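/- Let $\tau,\alpha,\mu,l>0$ and $\gamma_l\ge 0$, and put $\beta=\alpha/\tau$, $\theta=\mu^2/\tau$, $$\omega_{1,2}(k)=\frac{1+\mu^2k^2\pm\sqrt{(1+\mu^2k^2)^2-4\alpha\tau k^2}}{2\tau},\qquad k\in\mathbb C,$$ $$\sigma_l^{(1)}(k)=ik(\beta-\theta\omega_1)+\gamma_l(\omega_2-\theta k^2),\qquad \sigma_l^{(2)}(k)=ik(\beta-\theta\omega_2)+\gamma_l(\omega_1-\theta k^2),$$ $$\Delta_m'(k)=e^{ikl}\sigma_l^{(m)}(k)+e^{-ikl}\sigma_l^{(m)}(-k),\qquad \tilde g^{(m)}(t)=\int_0^t e^{-\omega_m(k)(t-s)}g(s)\,ds\qquad(m=1,2),$$ $$S(k)=\frac1{\omega_1-\omega_2}\begin{pmatrix}1&1\\ \omega_1/ik&\omega_2/ik\end{pmatrix},$$ $$a'(k,t)=\begin{pmatrix}-E_1+(\omega_2-\theta k^2)\tilde g^{(1)}(t)\\ E_2-(\omega_1-\theta k^2)\tilde g^{(2)}(t)\end{pmatrix},\qquad b'(k,t)=\begin{pmatrix}\sigma_l^{(1)}(-k)\,\tilde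 e^{(1)}\\ -\sigma_l^{(2)}(-k)\,\tilde e^{(2)}\end{pmatrix},$$ where, for $(m,m')=(1,2),(2,1)$, $$E_m=\frac{e^{ikl}\sigma_l^{(m)}(k)-e^{-ikl}\sigma_l^{(m)}(-k)}{\Delta_m'(k)}(\omega_{m'}-\theta k^2)\tilde g^{(m)}(t),\qquad \tilde e^{(m)}=\frac{2}{\Delta_m'(k)}(\omega_{m'}-\theta k^2)\tilde g^{(m)}(t).$$ Call $k$ regular if, for $(m,m')=(1,2),(2,1)$, $\Delta_m'(k)\neq0$ or $\omega_{m'}(k)-\theta k^2=0$ (in the latter case the terms containing that factor are read as $0$, also when $\Delta_m'(k)=0$). Let $D=\{k:\operatorname{Re}\omega_1(k)<0\text{ or }\operatorname{Re}\omega_2(k)<0\}$. For $R>0$ let $D_0^\pm=\{k\in D:\pm\operatorname{Im}k>0,\ |k|>R\}$, with boundary $\partial D_0^\pm$ oriented so that $D_0^\pm$ lies to the left. Call $R>0$ admissible if every $k\in\overline D$ with $|k|\ge R$ is regular. Then: 1. For every $g$, $t$ and every regular $k$, $$S(k)a'(k,t)=e^{-ikl}S(k)b'(k,t)=\frac{2e^{-ikl}}{\omega_1-\omega_2}\left[\begin{pmatrix}1\\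 \omega_1/ik\end{pmatrix}\frac{\sigma_l^{(1)}(-k)}{\Delta_1'(k)}(\omega_2-\theta k^2)\tilde g^{(1)}(t)-\begin{pmatrix}1\\ \omega_2/ik\end{pmatrix}\frac{\sigma_l^{(2)}(-k)}{\Delta_2'(k)}(\omega_1-\theta k^2)\tilde g^{(2)}(t)\right].$$ 2. All sufficiently large $R$ are admissible. 3. For every $R>0$ the boundary of $D_0^+$ consists of one curve: it comes from infinity in the second quadrant along $\partial D$, follows the circle $|k|=R$ clockwise above the origin, and returns to infinity in the first quadrant along $\partial D$. The boundary of $D_0^-$ is the image of this curve under $k\mapsto-k$. 4. Let $R$ be admissible and let $(e,q)$ be a classical solution of $$\partial_te+\partial_xq=0,\qquad \tau\partial_tq+q-\mu^2\partial_x^2q+\alpha\partial_xe=0,\qquad 0<x<l,\ t>0,$$ $$e|_{t=0}=q|_{t=0}=0,\qquad q(0,t)=g(t),\qquad q(l,t)=\gamma_l\,e(l,t)\quad(t>0),$$ that is, $e,q$ are $C^1$ and $q$ is $C^2$ in $x$ for $0<x<l$, $t>0$; $e,q$ are continuous on $[0,l]\times[0,\infty)$ except possibly at the corners $(0,0)$,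 $(l,0)$, and bounded on $[0,l]\times[0,T]$ for every $T$. Then for all $0<x\le l$ and $t>0$ $$\begin{pmatrix}e(x,t)\\ q(x,t)\end{pmatrix}=-\frac1{2\pi}\int_{\partial D_0^+}e^{ikx}S(k)a'(k,t)\,dk-\frac1{2\pi}\int_{\partial D_0^-}e^{ikx}e^{-ikl}S(k)b'(k,t)\,dk,$$ and both integrals converge absolutely. -/

import Mathlib

open Real Set MeasureTheory Filter Topology
open scoped Matrix

/-- Coefficients of the one-dimensional Guyer–Krumhansl problem: relaxation time `τ`, diffusivity
`α`, length parameter `μ`, heat exchange coefficient `γ` at the right end, length `l` of the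
interval. Sign conditions are stated where they are used. -/
structure GKParams where
  τ : ℝ
  α : ℝ
  μ : ℝ
  γ : ℝ
  l : ℝ

namespace GKParams

noncomputable section

/-- `β = α / τ`. -/
def beta (p : GKParams) : ℂ := (p.α : ℂ) / (p.τ : ℂ)

/-- `θ = μ² / τ`. -/
def theta (p : GKParams) : ℂ := (p.μ : ℂ) ^ 2 / (p.τ : ℂ)

/-! ### Dispersion relations -/

/-- The square root (principal branch) in the dispersion relations. -/
def disc (p : GKParams) (k : ℂ) : ℂ :=
  Complex.sqrt ((1 + (p.μ : ℂ) ^ 2 * k ^ 2) ^ 2 - 4 * (p.α : ℂ) * (p.τ : ℂ) * k ^ 2)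

def omega1 (p : GKParams) (k : ℂ) : ℂ :=
  (1 + (p.μ : ℂ) ^ 2 * k ^ 2 + p.disc k) / (2 * (p.τ : ℂ))

def omega2 (p : GKParams) (k : ℂ) : ℂ :=
  (1 + (p.μ : ℂ) ^ 2 * k ^ 2 - p.disc k) / (2 * (p.τ : ℂ))

/-! ### The integrands -/

/-- The matrix `S(k)` of eigenvectors. -/
def S (p : GKParams) (k : ℂ) : Matrix (Fin 2) (Fin 2) ℂ :=
  (1 / (p.omega1 k - p.omega2 k)) •
    !![1, 1; p.omega1 k / (Complex.I * k), p.omega2 k / (Complex.I * k)]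

/-- `σ_l⁽¹⁾(k)`. -/
def sigma1 (p : GKParams) (k : ℂ) : ℂ :=
  Complex.I * k * (p.beta - p.theta * p.omega1 k) + (p.γ : ℂ) * (p.omega2 k - p.theta * k ^ 2)

/-- `σ_l⁽²⁾(k)`. -/
def sigma2 (p : GKParams) (k : ℂ) : ℂ :=
  Complex.I * k * (p.beta - p.theta * p.omega2 k) + (p.γ : ℂ) * (p.omega1 k - p.theta * k ^ 2)

/-- `e^{ikl}`. -/
def expL (p : GKParams) (k : ℂ) : ℂ := Complex.exp (Complex.I * k * (p.l : ℂ))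

/-- `Δ₁'(k)`. -/
def Delta1 (p : GKParams) (k : ℂ) : ℂ :=
  p.expL k * p.sigma1 k + p.expL (-k) * p.sigma1 (-k)

/-- `Δ₂'(k)`. -/
def Delta2 (p : GKParams) (k : ℂ) : ℂ :=
  p.expL k * p.sigma2 k + p.expL (-k) * p.sigma2 (-k)

/-- The time transform `∫₀ᵗ e^{-ω(t-s)} g(s) ds`. -/
def timeTransform (g : ℝ → ℝ) (ω : ℂ) (t : ℝ) : ℂ :=
  ∫ s in (0 : ℝ)..t, Complex.exp (-ω * ((t : ℂ) - (s : ℂ))) * (g s : ℂ)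

/-- `g̃⁽¹⁾(t)`. -/
def gT1 (p : GKParams) (g : ℝ → ℝ) (k : ℂ) (t : ℝ) : ℂ := timeTransform g (p.omega1 k) t

/-- `g̃⁽²⁾(t)`. -/
def gT2 (p : GKParams) (g : ℝ → ℝ) (k : ℂ) (t : ℝ) : ℂ := timeTransform g (p.omega2 k) t

/-- The product `ik(β - θω₁) ẽ₀⁽¹⁾(0,t)`. -/
def eLeft1 (p : GKParams) (g : ℝ → ℝ) (k : ℂ) (t : ℝ) : ℂ :=
  1 / p.Delta1 k * (p.expL k * p.sigma1 k - p.expL (-k) * p.sigma1 (-k)) *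
    (p.omega2 k - p.theta * k ^ 2) * p.gT1 g k t

/-- The product `ik(β - θω₂) ẽ₀⁽²⁾(0,t)`. -/
def eLeft2 (p : GKParams) (g : ℝ → ℝ) (k : ℂ) (t : ℝ) : ℂ :=
  1 / p.Delta2 k * (p.expL k * p.sigma2 k - p.expL (-k) * p.sigma2 (-k)) *
    (p.omega1 k - p.theta * k ^ 2) * p.gT2 g k t

/-- `ẽ₀⁽¹⁾(l,t)`. -/
def eRight1 (p : GKParams) (g : ℝ → ℝ) (k : ℂ) (t : ℝ) : ℂ :=
  1 / p.Delta1 k * 2 * (p.omega2 k - p.theta * k ^ 2) * p.gT1 g k t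

/-- `ẽ₀⁽²⁾(l,t)`. -/
def eRight2 (p : GKParams) (g : ℝ → ℝ) (k : ℂ) (t : ℝ) : ℂ :=
  1 / p.Delta2 k * 2 * (p.omega1 k - p.theta * k ^ 2) * p.gT2 g k t

/-- The vector `a'(k,t)`. -/
def aVec (p : GKParams) (g : ℝ → ℝ) (k : ℂ) (t : ℝ) : Fin 2 → ℂ :=
  ![-p.eLeft1 g k t + (p.omega2 k - p.theta * k ^ 2) * p.gT1 g k t,
    p.eLeft2 g k t - (p.omega1 k - p.theta * k ^ 2) * p.gT2 g k t]

/-- The vector `b'(k,t)`. -/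
def bVec (p : GKParams) (g : ℝ → ℝ) (k : ℂ) (t : ℝ) : Fin 2 → ℂ :=
  ![p.sigma1 (-k) * p.eRight1 g k t, -(p.sigma2 (-k) * p.eRight2 g k t)]

/-- The explicit common value of `S a'` and `e^{-ikl} S b'`. -/
def explicitIntegrand (p : GKParams) (g : ℝ → ℝ) (k : ℂ) (t : ℝ) : Fin 2 → ℂ :=
  (2 * p.expL (-k) / (p.omega1 k - p.omega2 k)) •
    ((p.sigma1 (-k) / p.Delta1 k * (p.omega2 k - p.theta * k ^ 2) * p.gT1 g k t) •
        ![1, p.omega1 k / (Complex.I * k)] -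
      (p.sigma2 (-k) / p.Delta2 k * (p.omega1 k - p.theta * k ^ 2) * p.gT2 g k t) •
        ![1, p.omega2 k / (Complex.I * k)])

/-! ### The contours -/

/-- `D = {k : Re ω₁(k) < 0 or Re ω₂(k) < 0}`. -/
def D (p : GKParams) : Set ℂ := {k | (p.omega1 k).re < 0 ∨ (p.omega2 k).re < 0}

/-- `D₀⁺`: the part of `D` in the upper half-plane outside the disc of radius `R` about `0`. -/
def D0Plus (p : GKParams) (R : ℝ) : Set ℂ := {k | k ∈ p.D ∧ 0 < k.im ∧ R < ‖k‖}

/-- `D₀⁻`: the part of `D` in the lower half-plane outside the disc of radius `R` about `0`. -/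
def D0Minus (p : GKParams) (R : ℝ) : Set ℂ := {k | k ∈ p.D ∧ k.im < 0 ∧ R < ‖k‖}

/-- The angle at which the circle of radius `r` about `0` enters `D` in the open first quadrant:
`D` meets the upper half of that circle in the arc of arguments between `boundaryAngle r` and
`π - boundaryAngle r`. -/
def boundaryAngle (p : GKParams) (r : ℝ) : ℝ :=
  sInf {φ : ℝ | φ ∈ Ioo 0 (π / 2) ∧ (r : ℂ) * Complex.exp (Complex.I * (φ : ℂ)) ∈ p.D}

/-- Parametrization of `∂D₀⁺` by `s ∈ ℝ`, with `D₀⁺` on the left: it comes from infinity along the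
part of `∂D⁺` in the second quadrant (`s ≤ -R`), follows the circle `|k| = R` clockwise above the
origin (`-R < s < R`), and returns to infinity along `∂D⁺` in the first quadrant (`R ≤ s`). -/
def contourPlus (p : GKParams) (R s : ℝ) : ℂ :=
  if R ≤ s then
    (s : ℂ) * Complex.exp (Complex.I * (p.boundaryAngle s : ℂ))
  else if s ≤ -R then
    ((-s : ℝ) : ℂ) * Complex.exp (Complex.I * ((π - p.boundaryAngle (-s) : ℝ) : ℂ))
  else
    (R : ℂ) * Complex.exp (Complex.I * ((π / 2 - s / R * (π / 2 - p.boundaryAngle R) : ℝ) : ℂ))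

/-- Parametrization of `∂D₀⁻`: the image of `∂D₀⁺` under the rotation `k ↦ -k`, which maps `D₀⁺`
onto `D₀⁻` and so keeps the domain on the left. -/
def contourMinus (p : GKParams) (R s : ℝ) : ℂ := -p.contourPlus R s

/-- `f` is absolutely integrable along the path `c`. -/
def PathIntegrable (c : ℝ → ℂ) (f : ℂ → Fin 2 → ℂ) : Prop :=
  Integrable (fun s : ℝ => deriv c s • f (c s)) volume

/-- `∫_c f(k) dk`. -/
def pathIntegral (c : ℝ → ℂ) (f : ℂ → Fin 2 → ℂ) : Fin 2 → ℂ :=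
  ∫ s : ℝ, deriv c s • f (c s)

/-- The bracket in the integrand has no pole at `k`: `Δ₁'`, `Δ₂'` do not vanish at `k`, unless the
factor that accompanies the quotient vanishes too (for `k ≠ 0` the latter occurs only if
`ατ = μ²`, when one of the branches `ω_m` takes the value `1/τ` and its term is absent). -/
def RegularAt (p : GKParams) (k : ℂ) : Prop :=
  (p.omega2 k - p.theta * k ^ 2 ≠ 0 → p.Delta1 k ≠ 0) ∧
    (p.omega1 k - p.theta * k ^ 2 ≠ 0 → p.Delta2 k ≠ 0)

/-- `R` is an admissible radius for passing from `∂D^±` to `∂D₀^±`: all poles of the integrands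
that lie in the closure of `D` are within the excised disc. -/
def Admissible (p : GKParams) (R : ℝ) : Prop :=
  0 < R ∧ ∀ k ∈ closure p.D, R ≤ ‖k‖ → p.RegularAt k

/-! ### The initial-boundary value problem -/

/-- The open domain `0 < x < l`, `t > 0`. -/
def openStrip (p : GKParams) : Set (ℝ × ℝ) := Ioo 0 p.l ×ˢ Ioi 0

/-- The closed domain `0 ≤ x ≤ l`, `t ≥ 0` without its two corners. -/
def closedStrip (p : GKParams) : Set (ℝ × ℝ) := (Icc 0 p.l ×ˢ Ici 0) \ {(0, 0), (p.l, 0)}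

/-- Classical solutions `(e, q)` of the problem with zero source, zero initial state, flux `g` at
the left end and Newton's law at the right end. No compatibility of `g` with the initial state is
asked for: at the corners `e` and `q` need only stay bounded. -/
structure IsSolution (p : GKParams) (g : ℝ → ℝ) (e q : ℝ → ℝ → ℝ) : Prop where
  e_cont : ContinuousOn (Function.uncurry e) p.closedStrip
  q_cont : ContinuousOn (Function.uncurry q) p.closedStrip
  bounded : ∀ T : ℝ, ∃ M : ℝ, ∀ x ∈ Icc 0 p.l, ∀ t ∈ Icc 0 T, |e x t| ≤ M ∧ |q x t| ≤ M
  e_smooth : ContDiffOn ℝ 1 (Function.uncurry e) p.openStrip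
  q_smooth : ContDiffOn ℝ 1 (Function.uncurry q) p.openStrip
  q_smooth_x : ∀ t > 0, ContDiffOn ℝ 2 (fun x => q x t) (Ioo 0 p.l)
  balance : ∀ x ∈ Ioo 0 p.l, ∀ t > 0,
    deriv (fun s => e x s) t + deriv (fun y => q y t) x = 0
  constitutive : ∀ x ∈ Ioo 0 p.l, ∀ t > 0,
    p.τ * deriv (fun s => q x s) t + q x t - p.μ ^ 2 * iteratedDeriv 2 (fun y => q y t) x
      + p.α * deriv (fun y => e y t) x = 0
  initial : ∀ x ∈ Ioo 0 p.l, e x 0 = 0 ∧ q x 0 = 0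
  left_flux : ∀ t > 0, q 0 t = g t
  right_newton : ∀ t > 0, q p.l t = p.γ * e p.l t

end

end GKParams

/-! The formula is verified through Laplace transforms in time: the solution and the contour
integrals have the same truncated transform up to an exponentially small error, and such a transform
determines a function.

Algebra. With `ra = 1/τ`, `rb = β`, `rc = θ` the branches satisfy `ω₁ + ω₂ = ra + rc k²` and `ω₁ ω₂
= rb k²`. The product relation makes each `σ` and `Δ'` divisible by the factor `ω_{m'} - θ k²`,
which therefore cancels from the quotients. The two integrands coincide because `1 - (A - B) / (A +
B) = 2 B / (A + B)`.

Geometry. `ω₁` is a Möbius image of `ω₂` that lies in the right half-plane whenever `ω₂` lies in the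
left one; hence `Re ω₁ > 0` everywhere and `D = {Re ω₂ < 0}`. A Hurwitz determinant turns this into
`Re k² < reBound |k|`: on every circle `D` is a pair of arcs about the imaginary axis, uniformly
away from the real axis (`abs_cosBound_le`). Polar coordinates adapted to these arcs describe the
boundary and give Cauchy's theorem (`integral_contourPlus_eq_zero`) and the residue theorem at a
point `iκ` (`integral_contourPlus_pole`). In the closure of the upper half of `D`, `e^{ikx}` decays
exponentially, `ω₁` stays bounded and `ω₂` grows like `θ k²`; so the poles there are bounded
(`exists_le_norm_dhat`) and the integrands decay.

Contour side. The reflection `k ↦ -k` moves the lower integral to the upper contour. The terms with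
`ω₁` vanish by Cauchy's theorem, since their time transforms stay bounded. What remains is a
superposition of the time transforms with `ω₂`, whose Laplace transform at `y` is that of `g` times
an integral of `weight / (y + ω₂)`, up to an error at the final time. Because `(y + ω₁)(y + ω₂) =
(rc y + rb)(k² + κ²)`, that integral is one residue at `iκ` (`integral_weight_div`).

Equation side. Multiplying the system by `e^{±κx - yt}` and integrating over `[x, l] × [0, T]` gives
two global relations. With the boundary conditions they can be solved for the transforms of `e` and
`q`, with the same factor in front of the transform of `g` (`lap_asymptotics`). The errors are of
size `e^{-yT}` times `e^{O(√y)}`, hence `O(e^{-yT'})` for each `T' < T`. The uniqueness statement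
`eq_zero_of_laplace_le`, a consequence of Phragmén–Lindelöf, Liouville and Riemann–Lebesgue, then
yields equality on `(0, T')`. -/

/-- The sign conditions on the coefficients. -/
structure GKParams.IsPhysical (p : GKParams) : Prop where
  τ_pos : 0 < p.τ
  α_pos : 0 < p.α
  μ_pos : 0 < p.μ
  γ_nonneg : 0 ≤ p.γ
  l_pos : 0 < p.l

namespace GKParams

noncomputable section

/-! ### Dispersion relations -/

/-- The relaxation rate `1 / τ`. -/
def ra (p : GKParams) : ℝ := 1 / p.τ

/-- The real number `β`. -/
def rb (p : GKParams) : ℝ := p.α / p.τ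

/-- The real number `θ`. -/
def rc (p : GKParams) : ℝ := p.μ ^ 2 / p.τ

variable {p : GKParams}

lemma IsPhysical.ra_pos (hp : p.IsPhysical) : 0 < p.ra := one_div_pos.2 hp.τ_pos

lemma IsPhysical.rb_pos (hp : p.IsPhysical) : 0 < p.rb := div_pos hp.α_pos hp.τ_pos

lemma IsPhysical.rc_pos (hp : p.IsPhysical) : 0 < p.rc := div_pos (pow_pos hp.μ_pos 2) hp.τ_pos

lemma beta_eq (p : GKParams) : p.beta = (p.rb : ℂ) := by simp [beta, rb]

lemma theta_eq (p : GKParams) : p.theta = (p.rc : ℂ) := by simp [theta, rc]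

lemma disc_sq (p : GKParams) (k : ℂ) :
    p.disc k ^ 2 = (1 + (p.μ : ℂ) ^ 2 * k ^ 2) ^ 2 - 4 * (p.α : ℂ) * (p.τ : ℂ) * k ^ 2 := by
  rw [disc, Complex.sqrt]
  exact Complex.cpow_ofNat_inv_pow _ 2

lemma disc_neg (p : GKParams) (k : ℂ) : p.disc (-k) = p.disc k := by simp [disc]

lemma omega1_neg (p : GKParams) (k : ℂ) : p.omega1 (-k) = p.omega1 k := by
  simp [omega1, disc_neg]

lemma omega2_neg (p : GKParams) (k : ℂ) : p.omega2 (-k) = p.omega2 k := by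
  simp [omega2, disc_neg]

lemma Delta1_neg (p : GKParams) (k : ℂ) : p.Delta1 (-k) = p.Delta1 k := by
  simp only [Delta1, neg_neg]; ring

lemma Delta2_neg (p : GKParams) (k : ℂ) : p.Delta2 (-k) = p.Delta2 k := by
  simp only [Delta2, neg_neg]; ring

lemma re_sqrt_nonneg (z : ℂ) : 0 ≤ (Complex.sqrt z).re := by
  rw [Complex.sqrt, Complex.cpow_inv_two_re]
  positivity

lemma omega_add (hp : p.IsPhysical) (k : ℂ) :
    p.omega1 k + p.omega2 k = p.ra + p.rc * k ^ 2 := by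
  have : (p.τ : ℂ) ≠ 0 := by exact_mod_cast hp.τ_pos.ne'
  simp only [omega1, omega2, ra, rc]
  push_cast
  field_simp
  ring

lemma omega_mul (hp : p.IsPhysical) (k : ℂ) : p.omega1 k * p.omega2 k = p.rb * k ^ 2 := by
  have h0 : (p.τ : ℂ) ≠ 0 := by exact_mod_cast hp.τ_pos.ne'
  have h := p.disc_sq k
  simp only [omega1, omega2, rb]
  push_cast
  field_simp
  linear_combination -h

lemma omega_sub (hp : p.IsPhysical) (k : ℂ) :
    p.omega1 k - p.omega2 k = p.disc k / p.τ := by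
  have : (p.τ : ℂ) ≠ 0 := by exact_mod_cast hp.τ_pos.ne'
  simp only [omega1, omega2]
  field_simp
  ring

lemma re_omega2_le (hp : p.IsPhysical) (k : ℂ) : (p.omega2 k).re ≤ (p.omega1 k).re := by
  have h : 0 ≤ (p.omega1 k - p.omega2 k).re := by
    rw [omega_sub hp, Complex.div_ofReal_re]
    exact div_nonneg (re_sqrt_nonneg _) hp.τ_pos.le
  simpa using h

/-- The branch `ω₁` never leaves the open right half-plane. -/
lemma re_omega1_pos (hp : p.IsPhysical) (k : ℂ) : 0 < (p.omega1 k).re := by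
  by_contra! h
  have h2 := (re_omega2_le hp k).trans h
  have ha := hp.ra_pos
  have hb := hp.rb_pos
  have hc := hp.rc_pos
  -- Eliminating `k ^ 2` from sum and product gives `ω₁ = rb (ra - ω₂) / (rb - rc ω₂)`, a Möbius map
  -- taking the closed left half-plane into the open right one. The identity `e` below is the real
  -- part of this, cleared of the denominator.
  have key : p.omega1 k * (p.rc * p.omega2 k - p.rb) = p.rb * (p.omega2 k - p.ra) := by
    linear_combination (p.rc : ℂ) * omega_mul hp k - (p.rb : ℂ) * omega_add hp k
  have hre := congrArg Complex.re key
  have him := congrArg Complex.im key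
  simp at hre him
  generalize (p.omega1 k).re = x1 at *
  generalize (p.omega1 k).im = y1 at *
  generalize (p.omega2 k).re = x2 at *
  generalize (p.omega2 k).im = y2 at *
  have e : x1 * ((p.rc * x2 - p.rb) ^ 2 + (p.rc * y2) ^ 2) =
      p.rb * ((p.ra - x2) * (p.rb - p.rc * x2) + p.rc * y2 ^ 2) := by
    linear_combination (p.rc * x2 - p.rb) * hre + p.rc * y2 * him
  have h3 : x1 * ((p.rc * x2 - p.rb) ^ 2 + (p.rc * y2) ^ 2) ≤ 0 :=
    mul_nonpos_of_nonpos_of_nonneg h (by positivity)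
  have h4 : 0 < p.ra - x2 := by linarith
  have h5 : 0 < p.rb - p.rc * x2 := by nlinarith
  have h6 : 0 < p.rb * ((p.ra - x2) * (p.rb - p.rc * x2) + p.rc * y2 ^ 2) := by positivity
  linarith

lemma mem_D_iff_re (hp : p.IsPhysical) (k : ℂ) : k ∈ p.D ↔ (p.omega2 k).re < 0 := by
  simp [D, (re_omega1_pos hp k).le.not_gt]

/-! ### The domain `D` -/

/-- The Hurwitz determinant of the dispersion relation, divided by `β`, in terms of
`X = Re k²` and `q = |k|⁴`. -/
def hurwitz (p : GKParams) (X q : ℝ) : ℝ :=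
  (p.ra * p.rc + p.rb) * X ^ 2 + (p.ra ^ 2 + p.rc ^ 2 * q) * X + (p.ra * p.rc - p.rb) * q

/-- `D` consists of the `k` with `Re k² < reBound |k|`. -/
def reBound (p : GKParams) (r : ℝ) : ℝ :=
  (-(p.ra ^ 2 + p.rc ^ 2 * r ^ 4) +
    √((p.ra ^ 2 - p.rc ^ 2 * r ^ 4) ^ 2 + 4 * p.rb ^ 2 * r ^ 4)) / (2 * (p.ra * p.rc + p.rb))

lemma norm_pow_four (k : ℂ) : ‖k‖ ^ 4 = (k ^ 2).re ^ 2 + (k ^ 2).im ^ 2 := by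
  have h : ‖k ^ 2‖ ^ 2 = (k ^ 2).re ^ 2 + (k ^ 2).im ^ 2 := by
    rw [Complex.sq_norm, Complex.normSq_apply]; ring
  rw [← h, norm_pow]; ring

/-- For the sum `S` and product `P` of two numbers, `Re S * Re (S * conj P) - (Im P)^2` factors in
this way identically. As `Re ω₁ > 0`, the sign of `hurwitz` is that of `Re ω₂` wherever the last
factor does not vanish. -/
lemma rb_mul_hurwitz (hp : p.IsPhysical) (k : ℂ) :
    p.rb * p.hurwitz (k ^ 2).re (‖k‖ ^ 4) = (p.omega1 k).re * (p.omega2 k).re *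
      (((p.omega1 k).re + (p.omega2 k).re) ^ 2 + ((p.omega1 k).im - (p.omega2 k).im) ^ 2) := by
  have h1 := congrArg Complex.re (omega_add hp k)
  have h2 := congrArg Complex.im (omega_add hp k)
  have h3 := congrArg Complex.re (omega_mul hp k)
  have h4 := congrArg Complex.im (omega_mul hp k)
  simp only [Complex.add_re, Complex.add_im, Complex.mul_re, Complex.mul_im, Complex.ofReal_re,
    Complex.ofReal_im, zero_mul, sub_zero, add_zero, zero_add] at h1 h2 h3 h4
  rw [norm_pow_four]
  generalize (k ^ 2).re = X at *
  generalize (k ^ 2).im = Y at *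
  have e : p.rb * p.hurwitz X (X ^ 2 + Y ^ 2) =
      (p.ra + p.rc * X) * ((p.ra + p.rc * X) * (p.rb * X) + (p.rc * Y) * (p.rb * Y))
        - (p.rb * Y) ^ 2 := by
    unfold hurwitz; ring
  rw [e, ← h1, ← h2, ← h3, ← h4]
  ring

lemma reBound_sq (p : GKParams) (X r : ℝ) :
    4 * (p.ra * p.rc + p.rb) * p.hurwitz X (r ^ 4) =
      (2 * (p.ra * p.rc + p.rb) * X + (p.ra ^ 2 + p.rc ^ 2 * r ^ 4)) ^ 2 -
      √((p.ra ^ 2 - p.rc ^ 2 * r ^ 4) ^ 2 + 4 * p.rb ^ 2 * r ^ 4) ^ 2 := by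
  rw [Real.sq_sqrt (by positivity)]
  unfold hurwitz
  ring

lemma lt_reBound_iff (hp : p.IsPhysical) (X r : ℝ) :
    X < p.reBound r ↔ 2 * (p.ra * p.rc + p.rb) * X + (p.ra ^ 2 + p.rc ^ 2 * r ^ 4) <
      √((p.ra ^ 2 - p.rc ^ 2 * r ^ 4) ^ 2 + 4 * p.rb ^ 2 * r ^ 4) := by
  have := hp.ra_pos
  have := hp.rb_pos
  have := hp.rc_pos
  rw [reBound, lt_div_iff₀ (by positivity)]
  constructor <;> intro h <;> linarith

/-- On the circle of radius `r` the least value of `Re k²` is `-r²`, and there `hurwitz` is minus a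
square. So `-r²` lies between the two roots in `X`, and only the larger one, `reBound r`, can bound
`D`. -/
lemma neg_sqrt_le (hp : p.IsPhysical) {X r : ℝ} (hX : -r ^ 2 ≤ X) :
    -√((p.ra ^ 2 - p.rc ^ 2 * r ^ 4) ^ 2 + 4 * p.rb ^ 2 * r ^ 4) ≤
      2 * (p.ra * p.rc + p.rb) * X + (p.ra ^ 2 + p.rc ^ 2 * r ^ 4) := by
  have ha := hp.ra_pos
  have hb := hp.rb_pos
  have hc := hp.rc_pos
  have h := reBound_sq p (-r ^ 2) r
  have hm : 0 < p.ra * p.rc + p.rb := by positivity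
  have h1 : p.hurwitz (-r ^ 2) (r ^ 4) ≤ 0 := by
    have : p.hurwitz (-r ^ 2) (r ^ 4) = -(r * (p.ra - p.rc * r ^ 2)) ^ 2 := by
      unfold hurwitz; ring
    rw [this]; nlinarith [sq_nonneg (r * (p.ra - p.rc * r ^ 2))]
  have h2 := abs_le_of_sq_le_sq' (a := 2 * (p.ra * p.rc + p.rb) * (-r ^ 2) +
    (p.ra ^ 2 + p.rc ^ 2 * r ^ 4)) (b := √((p.ra ^ 2 - p.rc ^ 2 * r ^ 4) ^ 2 +
    4 * p.rb ^ 2 * r ^ 4)) (by nlinarith) (Real.sqrt_nonneg _)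
  nlinarith [h2.1]

lemma neg_sq_norm_le (k : ℂ) : -‖k‖ ^ 2 ≤ (k ^ 2).re := by
  have := Complex.abs_re_le_norm (k ^ 2)
  rw [norm_pow] at this
  linarith [(abs_le.1 this).1]

/-- Apart from degenerate points this is the sign rule of `rb_mul_hurwitz` together with
`neg_sqrt_le`. Both directions argue by contradiction and end in a degenerate configuration that is
excluded by hand. -/
lemma mem_D_iff (hp : p.IsPhysical) (k : ℂ) : k ∈ p.D ↔ (k ^ 2).re < p.reBound ‖k‖ := by
  have ha := hp.ra_pos
  have hb := hp.rb_pos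
  have hc := hp.rc_pos
  have hm : 0 < p.ra * p.rc + p.rb := by positivity
  rw [mem_D_iff_re hp, lt_reBound_iff hp]
  have h1 := rb_mul_hurwitz hp k
  have h2 := reBound_sq p (k ^ 2).re ‖k‖
  have h3 := neg_sqrt_le hp (neg_sq_norm_le k)
  have ho := re_omega1_pos hp k
  have hs := Real.sqrt_nonneg ((p.ra ^ 2 - p.rc ^ 2 * ‖k‖ ^ 4) ^ 2 + 4 * p.rb ^ 2 * ‖k‖ ^ 4)
  have hss := Real.sq_sqrt (show 0 ≤ (p.ra ^ 2 - p.rc ^ 2 * ‖k‖ ^ 4) ^ 2 +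
    4 * p.rb ^ 2 * ‖k‖ ^ 4 by positivity)
  have hre := congrArg Complex.re (omega_add hp k)
  have him := congrArg Complex.im (omega_mul hp k)
  simp only [Complex.add_re, Complex.mul_re, Complex.mul_im, Complex.ofReal_re,
    Complex.ofReal_im, zero_mul, sub_zero, add_zero] at hre him
  have hX := neg_sq_norm_le k
  have hr := norm_pow_four k
  set s := √((p.ra ^ 2 - p.rc ^ 2 * ‖k‖ ^ 4) ^ 2 + 4 * p.rb ^ 2 * ‖k‖ ^ 4)
  set w := 2 * (p.ra * p.rc + p.rb) * (k ^ 2).re + (p.ra ^ 2 + p.rc ^ 2 * ‖k‖ ^ 4) with hw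
  set f := p.hurwitz (k ^ 2).re (‖k‖ ^ 4)
  set x1 := (p.omega1 k).re
  set x2 := (p.omega2 k).re
  constructor
  · intro hx2
    by_contra! hws
    have hf : 0 ≤ f := by
      have : 0 ≤ 4 * (p.ra * p.rc + p.rb) * f := by
        rw [h2]; linarith [pow_le_pow_left₀ hs hws 2]
      exact nonneg_of_mul_nonneg_right this (by positivity)
    have hx12 : x1 * x2 < 0 := mul_neg_of_pos_of_neg ho hx2
    -- A negative product `x1 * x2` and `0 ≤ f` force the last factor of the Hurwitz identity to
    -- vanish. Then `k²` is the real number `-ra / rc`, where `w` is negative, against `0 ≤ s ≤ w`.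
    have h0 : (x1 + x2) ^ 2 + ((p.omega1 k).im - (p.omega2 k).im) ^ 2 ≤ 0 := by
      by_contra! h
      linarith [mul_neg_of_neg_of_pos hx12 h, mul_nonneg hb.le hf]
    have hS2 := sq_nonneg (x1 + x2)
    have hI2 := sq_nonneg ((p.omega1 k).im - (p.omega2 k).im)
    have hS : x1 + x2 = 0 := pow_eq_zero_iff two_ne_zero |>.1 (by linarith)
    have hI : (p.omega1 k).im - (p.omega2 k).im = 0 :=
      pow_eq_zero_iff two_ne_zero |>.1 (by linarith)
    have hY : (k ^ 2).im = 0 := by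
      have : p.rb * (k ^ 2).im = 0 := by
        rw [← him, sub_eq_zero.1 hI]; linear_combination (p.omega2 k).im * hS
      simpa [hb.ne'] using this
    have hXc : p.rc * (k ^ 2).re = -p.ra := by linarith
    have : p.rc * w = -2 * p.ra * p.rb := by
      rw [hw, hr, hY]
      linear_combination (2 * (p.ra * p.rc + p.rb) + p.rc * (p.rc * (k ^ 2).re - p.ra)) * hXc
    linarith [mul_pos ha hb, mul_nonneg hc.le (hs.trans hws)]
  · intro hws
    by_contra! hx2
    have hf : 0 ≤ f := by
      have : 0 ≤ p.rb * f := by rw [h1]; positivity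
      exact nonneg_of_mul_nonneg_right this hb
    have hsq : s ^ 2 ≤ w ^ 2 := by
      have : 0 ≤ 4 * (p.ra * p.rc + p.rb) * f := by positivity
      linarith
    -- From `s² ≤ w²` and `-s ≤ w < s` only the smaller root is left. It is attained only at `Re k²
    -- = -‖k‖²` with `hurwitz` zero, so that `k = 0` or `rc ‖k‖² = ra`; both contradict the signs.
    have hwm : w = -s := by
      by_contra hne
      have : -s < w := lt_of_le_of_ne h3 (Ne.symm hne)
      linarith [sq_lt_sq' this hws]
    have hmin := neg_sqrt_le hp (X := -‖k‖ ^ 2) (r := ‖k‖) le_rfl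
    have hXe : (k ^ 2).re = -‖k‖ ^ 2 := by
      refine le_antisymm ?_ hX
      have : 2 * (p.ra * p.rc + p.rb) * (k ^ 2).re ≤ 2 * (p.ra * p.rc + p.rb) * (-‖k‖ ^ 2) := by
        linarith
      exact le_of_mul_le_mul_left this (by positivity)
    have hzero : (‖k‖ * (p.ra - p.rc * ‖k‖ ^ 2)) ^ 2 = 0 := by
      have e1 : f = -(‖k‖ * (p.ra - p.rc * ‖k‖ ^ 2)) ^ 2 := by
        simp only [f, hXe]; unfold hurwitz; ring
      linarith [sq_nonneg (‖k‖ * (p.ra - p.rc * ‖k‖ ^ 2))]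
    rcases mul_eq_zero.1 (pow_eq_zero_iff two_ne_zero |>.1 hzero) with h | h
    · have : w = p.ra ^ 2 := by rw [hw, hXe, h]; ring
      linarith [pow_pos ha 2]
    · have : x1 + x2 = 0 := by rw [hre, hXe]; linarith
      linarith

/-- The principal root jumps across its cut, so boundary points are not reached as limits of `ω₂`.
Instead, on the boundary `hurwitz` vanishes, whereas `Re ω₂ > 0` would make it positive. -/
lemma re_omega2_nonpos (hp : p.IsPhysical) {k : ℂ} (hk : (k ^ 2).re ≤ p.reBound ‖k‖) :
    (p.omega2 k).re ≤ 0 := by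
  have ha := hp.ra_pos
  have hb := hp.rb_pos
  have hc := hp.rc_pos
  rcases hk.lt_or_eq with h | h
  · exact ((mem_D_iff_re hp k).1 ((mem_D_iff hp k).2 h)).le
  · by_contra! h2
    have h1 := re_omega1_pos hp k
    have e := rb_mul_hurwitz hp k
    have e2 := reBound_sq p (k ^ 2).re ‖k‖
    have e3 : 2 * (p.ra * p.rc + p.rb) * (k ^ 2).re + (p.ra ^ 2 + p.rc ^ 2 * ‖k‖ ^ 4) =
      √((p.ra ^ 2 - p.rc ^ 2 * ‖k‖ ^ 4) ^ 2 + 4 * p.rb ^ 2 * ‖k‖ ^ 4) := by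
      rw [h, reBound]; field_simp; ring
    rw [e3, sub_self] at e2
    have : p.hurwitz (k ^ 2).re (‖k‖ ^ 4) = 0 := by
      rcases mul_eq_zero.1 e2 with h | h
      · exact absurd h (by positivity)
      · exact h
    rw [this, mul_zero] at e
    have : 0 < (p.omega1 k).re * (p.omega2 k).re * (((p.omega1 k).re + (p.omega2 k).re) ^ 2 +
      ((p.omega1 k).im - (p.omega2 k).im) ^ 2) := by positivity
    linarith

/-- Off the imaginary axis of its radicand, `disc` is holomorphic; this covers the closure
of `D`. -/
lemma differentiableAt_disc (hp : p.IsPhysical) {k : ℂ} (hk : (k ^ 2).re ≤ p.reBound ‖k‖) :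
    DifferentiableAt ℂ p.disc k := by
  have h : 0 < (p.disc k).re := by
    have h1 := re_omega1_pos hp k
    have h2 := re_omega2_nonpos hp hk
    have h3 := congrArg Complex.re (omega_sub hp k)
    rw [Complex.div_ofReal_re, Complex.sub_re] at h3
    have h4 : 0 < (p.disc k).re / p.τ := by linarith
    exact (div_pos_iff_of_pos_right hp.τ_pos).1 h4
  -- On the cut the principal root is purely imaginary, contrary to `0 < Re disc`.
  have hs : (1 + (p.μ : ℂ) ^ 2 * k ^ 2) ^ 2 - 4 * (p.α : ℂ) * (p.τ : ℂ) * k ^ 2 ∈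
      Complex.slitPlane := by
    by_contra hn
    rw [Complex.mem_slitPlane_iff_not_le_zero, not_not] at hn
    obtain ⟨h5, h6⟩ := Complex.le_def.1 hn
    rw [disc, Complex.sqrt, Complex.cpow_inv_two_re] at h
    set z := (1 + (p.μ : ℂ) ^ 2 * k ^ 2) ^ 2 - 4 * (p.α : ℂ) * (p.τ : ℂ) * k ^ 2
    have hz : z = (z.re : ℂ) := Complex.ext rfl (by simpa using h6)
    have : ‖z‖ = -z.re := by
      rw [hz, Complex.norm_real, Complex.ofReal_re, Real.norm_eq_abs, abs_of_nonpos (by simpa using h5)]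
    simp [this] at h
  have := Complex.differentiableAt_sqrt hs
  unfold disc
  exact this.comp k (f := fun k => (1 + (p.μ : ℂ) ^ 2 * k ^ 2) ^ 2 - 4 * (p.α : ℂ) * (p.τ : ℂ) * k ^ 2)
    (by fun_prop)

lemma omega_sub_ne_zero (hp : p.IsPhysical) {k : ℂ} (hk : (k ^ 2).re ≤ p.reBound ‖k‖) :
    p.omega1 k - p.omega2 k ≠ 0 := fun h => by
  have h1 := re_omega1_pos hp k
  have h2 := re_omega2_nonpos hp hk
  have := congrArg Complex.re h
  simp at this
  linarith

lemma differentiableAt_omega1 (hp : p.IsPhysical) {k : ℂ} (hk : (k ^ 2).re ≤ p.reBound ‖k‖) :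
    DifferentiableAt ℂ p.omega1 k := by
  have := differentiableAt_disc hp hk
  unfold omega1
  fun_prop

lemma differentiableAt_omega2 (hp : p.IsPhysical) {k : ℂ} (hk : (k ^ 2).re ≤ p.reBound ‖k‖) :
    DifferentiableAt ℂ p.omega2 k := by
  have := differentiableAt_disc hp hk
  unfold omega2
  fun_prop

/-! ### The two integrands coincide -/

lemma S_mulVec (p : GKParams) (k : ℂ) (v : Fin 2 → ℂ) :
    p.S k *ᵥ v = (1 / (p.omega1 k - p.omega2 k)) •
      (v 0 • ![1, p.omega1 k / (Complex.I * k)] + v 1 • ![1, p.omega2 k / (Complex.I * k)]) := by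
  ext i
  fin_cases i <;> simp [S, Matrix.mulVec, dotProduct, Fin.sum_univ_two] <;> ring

/-- With `Δ = s₁ + s₂` one has `1 - (s₁ - s₂) / Δ = 2 s₂ / Δ`. If the accompanying factor `f` is
zero, both sides vanish whatever the value of `Δ`; this is why `RegularAt` suffices. -/
lemma aVec_eq (p : GKParams) (g : ℝ → ℝ) (k : ℂ) (t : ℝ) (hk : p.RegularAt k) :
    p.aVec g k t = p.expL (-k) • p.bVec g k t := by
  have key : ∀ Δ s₁ s₂ f G : ℂ, (f ≠ 0 → Δ ≠ 0) → Δ = s₁ + s₂ →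
      -(1 / Δ * (s₁ - s₂) * f * G) + f * G = 1 / Δ * 2 * s₂ * f * G := by
    intro Δ s₁ s₂ f G h1 h2
    by_cases hf : f = 0
    · simp [hf]
    · have := h1 hf
      field_simp
      rw [h2]; ring
  have h1 := key _ _ _ _ (p.gT1 g k t) hk.1 rfl
  have h2 := key _ _ _ _ (p.gT2 g k t) hk.2 rfl
  ext i
  fin_cases i
  · simp only [aVec, bVec, eLeft1, eRight1, Fin.zero_eta, Matrix.cons_val_zero, Pi.smul_apply,
      smul_eq_mul]
    rw [h1]; ring
  · simp only [aVec, bVec, eLeft2, eRight2, Fin.mk_one, Matrix.cons_val_one, Matrix.cons_val_zero,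
      Pi.smul_apply, smul_eq_mul]
    linear_combination -h2

lemma S_mulVec_bVec (p : GKParams) (g : ℝ → ℝ) (k : ℂ) (t : ℝ) :
    p.expL (-k) • (p.S k *ᵥ p.bVec g k t) = p.explicitIntegrand g k t := by
  rw [S_mulVec]
  ext i
  fin_cases i <;> simp [explicitIntegrand, bVec, eRight1, eRight2] <;> ring

/-! ### The boundary of `D` in polar coordinates -/

/-- The sum of the roots of the quadratic equation for `cosBound`, up to sign and a constant. -/
def cosCoeff (p : GKParams) (r : ℝ) : ℝ := p.ra ^ 2 / r ^ 2 + p.rc ^ 2 * r ^ 2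

/-- The root of the discriminant of the quadratic equation for `cosBound`. -/
def cosRoot (p : GKParams) (r : ℝ) : ℝ :=
  √(p.cosCoeff r ^ 2 + 4 * (p.rb ^ 2 - (p.ra * p.rc) ^ 2))

/-- `cos (2 φ)` where `φ` is the argument of the boundary point of `D` of modulus `r` in the first
quadrant. -/
def cosBound (p : GKParams) (r : ℝ) : ℝ :=
  (-p.cosCoeff r + p.cosRoot r) / (2 * (p.ra * p.rc + p.rb))

/-- Closed form of `boundaryAngle`. -/
def angle (p : GKParams) (r : ℝ) : ℝ := arccos (p.cosBound r) / 2

/-- The inequality of the arithmetic and geometric means. It keeps the discriminant in `cosRoot`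
above `4 rb²`, uniformly in `r`. -/
lemma two_mul_le_cosCoeff (p : GKParams) {r : ℝ} (hr : 0 < r) :
    2 * (p.ra * p.rc) ≤ p.cosCoeff r := by
  have h : p.cosCoeff r - 2 * (p.ra * p.rc) = (p.ra / r - p.rc * r) ^ 2 := by
    unfold cosCoeff; field_simp; ring
  nlinarith [sq_nonneg (p.ra / r - p.rc * r)]

lemma cosRoot_sq (hp : p.IsPhysical) {r : ℝ} (hr : 0 < r) :
    p.cosRoot r ^ 2 = p.cosCoeff r ^ 2 + 4 * (p.rb ^ 2 - (p.ra * p.rc) ^ 2) ∧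
      2 * p.rb ≤ p.cosRoot r := by
  have h := two_mul_le_cosCoeff p hr
  have ha := hp.ra_pos
  have hb := hp.rb_pos
  have hc := hp.rc_pos
  have hm : 0 < p.ra * p.rc := by positivity
  have h2 := pow_le_pow_left₀ (by positivity) h 2
  constructor
  · rw [cosRoot, Real.sq_sqrt]; nlinarith
  · rw [cosRoot]; apply Real.le_sqrt_of_sq_le; nlinarith

lemma cosRoot_pos (hp : p.IsPhysical) {r : ℝ} (hr : 0 < r) : 0 < p.cosRoot r := by
  linarith [(cosRoot_sq hp hr).2, hp.rb_pos]

lemma reBound_eq (hp : p.IsPhysical) {r : ℝ} (hr : 0 < r) :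
    p.reBound r = r ^ 2 * p.cosBound r := by
  have ha := hp.ra_pos
  have hb := hp.rb_pos
  have hc := hp.rc_pos
  have h : (p.ra ^ 2 - p.rc ^ 2 * r ^ 4) ^ 2 + 4 * p.rb ^ 2 * r ^ 4 =
      (r ^ 2) ^ 2 * (p.cosCoeff r ^ 2 + 4 * (p.rb ^ 2 - (p.ra * p.rc) ^ 2)) := by
    unfold cosCoeff; field_simp; ring
  rw [reBound, h, Real.sqrt_mul (by positivity), Real.sqrt_sq (by positivity), cosBound, cosRoot]
  have : r ^ 2 * p.cosCoeff r = p.ra ^ 2 + p.rc ^ 2 * r ^ 4 := by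
    unfold cosCoeff; field_simp
  field_simp
  linarith

/-- A bound for `|cosBound|`. -/
def cosMax (p : GKParams) : ℝ := |p.rb - p.ra * p.rc| / (p.rb + p.ra * p.rc)

lemma cosMax_lt_one (hp : p.IsPhysical) : p.cosMax < 1 := by
  have hb := hp.rb_pos
  have hm : 0 < p.ra * p.rc := mul_pos hp.ra_pos hp.rc_pos
  rw [cosMax, div_lt_one (by positivity), abs_lt]
  constructor <;> linarith

lemma cosMax_nonneg (hp : p.IsPhysical) : 0 ≤ p.cosMax := by
  have hb := hp.rb_pos
  have hm : 0 < p.ra * p.rc := mul_pos hp.ra_pos hp.rc_pos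
  unfold cosMax; positivity

/-- Rationalising the numerator gives `2 (rb - ra rc) / (cosCoeff + cosRoot)`, and the denominator
is at least `2 (rb + ra rc)`. The bound is below one and independent of `r`, so `D` stays in a fixed
double sector about the imaginary axis. -/
lemma abs_cosBound_le (hp : p.IsPhysical) {r : ℝ} (hr : 0 < r) : |p.cosBound r| ≤ p.cosMax := by
  have hb := hp.rb_pos
  have hm : 0 < p.ra * p.rc := mul_pos hp.ra_pos hp.rc_pos
  have h1 := two_mul_le_cosCoeff p hr
  obtain ⟨h2, h3⟩ := cosRoot_sq hp hr
  have h4 : p.cosBound r = 2 * (p.rb - p.ra * p.rc) / (p.cosCoeff r + p.cosRoot r) := by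
    have : p.cosCoeff r + p.cosRoot r ≠ 0 := by linarith
    rw [cosBound, div_eq_div_iff (by positivity) this]
    linear_combination h2
  rw [h4, abs_div, abs_mul, abs_two, abs_of_pos (show 0 < p.cosCoeff r + p.cosRoot r by linarith),
    cosMax, div_le_div_iff₀ (by linarith) (by linarith)]
  nlinarith [abs_nonneg (p.rb - p.ra * p.rc)]

lemma cosBound_mem (hp : p.IsPhysical) {r : ℝ} (hr : 0 < r) :
    -1 < p.cosBound r ∧ p.cosBound r < 1 :=
  abs_lt.1 ((abs_cosBound_le hp hr).trans_lt (cosMax_lt_one hp))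

lemma cos_two_angle (hp : p.IsPhysical) {r : ℝ} (hr : 0 < r) :
    cos (2 * p.angle r) = p.cosBound r := by
  obtain ⟨h1, h2⟩ := cosBound_mem hp hr
  rw [angle, mul_div_cancel₀ _ two_ne_zero, Real.cos_arccos h1.le h2.le]

lemma angle_pos (hp : p.IsPhysical) {r : ℝ} (hr : 0 < r) : 0 < p.angle r :=
  div_pos (Real.arccos_pos.2 (cosBound_mem hp hr).2) two_pos

lemma angle_lt (hp : p.IsPhysical) {r : ℝ} (hr : 0 < r) : p.angle r < π / 2 := by
  have := Real.arccos_lt_pi.2 (cosBound_mem hp hr).1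
  unfold angle; linarith

lemma contDiffAt_cosCoeff (p : GKParams) {r : ℝ} (hr : 0 < r) : ContDiffAt ℝ 2 p.cosCoeff r := by
  unfold cosCoeff
  have : r ^ 2 ≠ 0 := by positivity
  fun_prop (disch := assumption)

lemma contDiffAt_cosBound (hp : p.IsPhysical) {r : ℝ} (hr : 0 < r) :
    ContDiffAt ℝ 2 p.cosBound r := by
  have h := contDiffAt_cosCoeff p hr
  have h0 : p.cosCoeff r ^ 2 + 4 * (p.rb ^ 2 - (p.ra * p.rc) ^ 2) ≠ 0 := by
    rw [← (cosRoot_sq hp hr).1]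
    exact pow_ne_zero 2 (cosRoot_pos hp hr).ne'
  have h1 : ContDiffAt ℝ 2 p.cosRoot r := by
    unfold cosRoot
    exact ContDiffAt.sqrt (by fun_prop) h0
  unfold cosBound
  fun_prop

/-- Two derivatives are required because Cauchy's theorem is proved in polar coordinates, where a
form containing `deriv p.opening` is differentiated once more. -/
lemma contDiffAt_angle (hp : p.IsPhysical) {r : ℝ} (hr : 0 < r) : ContDiffAt ℝ 2 p.angle r := by
  obtain ⟨h1, h2⟩ := cosBound_mem hp hr
  unfold angle
  exact ((Real.contDiffAt_arccos h1.ne' h2.ne).comp r (contDiffAt_cosBound hp hr)).div_const 2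

lemma differentiableAt_angle (hp : p.IsPhysical) {r : ℝ} (hr : 0 < r) :
    DifferentiableAt ℝ p.angle r :=
  (contDiffAt_angle hp hr).differentiableAt (by norm_num)

lemma deriv_cosCoeff (p : GKParams) {r : ℝ} (hr : 0 < r) :
    HasDerivAt p.cosCoeff (2 * (-(p.ra ^ 2 / r ^ 2) + p.rc ^ 2 * r ^ 2) / r) r := by
  have h1 : HasDerivAt (fun r : ℝ => r ^ 2) (2 * r) r := by simpa using hasDerivAt_pow 2 r
  have h2 := ((hasDerivAt_const r (p.ra ^ 2)).div h1 (by positivity)).add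
    (h1.const_mul (p.rc ^ 2))
  refine h2.congr_deriv ?_
  field_simp
  ring

/-- Write `u = cosBound`, `P = cosCoeff`. Then `u' = -u P' / cosRoot`, while `|r P'| ≤ 2 P`, the
quotient `P / cosRoot` is bounded, and `√(1 - u²)` is bounded below by means of `cosMax`. This
scale-invariant estimate makes the speed of the contour bounded. -/
lemma exists_abs_mul_deriv_angle_le (hp : p.IsPhysical) :
    ∃ C, ∀ r > 0, |r * deriv p.angle r| ≤ C := by
  have hb := hp.rb_pos
  have hm : 0 < p.ra * p.rc := mul_pos hp.ra_pos hp.rc_pos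
  have hq : 0 < 1 - p.cosMax ^ 2 := by nlinarith [cosMax_lt_one hp, cosMax_nonneg hp]
  refine ⟨1 / √(1 - p.cosMax ^ 2) * (1 + p.ra * p.rc / p.rb), fun r hr => ?_⟩
  have hP := two_mul_le_cosCoeff p hr
  obtain ⟨hs, hsb⟩ := cosRoot_sq hp hr
  have hs0 := cosRoot_pos hp hr
  have hu := abs_cosBound_le hp hr
  obtain ⟨hu1, hu2⟩ := cosBound_mem hp hr
  set P' := 2 * (-(p.ra ^ 2 / r ^ 2) + p.rc ^ 2 * r ^ 2) / r
  have hdP : HasDerivAt p.cosCoeff P' r := deriv_cosCoeff p hr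
  have hds : HasDerivAt p.cosRoot (p.cosCoeff r * P' / p.cosRoot r) r := by
    have h1 := ((hdP.pow 2).add_const (4 * (p.rb ^ 2 - (p.ra * p.rc) ^ 2))).sqrt
      (by simp only [Pi.pow_apply]; rw [← hs]; positivity)
    refine h1.congr_deriv ?_
    simp only [Pi.pow_apply]
    rw [← cosRoot]
    field_simp
    norm_num
    ring
  have hdu : HasDerivAt p.cosBound (-p.cosBound r * P' / p.cosRoot r) r := by
    refine ((hdP.neg.add hds).div_const (2 * (p.ra * p.rc + p.rb))).congr_deriv ?_
    unfold cosBound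
    field_simp
    ring
  have hda : HasDerivAt p.angle
      (-(1 / √(1 - p.cosBound r ^ 2)) * (-p.cosBound r * P' / p.cosRoot r) / 2) r :=
    ((Real.hasDerivAt_arccos hu1.ne' hu2.ne).comp r hdu).div_const 2
  have hrP : |r * P'| ≤ 2 * p.cosCoeff r := by
    have e : r * P' = 2 * (-(p.ra ^ 2 / r ^ 2) + p.rc ^ 2 * r ^ 2) := by
      simp only [P']; field_simp
    have h1 : 0 ≤ p.ra ^ 2 / r ^ 2 := by positivity
    have h2 : 0 ≤ p.rc ^ 2 * r ^ 2 := by positivity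
    rw [e, abs_le, cosCoeff]
    constructor <;> linarith
  -- The constant is chosen so that, after squaring, `4 rb²` becomes `4 (rb + ra rc)²`, which
  -- absorbs the `4 (ra rc)²` subtracted from `cosCoeff²` in `cosRoot²`.
  have hPs : p.cosCoeff r / p.cosRoot r ≤ 1 + p.ra * p.rc / p.rb := by
    rw [div_le_iff₀ hs0]
    refine le_of_sq_le_sq ?_ (by positivity)
    have e : ((1 + p.ra * p.rc / p.rb) * p.cosRoot r) ^ 2 =
        (1 + p.ra * p.rc / p.rb) ^ 2 * (p.cosCoeff r ^ 2 - (2 * (p.ra * p.rc)) ^ 2)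
          + 4 * (p.rb + p.ra * p.rc) ^ 2 := by
      rw [mul_pow, hs]; field_simp; ring
    have h1 : 0 ≤ p.cosCoeff r ^ 2 - (2 * (p.ra * p.rc)) ^ 2 :=
      sub_nonneg.2 (pow_le_pow_left₀ (by positivity) hP 2)
    have h2 : 1 ≤ (1 + p.ra * p.rc / p.rb) ^ 2 :=
      one_le_pow₀ (by linarith [show 0 ≤ p.ra * p.rc / p.rb by positivity])
    rw [e]
    nlinarith [mul_le_mul_of_nonneg_right h2 h1]
  have hu' : |p.cosBound r| ≤ 1 := hu.trans (cosMax_lt_one hp).le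
  have hsq : √(1 - p.cosMax ^ 2) ≤ √(1 - p.cosBound r ^ 2) := by
    apply Real.sqrt_le_sqrt
    have := pow_le_pow_left₀ (abs_nonneg _) hu 2
    rw [sq_abs] at this
    linarith
  have hq0 := Real.sqrt_pos.2 hq
  rw [hda.deriv]
  have e : r * (-(1 / √(1 - p.cosBound r ^ 2)) * (-p.cosBound r * P' / p.cosRoot r) / 2) =
      (1 / √(1 - p.cosBound r ^ 2)) * (p.cosBound r * ((r * P') / 2 / p.cosRoot r)) := by
    ring
  rw [e, abs_mul (1 / _), abs_mul (p.cosBound r), abs_div (r * P' / 2), abs_div (r * P'), abs_two,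
    abs_of_pos hs0,
    abs_of_pos (show 0 < 1 / √(1 - p.cosBound r ^ 2) from one_div_pos.2 (hq0.trans_le hsq))]
  refine mul_le_mul (one_div_le_one_div_of_le hq0 hsq) ?_ (by positivity) (by positivity)
  calc |p.cosBound r| * (|r * P'| / 2 / p.cosRoot r)
      ≤ 1 * (p.cosCoeff r / p.cosRoot r) := by
        refine mul_le_mul hu' ?_ (by positivity) zero_le_one
        exact div_le_div_of_nonneg_right (by linarith) hs0.le
    _ ≤ _ := by rw [one_mul]; exact hPs

/-! ### Polar coordinates adapted to `D` -/

/-- Half the opening of `D` on the circle of radius `r`. -/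
def opening (p : GKParams) (r : ℝ) : ℝ := π / 2 - p.angle r

/-- The point of modulus `r` whose argument is `π / 2 + v * opening r`; for `|v| < 1` these points
fill the upper half of `D`. -/
def polarMap (p : GKParams) (r v : ℝ) : ℂ :=
  r * Complex.exp (Complex.I * ((π / 2 + v * p.opening r : ℝ) : ℂ))

/-- The closure of `D₀⁺`. -/
def closedRegion (p : GKParams) (R : ℝ) : Set ℂ :=
  {k | 0 < k.im ∧ R ≤ ‖k‖ ∧ (k ^ 2).re ≤ p.reBound ‖k‖}

lemma opening_pos (hp : p.IsPhysical) {r : ℝ} (hr : 0 < r) : 0 < p.opening r :=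
  sub_pos.2 (angle_lt hp hr)

lemma opening_lt (hp : p.IsPhysical) {r : ℝ} (hr : 0 < r) : p.opening r < π / 2 := by
  have := angle_pos hp hr
  unfold opening; linarith

lemma norm_ofReal_mul_exp {r : ℝ} (hr : 0 < r) (ψ : ℝ) :
    ‖(r : ℂ) * Complex.exp (Complex.I * (ψ : ℂ))‖ = r := by
  rw [norm_mul, mul_comm Complex.I, Complex.norm_exp_ofReal_mul_I, Complex.norm_real, mul_one,
    Real.norm_of_nonneg hr.le]

lemma ofReal_mul_exp_im (r ψ : ℝ) :
    ((r : ℂ) * Complex.exp (Complex.I * (ψ : ℂ))).im = r * sin ψ := by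
  rw [Complex.im_ofReal_mul, mul_comm Complex.I, Complex.exp_ofReal_mul_I_im]

lemma ofReal_mul_exp_re (r ψ : ℝ) :
    ((r : ℂ) * Complex.exp (Complex.I * (ψ : ℂ))).re = r * cos ψ := by
  rw [Complex.re_ofReal_mul, mul_comm Complex.I, Complex.exp_ofReal_mul_I_re]

lemma ofReal_mul_exp_sq_re (r ψ : ℝ) :
    (((r : ℂ) * Complex.exp (Complex.I * (ψ : ℂ))) ^ 2).re = r ^ 2 * cos (2 * ψ) := by
  have : ((r : ℂ) * Complex.exp (Complex.I * (ψ : ℂ))) ^ 2 =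
      ((r ^ 2 : ℝ) : ℂ) * Complex.exp (Complex.I * ((2 * ψ : ℝ) : ℂ)) := by
    rw [mul_pow, ← Complex.exp_nat_mul]
    push_cast
    ring_nf
  rw [this, ofReal_mul_exp_re]

lemma norm_polarMap {r : ℝ} (hr : 0 < r) (v : ℝ) : ‖p.polarMap r v‖ = r :=
  norm_ofReal_mul_exp hr _

/-- Divided by `-r²`, the two sides are the cosines of `2 |v| opening` and `2 opening`. The
hypothesis `hv` keeps the first angle in `[0, π]`, where cosine is strictly decreasing. -/
lemma polarMap_sq_re_le_iff (hp : p.IsPhysical) {r v : ℝ} (hr : 0 < r)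
    (hv : |v| * p.opening r ≤ π / 2) :
    (p.polarMap r v ^ 2).re ≤ p.reBound r ↔ |v| ≤ 1 := by
  have hδ := opening_pos hp hr
  rw [polarMap, ofReal_mul_exp_sq_re, reBound_eq hp hr, ← cos_two_angle hp hr,
    mul_le_mul_iff_right₀ (by positivity)]
  have e1 : cos (2 * (π / 2 + v * p.opening r)) = -cos (2 * (|v| * p.opening r)) := by
    rw [show 2 * (π / 2 + v * p.opening r) = 2 * (v * p.opening r) + π by ring, Real.cos_add_pi,
      ← Real.cos_abs (2 * (v * p.opening r)), abs_mul, abs_mul, abs_two, abs_of_pos hδ]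
  have e2 : cos (2 * p.angle r) = -cos (2 * p.opening r) := by
    rw [show 2 * p.angle r = π - 2 * p.opening r by unfold opening; ring, Real.cos_pi_sub]
  rw [e1, e2, neg_le_neg_iff, Real.strictAntiOn_cos.le_iff_ge]
  · constructor
    · intro h
      have : |v| * p.opening r ≤ 1 * p.opening r := by linarith
      exact le_of_mul_le_mul_right this hδ
    · intro h
      nlinarith
  · exact ⟨by positivity, by linarith [opening_lt hp hr]⟩
  · exact ⟨by positivity, by linarith⟩

lemma polarMap_sq_re_lt_iff (hp : p.IsPhysical) {r v : ℝ} (hr : 0 < r)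
    (hv : |v| * p.opening r ≤ π / 2) :
    (p.polarMap r v ^ 2).re < p.reBound r ↔ |v| < 1 := by
  have hδ := opening_pos hp hr
  rw [polarMap, ofReal_mul_exp_sq_re, reBound_eq hp hr, ← cos_two_angle hp hr,
    mul_lt_mul_iff_right₀ (by positivity)]
  have e1 : cos (2 * (π / 2 + v * p.opening r)) = -cos (2 * (|v| * p.opening r)) := by
    rw [show 2 * (π / 2 + v * p.opening r) = 2 * (v * p.opening r) + π by ring, Real.cos_add_pi,
      ← Real.cos_abs (2 * (v * p.opening r)), abs_mul, abs_mul, abs_two, abs_of_pos hδ]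
  have e2 : cos (2 * p.angle r) = -cos (2 * p.opening r) := by
    rw [show 2 * p.angle r = π - 2 * p.opening r by unfold opening; ring, Real.cos_pi_sub]
  rw [e1, e2, neg_lt_neg_iff, Real.strictAntiOn_cos.lt_iff_gt]
  · constructor
    · intro h
      have : |v| * p.opening r < 1 * p.opening r := by linarith
      exact lt_of_mul_lt_mul_right this hδ.le
    · intro h
      nlinarith
  · exact ⟨by positivity, by linarith [opening_lt hp hr]⟩
  · exact ⟨by positivity, by linarith⟩

lemma polarMap_im_pos (hp : p.IsPhysical) {r v : ℝ} (hr : 0 < r) (hv : |v| ≤ 1) :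
    0 < (p.polarMap r v).im := by
  have hδ := opening_pos hp hr
  have hδ2 := opening_lt hp hr
  have h : |v * p.opening r| < π / 2 := by
    rw [abs_mul, abs_of_pos hδ]; nlinarith
  rw [abs_lt] at h
  rw [polarMap, ofReal_mul_exp_im]
  exact mul_pos hr (Real.sin_pos_of_pos_of_lt_pi (by linarith) (by linarith))

lemma mul_opening_le (hp : p.IsPhysical) {r v : ℝ} (hr : 0 < r) (hv : |v| ≤ 1) :
    |v| * p.opening r ≤ π / 2 := by
  nlinarith [opening_pos hp hr, opening_lt hp hr]

lemma polarMap_mem_closedRegion (hp : p.IsPhysical) {R r v : ℝ} (hR : 0 < R) (hr : R ≤ r)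
    (hv : |v| ≤ 1) : p.polarMap r v ∈ p.closedRegion R := by
  have hr0 := hR.trans_le hr
  refine ⟨polarMap_im_pos hp hr0 hv, ?_, ?_⟩
  · rwa [norm_polarMap hr0]
  · rw [norm_polarMap hr0]
    exact (polarMap_sq_re_le_iff hp hr0 (mul_opening_le hp hr0 hv)).2 hv

lemma exists_polarMap_eq (hp : p.IsPhysical) {k : ℂ} (hk : 0 < k.im) :
    ∃ v, |v| * p.opening ‖k‖ ≤ π / 2 ∧ p.polarMap ‖k‖ v = k := by
  have hr : 0 < ‖k‖ := norm_pos_iff.2 fun h => by simp [h] at hk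
  have hδ := opening_pos hp hr
  have harg : 0 ≤ k.arg := Complex.arg_nonneg_iff.2 hk.le
  refine ⟨(k.arg - π / 2) / p.opening ‖k‖, ?_, ?_⟩
  · rw [abs_div, abs_of_pos hδ, div_mul_cancel₀ _ hδ.ne', abs_le]
    constructor <;> linarith [Complex.arg_le_pi k]
  · rw [polarMap, div_mul_cancel₀ _ hδ.ne', add_sub_cancel, mul_comm Complex.I]
    exact Complex.norm_mul_exp_arg_mul_I k

lemma exists_polarMap_of_mem (hp : p.IsPhysical) {R : ℝ} {k : ℂ} (hk : k ∈ p.closedRegion R) :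
    ∃ v, |v| ≤ 1 ∧ p.polarMap ‖k‖ v = k := by
  obtain ⟨h1, h2, h3⟩ := hk
  have hr : 0 < ‖k‖ := norm_pos_iff.2 fun h => by simp [h] at h1
  obtain ⟨v, hv, e⟩ := exists_polarMap_eq hp h1
  refine ⟨v, ?_, e⟩
  rw [← polarMap_sq_re_le_iff hp hr hv, e]
  exact h3

/-- The angles of the open first quadrant that belong to `D` fill exactly the interval from `angle
r` to `π / 2`. -/
lemma boundaryAngle_eq (hp : p.IsPhysical) {r : ℝ} (hr : 0 < r) :
    p.boundaryAngle r = p.angle r := by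
  have h : {φ : ℝ | φ ∈ Ioo 0 (π / 2) ∧ (r : ℂ) * Complex.exp (Complex.I * (φ : ℂ)) ∈ p.D} =
      Ioo (p.angle r) (π / 2) := by
    ext φ
    have hδ := opening_pos hp hr
    have key : φ ∈ Ioo 0 (π / 2) →
        ((r : ℂ) * Complex.exp (Complex.I * (φ : ℂ)) ∈ p.D ↔ p.angle r < φ) := by
      intro hφ
      have e : (r : ℂ) * Complex.exp (Complex.I * (φ : ℂ)) =
          p.polarMap r (-((π / 2 - φ) / p.opening r)) := by
        rw [polarMap, neg_mul, div_mul_cancel₀ _ hδ.ne']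
        congr 4; ring
      have habs : |-((π / 2 - φ) / p.opening r)| = (π / 2 - φ) / p.opening r := by
        rw [abs_neg, abs_of_nonneg (div_nonneg (by linarith [hφ.2]) hδ.le)]
      rw [e, mem_D_iff hp, norm_polarMap hr, polarMap_sq_re_lt_iff hp hr, habs, div_lt_one hδ,
        opening]
      · constructor <;> intro h <;> linarith
      · rw [habs, div_mul_cancel₀ _ hδ.ne']; linarith [hφ.1]
    constructor
    · rintro ⟨h1, h2⟩
      exact ⟨(key h1).1 h2, h1.2⟩
    · rintro ⟨h1, h2⟩
      have h3 : φ ∈ Ioo 0 (π / 2) := ⟨(angle_pos hp hr).trans h1, h2⟩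
      exact ⟨h3, (key h3).2 h1⟩
  rw [boundaryAngle, h, csInf_Ioo (angle_lt hp hr)]

/-! ### The contours -/

lemma contourPlus_of_ge (hp : p.IsPhysical) {R s : ℝ} (hR : 0 < R) (hs : R ≤ s) :
    p.contourPlus R s = p.polarMap s (-1) := by
  rw [contourPlus, if_pos hs, boundaryAngle_eq hp (hR.trans_le hs), polarMap, opening]
  congr 4; ring

lemma contourPlus_of_le (hp : p.IsPhysical) {R s : ℝ} (hR : 0 < R) (hs : s ≤ -R) :
    p.contourPlus R s = p.polarMap (-s) 1 := by
  rw [contourPlus, if_neg (by linarith), if_pos hs, boundaryAngle_eq hp (by linarith), polarMap,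
    opening]
  congr 4; ring

lemma contourPlus_of_mem (hp : p.IsPhysical) {R s : ℝ} (hR : 0 < R) (hs : s ∈ Icc (-R) R) :
    p.contourPlus R s = p.polarMap R (-(s / R)) := by
  rcases hs.2.lt_or_eq with h | h
  · rcases hs.1.lt_or_eq with h' | h'
    · rw [contourPlus, if_neg h.not_ge, if_neg h'.not_ge, boundaryAngle_eq hp hR, polarMap,
        opening]
      congr 4; ring
    · rw [contourPlus_of_le hp hR h'.ge, ← h']
      congr 1
      · simp
      · field_simp
  · rw [contourPlus_of_ge hp hR h.ge, h]
    congr 1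
    field_simp

lemma continuousAt_polarMap (hp : p.IsPhysical) {r : ℝ} (hr : 0 < r) (v : ℝ) :
    ContinuousAt (fun x : ℝ × ℝ => p.polarMap x.1 x.2) (r, v) := by
  have h : ContinuousAt (fun x : ℝ × ℝ => p.angle x.1) (r, v) :=
    ContinuousAt.comp (g := p.angle) (f := Prod.fst) (x := (r, v)) (differentiableAt_angle hp hr).continuousAt continuousAt_fst
  have h2 : ContinuousAt (fun x : ℝ × ℝ => π / 2 + x.2 * p.opening x.1) (r, v) := by
    unfold opening
    fun_prop
  have h3 : ContinuousAt (fun x : ℝ × ℝ => ((π / 2 + x.2 * p.opening x.1 : ℝ) : ℂ)) (r, v) :=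
    Complex.continuous_ofReal.continuousAt.comp h2
  unfold polarMap
  fun_prop

lemma continuous_reBound (p : GKParams) : Continuous p.reBound := by
  unfold reBound; fun_prop

lemma reBound_lt (hp : p.IsPhysical) {r : ℝ} (hr : 0 < r) : p.reBound r < r ^ 2 := by
  rw [reBound_eq hp hr]
  have := (cosBound_mem hp hr).2
  have : 0 < r ^ 2 := by positivity
  nlinarith

/-- The strict condition `0 < Im k` may be relaxed to `0 ≤ Im k`: a nonzero real `k` has `Re k² =
‖k‖²`, which exceeds `reBound ‖k‖`. -/
lemma isClosed_closedRegion (hp : p.IsPhysical) {R : ℝ} (hR : 0 < R) :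
    IsClosed (p.closedRegion R) := by
  have h : p.closedRegion R = {k | 0 ≤ k.im} ∩ {k | R ≤ ‖k‖} ∩
      {k | (k ^ 2).re ≤ p.reBound ‖k‖} := by
    ext k
    constructor
    · rintro ⟨h1, h2, h3⟩
      exact ⟨⟨h1.le, h2⟩, h3⟩
    · rintro ⟨⟨h1, h2⟩, h3⟩
      refine ⟨lt_of_le_of_ne h1 fun h0 => ?_, h2, h3⟩
      have hr : 0 < ‖k‖ := hR.trans_le h2
      have h4 := reBound_lt hp hr
      have h5 : (k ^ 2).re = ‖k‖ ^ 2 := by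
        rw [Complex.sq_norm, Complex.normSq_apply, ← h0, sq, Complex.mul_re, ← h0]; ring
      simp only [mem_ofPred_eq] at h3
      linarith
  rw [h]
  have := continuous_reBound p
  exact ((isClosed_le continuous_const Complex.continuous_im).inter
    (isClosed_le continuous_const continuous_norm)).inter
    (isClosed_le (by fun_prop) (by fun_prop))

lemma mem_D0Plus_iff (hp : p.IsPhysical) {R : ℝ} {k : ℂ} :
    k ∈ p.D0Plus R ↔ 0 < k.im ∧ R < ‖k‖ ∧ (k ^ 2).re < p.reBound ‖k‖ := by
  rw [D0Plus, mem_ofPred_eq, mem_D_iff hp]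
  tauto

lemma isOpen_D0Plus (hp : p.IsPhysical) (R : ℝ) : IsOpen (p.D0Plus R) := by
  have h : p.D0Plus R = {k | 0 < k.im} ∩ {k | R < ‖k‖} ∩ {k | (k ^ 2).re < p.reBound ‖k‖} := by
    ext k
    rw [mem_D0Plus_iff hp]
    simp [and_assoc]
  rw [h]
  have := continuous_reBound p
  exact ((isOpen_lt continuous_const Complex.continuous_im).inter
    (isOpen_lt continuous_const continuous_norm)).inter (isOpen_lt (by fun_prop) (by fun_prop))

lemma polarMap_mem_D0Plus (hp : p.IsPhysical) {R r v : ℝ} (hR : 0 < R) (hr : R < r)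
    (hv : |v| < 1) : p.polarMap r v ∈ p.D0Plus R := by
  have hr0 := hR.trans hr
  rw [mem_D0Plus_iff hp, norm_polarMap hr0]
  exact ⟨polarMap_im_pos hp hr0 hv.le, hr,
    (polarMap_sq_re_lt_iff hp hr0 (mul_opening_le hp hr0 hv.le)).2 hv⟩

lemma closure_D0Plus (hp : p.IsPhysical) {R : ℝ} (hR : 0 < R) :
    closure (p.D0Plus R) = p.closedRegion R := by
  refine Subset.antisymm ?_ fun k hk => ?_
  · refine closure_minimal (fun k hk => ?_) (isClosed_closedRegion hp hR)
    obtain ⟨h1, h2, h3⟩ := (mem_D0Plus_iff hp).1 hk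
    exact ⟨h1, h2.le, h3.le⟩
  · obtain ⟨v, hv, e⟩ := exists_polarMap_of_mem hp hk
    have hr := hR.trans_le hk.2.1
    -- Increasing the radius by `n` and shrinking `v` by the factor `1 - n` moves the point into the
    -- open set.
    have hc : Tendsto (fun n : ℝ => p.polarMap (‖k‖ + n) (v * (1 - n))) (𝓝[>] 0) (𝓝 k) := by
      have h1 : Tendsto (fun n : ℝ => (‖k‖ + n, v * (1 - n))) (𝓝[>] 0) (𝓝 (‖k‖, v)) := by
        refine Tendsto.mono_left ?_ nhdsWithin_le_nhds
        exact Continuous.tendsto' (by fun_prop) _ _ (by simp)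
      have h2 := (continuousAt_polarMap hp hr v).tendsto.comp h1
      simp only [e] at h2
      exact h2
    refine mem_closure_of_tendsto hc ?_
    filter_upwards [Ioo_mem_nhdsGT (show (0 : ℝ) < 1 by norm_num)] with n hn
    refine polarMap_mem_D0Plus hp hR (by linarith [hk.2.1, hn.1]) ?_
    rw [abs_mul, abs_of_pos (show 0 < 1 - n by linarith [hn.2])]
    nlinarith [hn.1, hn.2]

lemma closedRegion_subset (hp : p.IsPhysical) {R : ℝ} (hR : 0 < R) :
    p.closedRegion R ⊆ closure p.D := by
  rw [← closure_D0Plus hp hR]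
  exact closure_mono fun k hk => hk.1

lemma contourPlus_mem (hp : p.IsPhysical) {R : ℝ} (hR : 0 < R) (s : ℝ) :
    p.contourPlus R s ∈ p.closedRegion R ∧
      ∃ r v, R ≤ r ∧ |v| ≤ 1 ∧ p.contourPlus R s = p.polarMap r v ∧ (r = R ∨ |v| = 1) := by
  suffices h : ∃ r v, R ≤ r ∧ |v| ≤ 1 ∧ p.contourPlus R s = p.polarMap r v ∧
      (r = R ∨ |v| = 1) by
    refine ⟨?_, h⟩
    obtain ⟨r, v, h1, h2, h3, -⟩ := h
    rw [h3]
    exact polarMap_mem_closedRegion hp hR h1 h2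
  rcases le_total R s with h | h
  · exact ⟨s, -1, h, by simp, contourPlus_of_ge hp hR h, by simp⟩
  · rcases le_total s (-R) with h' | h'
    · exact ⟨-s, 1, by linarith, by simp, contourPlus_of_le hp hR h', by simp⟩
    · refine ⟨R, -(s / R), le_rfl, ?_, contourPlus_of_mem hp hR ⟨h', h⟩, Or.inl rfl⟩
      rw [abs_neg, abs_div, abs_of_pos hR, div_le_one hR, abs_le]
      exact ⟨h', h⟩

/-- In the coordinates of `polarMap` the closure is `R ≤ r`, `|v| ≤ 1`, and the open set has both
inequalities strict. The frontier is thus `r = R` or `|v| = 1`, which is what the three pieces of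
the contour trace. -/
lemma range_contourPlus (hp : p.IsPhysical) {R : ℝ} (hR : 0 < R) :
    range (p.contourPlus R) = frontier (p.D0Plus R) := by
  rw [(isOpen_D0Plus hp R).frontier_eq, closure_D0Plus hp hR]
  ext k
  constructor
  · rintro ⟨s, rfl⟩
    obtain ⟨h1, r, v, hr, hv, e, h2⟩ := contourPlus_mem hp hR s
    have hr0 := hR.trans_le hr
    refine ⟨h1, fun h3 => ?_⟩
    rw [mem_D0Plus_iff hp, e, norm_polarMap hr0,
      polarMap_sq_re_lt_iff hp hr0 (mul_opening_le hp hr0 hv)] at h3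
    rcases h2 with h2 | h2
    · exact h3.2.1.ne' h2
    · exact h3.2.2.ne h2
  · rintro ⟨hk, hk'⟩
    obtain ⟨v, hv, e⟩ := exists_polarMap_of_mem hp hk
    have hr := hk.2.1
    rcases hr.lt_or_eq with h | h
    · have hv1 : |v| = 1 := by
        by_contra hne
        exact hk' (e ▸ polarMap_mem_D0Plus hp hR h (lt_of_le_of_ne hv hne))
      rcases eq_or_eq_neg_of_abs_eq hv1 with h1 | h1
      · refine ⟨-‖k‖, ?_⟩
        rw [contourPlus_of_le hp hR (by linarith), neg_neg, ← h1, e]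
      · refine ⟨‖k‖, ?_⟩
        rw [contourPlus_of_ge hp hR hr, ← h1, e]
    · refine ⟨-(v * R), ?_⟩
      have hv' := abs_le.1 hv
      rw [contourPlus_of_mem hp hR ⟨by nlinarith, by nlinarith⟩]
      have : -(-(v * R) / R) = v := by field_simp
      rw [this]
      rw [← h] at e
      exact e

lemma range_contourMinus (hp : p.IsPhysical) {R : ℝ} (hR : 0 < R) :
    range (p.contourMinus R) = frontier (p.D0Minus R) := by
  have h1 : p.D0Minus R = Homeomorph.neg ℂ '' p.D0Plus R := by
    ext k
    simp only [D0Minus, D0Plus, D, mem_image, mem_ofPred_eq, Homeomorph.coe_neg]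
    constructor
    · rintro ⟨h1, h2, h3⟩
      exact ⟨-k, ⟨by simpa [omega1_neg, omega2_neg] using h1, by simpa using h2, by simpa using h3⟩,
        by simp⟩
    · rintro ⟨x, ⟨h1, h2, h3⟩, rfl⟩
      exact ⟨by simpa [omega1_neg, omega2_neg] using h1, by simpa using h2, by simpa using h3⟩
  have h2 : p.contourMinus R = Homeomorph.neg ℂ ∘ p.contourPlus R := by
    ext s; simp [contourMinus]
  rw [h1, h2, range_comp, range_contourPlus hp hR]
  exact (Homeomorph.neg ℂ).image_frontier _

/-! ### Derivatives along the contour -/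

lemma contDiffAt_opening (hp : p.IsPhysical) {r : ℝ} (hr : 0 < r) :
    ContDiffAt ℝ 2 p.opening r := by
  have := contDiffAt_angle hp hr
  unfold opening
  fun_prop

lemma differentiableAt_opening (hp : p.IsPhysical) {r : ℝ} (hr : 0 < r) :
    DifferentiableAt ℝ p.opening r :=
  (contDiffAt_opening hp hr).differentiableAt (by norm_num)

lemma differentiableAt_deriv_opening (hp : p.IsPhysical) {r : ℝ} (hr : 0 < r) :
    DifferentiableAt ℝ (deriv p.opening) r := by
  have h := (contDiffAt_opening hp hr).fderiv_right (m := 1) (by norm_num)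
  have h2 := (h.differentiableAt (by norm_num)).clm_apply (differentiableAt_const (1 : ℝ))
  exact h2

lemma exists_abs_mul_deriv_opening_le (hp : p.IsPhysical) :
    ∃ C, 0 ≤ C ∧ ∀ r > 0, |r * deriv p.opening r| ≤ C := by
  obtain ⟨C, hC⟩ := exists_abs_mul_deriv_angle_le hp
  refine ⟨C, (abs_nonneg _).trans (hC 1 one_pos), fun r hr => ?_⟩
  have : deriv p.opening r = -deriv p.angle r := by
    unfold opening; rw [deriv_const_sub]
  rw [this, mul_neg, abs_neg]
  exact hC r hr

lemma hasDerivAt_polarMap_left (hp : p.IsPhysical) {r : ℝ} (hr : 0 < r) (v : ℝ) :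
    HasDerivAt (fun r => p.polarMap r v)
      (p.polarMap r v * (1 / r + Complex.I * v * (deriv p.opening r : ℝ))) r := by
  have h1 := (((differentiableAt_opening hp hr).hasDerivAt.const_mul v).const_add
    (π / 2)).ofReal_comp.const_mul Complex.I
  have h2 := (hasDerivAt_id r).ofReal_comp.mul h1.cexp
  refine h2.congr_deriv ?_
  have : (r : ℂ) ≠ 0 := by exact_mod_cast hr.ne'
  unfold polarMap
  simp only [id]
  push_cast
  field_simp

lemma hasDerivAt_polarMap_right (p : GKParams) (r v : ℝ) :
    HasDerivAt (fun v => p.polarMap r v)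
      (p.polarMap r v * (Complex.I * (p.opening r : ℝ))) v := by
  have h1 := (((hasDerivAt_id v).mul_const (p.opening r)).const_add
    (π / 2)).ofReal_comp.const_mul Complex.I
  have h2 := h1.cexp.const_mul (r : ℂ)
  refine h2.congr_deriv ?_
  unfold polarMap
  simp only [id]
  push_cast
  ring

lemma deriv_contourPlus_of_gt (hp : p.IsPhysical) {R s : ℝ} (hR : 0 < R) (hs : R < s) :
    HasDerivAt (p.contourPlus R)
      (p.polarMap s (-1) * (1 / s + Complex.I * (-1 : ℝ) * (deriv p.opening s : ℝ))) s := by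
  refine (hasDerivAt_polarMap_left hp (hR.trans hs) (-1)).congr_of_eventuallyEq ?_
  filter_upwards [Ioi_mem_nhds hs] with x hx
  exact contourPlus_of_ge hp hR (le_of_lt hx)

lemma deriv_contourPlus_of_lt (hp : p.IsPhysical) {R s : ℝ} (hR : 0 < R) (hs : s < -R) :
    HasDerivAt (p.contourPlus R) (-(p.polarMap (-s) 1 *
      (1 / (-s : ℝ) + Complex.I * (1 : ℝ) * (deriv p.opening (-s) : ℝ)))) s := by
  have h := (hasDerivAt_polarMap_left hp (show 0 < -s by linarith) 1).scomp s (hasDerivAt_neg s)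
  have h' : HasDerivAt (fun s => p.polarMap (-s) 1) (-(p.polarMap (-s) 1 *
      (1 / (-s : ℝ) + Complex.I * (1 : ℝ) * (deriv p.opening (-s) : ℝ)))) s := by
    refine h.congr_deriv ?_
    simp
  refine h'.congr_of_eventuallyEq ?_
  filter_upwards [Iio_mem_nhds hs] with x hx
  exact contourPlus_of_le hp hR (le_of_lt hx)

lemma deriv_contourPlus_of_mem (hp : p.IsPhysical) {R s : ℝ} (hR : 0 < R) (hs : s ∈ Ioo (-R) R) :
    HasDerivAt (p.contourPlus R) ((-(1 / R) : ℝ) • (p.polarMap R (-(s / R)) *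
      (Complex.I * (p.opening R : ℝ)))) s := by
  have h1 : HasDerivAt (fun s : ℝ => -(s / R)) (-(1 / R)) s := ((hasDerivAt_id s).div_const R).neg
  refine ((hasDerivAt_polarMap_right p R (-(s / R))).scomp s h1).congr_of_eventuallyEq ?_
  filter_upwards [Ioo_mem_nhds hs.1 hs.2] with x hx
  exact contourPlus_of_mem hp hR ⟨hx.1.le, hx.2.le⟩

lemma differentiableAt_contourPlus (hp : p.IsPhysical) {R s : ℝ} (hR : 0 < R)
    (hs : s ∉ ({-R, R} : Set ℝ)) : DifferentiableAt ℝ (p.contourPlus R) s := by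
  simp only [mem_insert_iff, mem_singleton_iff, not_or] at hs
  rcases lt_or_gt_of_ne hs.2 with h | h
  · rcases lt_or_gt_of_ne hs.1 with h' | h'
    · exact (deriv_contourPlus_of_lt hp hR h').differentiableAt
    · exact (deriv_contourPlus_of_mem hp hR ⟨h', h⟩).differentiableAt
  · exact (deriv_contourPlus_of_gt hp hR h).differentiableAt

/-- On the outer branches the speed is `|1 ± i r opening'(r)|` with `r = |s|`, bounded by the
scale-invariant estimate; on the circular arc it is `opening R < π / 2`. -/
lemma exists_norm_deriv_contourPlus_le (hp : p.IsPhysical) {R : ℝ} (hR : 0 < R) :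
    ∃ C, 0 ≤ C ∧ ∀ s ∉ ({-R, R} : Set ℝ), ‖deriv (p.contourPlus R) s‖ ≤ C := by
  obtain ⟨C, hC0, hC⟩ := exists_abs_mul_deriv_opening_le hp
  have key : ∀ r > 0, ∀ v : ℝ, |v| = 1 →
      ‖p.polarMap r v * (1 / r + Complex.I * v * (deriv p.opening r : ℝ))‖ ≤ 1 + C := by
    intro r hr v hv
    have hr' : (r : ℂ) ≠ 0 := by exact_mod_cast hr.ne'
    have e : ‖p.polarMap r v * (1 / r + Complex.I * v * (deriv p.opening r : ℝ))‖ =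
        ‖1 + Complex.I * v * ((r * deriv p.opening r : ℝ) : ℂ)‖ := by
      have e' : 1 + Complex.I * v * ((r * deriv p.opening r : ℝ) : ℂ) =
          r * (1 / r + Complex.I * v * (deriv p.opening r : ℝ)) := by
        push_cast
        field_simp
      rw [e', norm_mul, norm_mul, norm_polarMap hr, Complex.norm_real, Real.norm_of_nonneg hr.le]
    rw [e]
    refine (norm_add_le _ _).trans ?_
    rw [norm_one, norm_mul, norm_mul, Complex.norm_I, Complex.norm_real, Complex.norm_real,
      Real.norm_eq_abs, Real.norm_eq_abs, hv]
    linarith [hC r hr]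
  refine ⟨1 + C + π / 2, by positivity, fun s hs => ?_⟩
  simp only [mem_insert_iff, mem_singleton_iff, not_or] at hs
  rcases lt_or_gt_of_ne hs.2 with h | h
  · rcases lt_or_gt_of_ne hs.1 with h' | h'
    · rw [(deriv_contourPlus_of_lt hp hR h').deriv, norm_neg]
      linarith [key (-s) (by linarith) 1 (by simp), pi_pos]
    · rw [(deriv_contourPlus_of_mem hp hR ⟨h', h⟩).deriv, norm_smul, norm_mul, norm_polarMap hR,
        norm_mul, Complex.norm_I, Complex.norm_real, norm_neg, Real.norm_of_nonneg (by positivity),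
        Real.norm_of_nonneg (opening_pos hp hR).le]
      have : 1 / R * (R * (1 * p.opening R)) = p.opening R := by field_simp
      rw [this]
      linarith [opening_lt hp hR]
  · rw [(deriv_contourPlus_of_gt hp hR h).deriv]
    linarith [key s (hR.trans h) (-1) (by simp), pi_pos]

/-- A single formula for the three pieces, so that continuity at the joints `±R` needs no gluing. -/
lemma contourPlus_eq_clamp (hp : p.IsPhysical) {R : ℝ} (hR : 0 < R) (s : ℝ) :
    p.contourPlus R s = p.polarMap (max R |s|) (max (-1) (min 1 (-(s / R)))) := by
  rcases le_total R s with h | h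
  · have h1 : 1 ≤ s / R := (one_le_div hR).2 h
    rw [contourPlus_of_ge hp hR h, abs_of_nonneg (hR.le.trans h), max_eq_right h,
      min_eq_right (by linarith), max_eq_left (by linarith)]
  · rcases le_total s (-R) with h' | h'
    · have h1 : 1 ≤ -(s / R) := by rw [← neg_div]; exact (one_le_div hR).2 (by linarith)
      rw [contourPlus_of_le hp hR h', abs_of_nonpos (by linarith), max_eq_right (by linarith),
        min_eq_left h1, max_eq_right (by norm_num)]
    · have h1 : s / R ≤ 1 := (div_le_one hR).2 h
      have h2 : -(s / R) ≤ 1 := by rw [← neg_div]; exact (div_le_one hR).2 (by linarith)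
      rw [contourPlus_of_mem hp hR ⟨h', h⟩, max_eq_left (abs_le.2 ⟨h', h⟩), min_eq_right h2,
        max_eq_right (by linarith)]

lemma continuous_contourPlus (hp : p.IsPhysical) {R : ℝ} (hR : 0 < R) :
    Continuous (p.contourPlus R) := by
  rw [continuous_iff_continuousAt]
  intro s
  rw [funext (contourPlus_eq_clamp hp hR)]
  have h1 : ContinuousAt (fun s : ℝ => (max R |s|, max (-1) (min 1 (-(s / R))))) s := by fun_prop
  exact ContinuousAt.comp (g := fun x : ℝ × ℝ => p.polarMap x.1 x.2)
    (f := fun s : ℝ => (max R |s|, max (-1) (min 1 (-(s / R))))) (x := s)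
    (continuousAt_polarMap hp (lt_max_of_lt_left hR) _) h1

lemma norm_contourPlus (hp : p.IsPhysical) {R : ℝ} (hR : 0 < R) (s : ℝ) :
    ‖p.contourPlus R s‖ = max R |s| := by
  rw [contourPlus_eq_clamp hp hR, norm_polarMap (lt_max_of_lt_left hR)]

/-- The sign of the real part on each half of the contour tells which branch of the logarithm of
`moebius` can be used there. -/
lemma contourPlus_re_pos (hp : p.IsPhysical) {R : ℝ} (hR : 0 < R) {s : ℝ} (hs : 0 < s) :
    0 < (p.contourPlus R s).re := by
  have hr : 0 < max R |s| := lt_max_of_lt_left hR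
  have hδ := opening_pos hp hr
  have hδ2 := opening_lt hp hr
  rw [contourPlus_eq_clamp hp hR, polarMap, ofReal_mul_exp_re]
  set v := max (-1) (min 1 (-(s / R)))
  have hv : v < 0 := max_lt (by norm_num) (min_lt_of_right_lt (by simp; positivity))
  have hv1 : -1 ≤ v := le_max_left _ _
  exact mul_pos hr (Real.cos_pos_of_mem_Ioo ⟨by nlinarith [pi_pos], by nlinarith⟩)

lemma contourPlus_re_neg (hp : p.IsPhysical) {R : ℝ} (hR : 0 < R) {s : ℝ} (hs : s < 0) :
    (p.contourPlus R s).re < 0 := by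
  have hr : 0 < max R |s| := lt_max_of_lt_left hR
  have hδ := opening_pos hp hr
  have hδ2 := opening_lt hp hr
  rw [contourPlus_eq_clamp hp hR, polarMap, ofReal_mul_exp_re]
  set v := max (-1) (min 1 (-(s / R)))
  have hv : 0 < v := lt_max_of_lt_right (lt_min one_pos (by
    rw [← neg_div]; exact div_pos (by linarith) hR))
  have hv1 : v ≤ 1 := max_le (by norm_num) (min_le_left _ _)
  exact mul_neg_of_pos_of_neg hr
    (Real.cos_neg_of_pi_div_two_lt_of_lt (by nlinarith) (by nlinarith [pi_pos]))

lemma contourPlus_zero (hp : p.IsPhysical) {R : ℝ} (hR : 0 < R) :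
    p.contourPlus R 0 = R * Complex.I := by
  rw [contourPlus_of_mem hp hR ⟨by linarith, hR.le⟩, polarMap]
  have : Complex.exp (Complex.I * ((π / 2 : ℝ) : ℂ)) = Complex.I := by
    rw [mul_comm]; push_cast; exact Complex.exp_pi_div_two_mul_I
  simp only [zero_div, neg_zero, zero_mul, add_zero, this]

lemma contourPlus_ne_of_mem (hp : p.IsPhysical) {R : ℝ} (hR : 0 < R) {k : ℂ}
    (hk : k ∈ p.D0Plus R) (s : ℝ) : p.contourPlus R s ≠ k := by
  intro h
  have : k ∈ frontier (p.D0Plus R) := by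
    rw [← range_contourPlus hp hR]; exact ⟨s, h⟩
  rw [(isOpen_D0Plus hp R).frontier_eq] at this
  exact this.2 hk

lemma ofReal_mul_I_mem_D0Plus (hp : p.IsPhysical) {R κ : ℝ} (hR : 0 < R) (hκ : R < κ) :
    (κ : ℂ) * Complex.I ∈ p.D0Plus R := by
  have h := polarMap_mem_D0Plus hp hR hκ (v := 0) (by simp)
  have : Complex.exp (Complex.I * ((π / 2 : ℝ) : ℂ)) = Complex.I := by
    rw [mul_comm]; push_cast; exact Complex.exp_pi_div_two_mul_I
  simpa only [polarMap, zero_mul, add_zero, this] using h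

/-! ### Integrals along the contour -/

lemma integrable_contourPlus (hp : p.IsPhysical) {R : ℝ} (hR : 0 < R) {f : ℝ → ℂ}
    (hf : Continuous f) {C S : ℝ} (hb : ∀ s, S ≤ |s| → ‖f s‖ ≤ C / s ^ 2) :
    Integrable (fun s => deriv (p.contourPlus R) s * f s) := by
  obtain ⟨C₁, hC₁, hd⟩ := exists_norm_deriv_contourPlus_le hp hR
  set S' := max S 1
  obtain ⟨M, hM⟩ := (isCompact_Icc (a := -S') (b := S')).exists_bound_of_continuousOn
    (f := fun s => ((1 + s ^ 2 : ℝ) : ℂ) * f s) (by fun_prop)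
  have hb' : ∀ s, ‖f s‖ ≤ max M (2 * C) * (1 + s ^ 2)⁻¹ := by
    intro s
    have h1 : 0 < 1 + s ^ 2 := by positivity
    rw [← div_eq_mul_inv, le_div_iff₀ h1]
    rcases le_total |s| S' with h | h
    · have := hM s (abs_le.1 h)
      rw [norm_mul, Complex.norm_real, Real.norm_of_nonneg h1.le] at this
      exact le_max_of_le_left (by linarith)
    · have h2 := hb s ((le_max_left _ _).trans h)
      have h3 : 1 ≤ s ^ 2 := by
        rw [← sq_abs]; exact one_le_pow₀ ((le_max_right _ _).trans h)
      rw [le_div_iff₀ (by linarith)] at h2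
      refine le_max_of_le_right ?_
      nlinarith [norm_nonneg (f s)]
  refine ((integrable_inv_one_add_sq.const_mul (C₁ * max M (2 * C)))).mono'
    ((measurable_deriv _).aestronglyMeasurable.mul hf.aestronglyMeasurable) ?_
  have hae : ∀ᵐ s : ℝ, s ∉ ({-R, R} : Set ℝ) :=
    (Set.toFinite _).countable.ae_notMem volume
  filter_upwards [hae] with s hs
  rw [norm_mul, mul_assoc]
  exact mul_le_mul (hd s hs) (hb' s) (norm_nonneg _) hC₁

lemma differentiableAt_polarMap (hp : p.IsPhysical) {x : ℝ × ℝ} (hr : 0 < x.1) :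
    DifferentiableAt ℝ (fun x : ℝ × ℝ => p.polarMap x.1 x.2) x := by
  have h : DifferentiableAt ℝ (fun x : ℝ × ℝ => p.opening x.1) x :=
    DifferentiableAt.comp (g := p.opening) (f := Prod.fst) x (differentiableAt_opening hp hr)
      differentiableAt_fst
  have h2 : DifferentiableAt ℝ (fun x : ℝ × ℝ => ((π / 2 + x.2 * p.opening x.1 : ℝ) : ℂ)) x :=
    DifferentiableAt.comp (g := Complex.ofReal) x Complex.ofRealCLM.differentiableAt
      (by fun_prop)
  have h3 : DifferentiableAt ℝ (fun x : ℝ × ℝ => (x.1 : ℂ)) x :=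
    DifferentiableAt.comp (g := Complex.ofReal) x Complex.ofRealCLM.differentiableAt
      (by fun_prop)
  unfold polarMap
  fun_prop

/-- Cauchy's theorem for the part of `D` between two circles. -/
lemma integral_polarMap_boundary (hp : p.IsPhysical) {R ρ : ℝ} (hR : 0 < R) (hρ : R ≤ ρ)
    {F : ℂ → ℂ} (hF : ∀ k ∈ p.closedRegion R, DifferentiableAt ℂ F k) :
    (∫ r in R..ρ, p.polarMap r 1 * (1 / r + Complex.I * (1 : ℝ) * (deriv p.opening r : ℝ)) *
        F (p.polarMap r 1)) -
      (∫ r in R..ρ, p.polarMap r (-1) *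
        (1 / r + Complex.I * (-1 : ℝ) * (deriv p.opening r : ℝ)) * F (p.polarMap r (-1))) =
    (∫ v in (-1 : ℝ)..1, p.polarMap ρ v * (Complex.I * (p.opening ρ : ℝ)) * F (p.polarMap ρ v)) -
      ∫ v in (-1 : ℝ)..1, p.polarMap R v * (Complex.I * (p.opening R : ℝ)) *
        F (p.polarMap R v) := by
  -- The form `F(k) dk` pulled back by `polarMap` is `f dv - g dr`. It is closed because `F` is
  -- holomorphic and mixed derivatives agree, so `∂_r f + ∂_v g = 0` and the divergence theorem on
  -- the rectangle applies.
  set f : ℝ × ℝ → ℂ := fun x => p.polarMap x.1 x.2 * (Complex.I * (p.opening x.1 : ℝ)) *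
    F (p.polarMap x.1 x.2)
  set g : ℝ × ℝ → ℂ := fun x => -(p.polarMap x.1 x.2 *
    (1 / x.1 + Complex.I * x.2 * (deriv p.opening x.1 : ℝ)) * F (p.polarMap x.1 x.2))
  have hpt : ∀ x ∈ uIcc R ρ ×ˢ uIcc (-1 : ℝ) 1, 0 < x.1 ∧
      p.polarMap x.1 x.2 ∈ p.closedRegion R := by
    rintro x ⟨h1, h2⟩
    rw [uIcc_of_le hρ] at h1
    rw [uIcc_of_le (by norm_num)] at h2
    exact ⟨hR.trans_le h1.1, polarMap_mem_closedRegion hp hR h1.1 (abs_le.2 h2)⟩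
  have hFd : ∀ x ∈ uIcc R ρ ×ˢ uIcc (-1 : ℝ) 1,
      DifferentiableAt ℝ (fun x : ℝ × ℝ => F (p.polarMap x.1 x.2)) x := fun x hx =>
    DifferentiableAt.comp (g := F) (f := fun x : ℝ × ℝ => p.polarMap x.1 x.2) x
      ((hF _ (hpt x hx).2).restrictScalars ℝ) (differentiableAt_polarMap hp (hpt x hx).1)
  have hcast : ∀ (u : ℝ × ℝ → ℝ) (x : ℝ × ℝ), DifferentiableAt ℝ u x →
      DifferentiableAt ℝ (fun x => (u x : ℂ)) x := fun u x hu =>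
    DifferentiableAt.comp (g := Complex.ofReal) x Complex.ofRealCLM.differentiableAt hu
  have hf : ∀ x ∈ uIcc R ρ ×ˢ uIcc (-1 : ℝ) 1, DifferentiableAt ℝ f x := by
    intro x hx
    have h1 := hFd x hx
    have h2 := differentiableAt_polarMap hp (hpt x hx).1
    have h3 := hcast (fun x => p.opening x.1) x (DifferentiableAt.comp (g := p.opening)
      (f := Prod.fst) x (differentiableAt_opening hp (hpt x hx).1) differentiableAt_fst)
    exact (h2.mul (h3.const_mul Complex.I)).mul h1
  have hg : ∀ x ∈ uIcc R ρ ×ˢ uIcc (-1 : ℝ) 1, DifferentiableAt ℝ g x := by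
    intro x hx
    have h1 := hFd x hx
    have h2 := differentiableAt_polarMap hp (hpt x hx).1
    have h3 := hcast (fun x => deriv p.opening x.1) x (DifferentiableAt.comp
      (g := deriv p.opening) (f := Prod.fst) x (differentiableAt_deriv_opening hp (hpt x hx).1)
      differentiableAt_fst)
    have h5 := hcast Prod.snd x differentiableAt_snd
    have h6 : x.1 ≠ 0 := (hpt x hx).1.ne'
    have h7 : DifferentiableAt ℝ (fun x : ℝ × ℝ => 1 / (x.1 : ℂ)) x :=
      by simpa using hcast (fun x => 1 / x.1) x (by fun_prop (disch := assumption))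
    exact ((h2.mul (h7.add ((h5.const_mul Complex.I).mul h3))).mul h1).neg
  have hdiv : ∀ x ∈ uIcc R ρ ×ˢ uIcc (-1 : ℝ) 1,
      fderiv ℝ f x (1, 0) + fderiv ℝ g x (0, 1) = 0 := by
    intro x hx
    obtain ⟨hr, hk⟩ := hpt x hx
    have hr' : (x.1 : ℂ) ≠ 0 := by exact_mod_cast hr.ne'
    have i1 : HasDerivAt (fun r : ℝ => (r, x.2)) ((1, 0) : ℝ × ℝ) x.1 :=
      (hasDerivAt_id x.1).prodMk (hasDerivAt_const x.1 x.2)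
    have i2 : HasDerivAt (fun v : ℝ => (x.1, v)) ((0, 1) : ℝ × ℝ) x.2 :=
      (hasDerivAt_const x.2 x.1).prodMk (hasDerivAt_id x.2)
    have a1 := (hf x hx).hasFDerivAt.comp_hasDerivAt x.1 i1
    have a2 := (hg x hx).hasFDerivAt.comp_hasDerivAt x.2 i2
    have p1 := hasDerivAt_polarMap_left hp hr x.2
    have p2 := hasDerivAt_polarMap_right p x.1 x.2
    have q1 := (hF _ hk).hasDerivAt.comp x.1 p1
    have q2 := (hF _ hk).hasDerivAt.comp x.2 p2
    have d1 := (differentiableAt_opening hp hr).hasDerivAt.ofReal_comp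
    have b1 := (p1.mul (d1.const_mul Complex.I)).mul q1
    have b2 := ((p2.mul ((((hasDerivAt_id x.2).ofReal_comp.const_mul Complex.I).mul_const
      ((deriv p.opening x.1 : ℝ) : ℂ)).const_add (1 / (x.1 : ℂ)))).mul q2).neg
    rw [a1.unique b1, a2.unique b2]
    simp only [id, Function.comp, Pi.mul_apply]
    push_cast
    field_simp
    ring
  have hsub : Ioo (min R ρ) (max R ρ) ×ˢ Ioo (min (-1 : ℝ) 1) (max (-1 : ℝ) 1) ⊆
      uIcc R ρ ×ˢ uIcc (-1 : ℝ) 1 := prod_mono Ioo_subset_Icc_self Ioo_subset_Icc_self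
  have hzero : EqOn (fun x => fderiv ℝ f x (1, 0) + fderiv ℝ g x (0, 1)) (fun _ => 0)
      (uIcc R ρ ×ˢ uIcc (-1 : ℝ) 1) := hdiv
  have hmeas : MeasurableSet (uIcc R ρ ×ˢ uIcc (-1 : ℝ) 1) :=
    measurableSet_uIcc.prod measurableSet_uIcc
  have key := integral2_divergence_prod_of_hasFDerivAt f g (fderiv ℝ f) (fderiv ℝ g)
    R (-1) ρ 1 (fun x hx => (hf x hx).continuousAt.continuousWithinAt)
    (fun x hx => (hg x hx).continuousAt.continuousWithinAt)
    (fun x hx => (hf x (hsub hx)).hasFDerivAt) (fun x hx => (hg x (hsub hx)).hasFDerivAt)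
    ((integrableOn_congr_fun hzero hmeas).2 (integrable_zero _ _ _).integrableOn)
  have hlhs : (∫ x in R..ρ, ∫ y in (-1 : ℝ)..1,
      fderiv ℝ f (x, y) (1, 0) + fderiv ℝ g (x, y) (0, 1)) = 0 := by
    rw [intervalIntegral.integral_congr (g := fun _ => (0 : ℂ)), intervalIntegral.integral_zero]
    intro x hx
    dsimp only
    rw [intervalIntegral.integral_congr (g := fun _ => (0 : ℂ)), intervalIntegral.integral_zero]
    intro y hy
    exact hdiv (x, y) ⟨hx, hy⟩
  rw [hlhs] at key
  simp only [f, g, intervalIntegral.integral_neg] at key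
  linear_combination key

/-- The window `[-ρ, ρ]` of the contour and the arc of radius `ρ` together bound the part of the
region between two circles. The contour runs through its middle circle clockwise, whence the minus
sign. -/
lemma integral_contourPlus_symm (hp : p.IsPhysical) {R ρ : ℝ} (hR : 0 < R) (hρ : R ≤ ρ)
    {F : ℂ → ℂ} (hF : ∀ k ∈ p.closedRegion R, DifferentiableAt ℂ F k)
    (hi : Integrable (fun s => deriv (p.contourPlus R) s * F (p.contourPlus R s))) :
    ∫ s in (-ρ)..ρ, deriv (p.contourPlus R) s * F (p.contourPlus R s) =
      -∫ v in (-1 : ℝ)..1, p.polarMap ρ v * (Complex.I * (p.opening ρ : ℝ)) *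
        F (p.polarMap ρ v) := by
  have hii : ∀ a b : ℝ, IntervalIntegrable
      (fun s => deriv (p.contourPlus R) s * F (p.contourPlus R s)) volume a b :=
    fun a b => hi.intervalIntegrable
  rw [← intervalIntegral.integral_add_adjacent_intervals (hii (-ρ) R) (hii R ρ),
    ← intervalIntegral.integral_add_adjacent_intervals (hii (-ρ) (-R)) (hii (-R) R)]
  have h3 : ∫ s in R..ρ, deriv (p.contourPlus R) s * F (p.contourPlus R s) =
      ∫ r in R..ρ, p.polarMap r (-1) *
        (1 / r + Complex.I * (-1 : ℝ) * (deriv p.opening r : ℝ)) * F (p.polarMap r (-1)) := by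
    rw [intervalIntegral.integral_of_le hρ, intervalIntegral.integral_of_le hρ]
    refine setIntegral_congr_fun measurableSet_Ioc fun s hs => ?_
    rw [(deriv_contourPlus_of_gt hp hR hs.1).deriv, contourPlus_of_ge hp hR hs.1.le]
  have h1 : ∫ s in (-ρ)..(-R), deriv (p.contourPlus R) s * F (p.contourPlus R s) =
      -∫ r in R..ρ, p.polarMap r 1 * (1 / r + Complex.I * (1 : ℝ) * (deriv p.opening r : ℝ)) *
        F (p.polarMap r 1) := by
    rw [← intervalIntegral.integral_comp_neg, ← intervalIntegral.integral_neg,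
      intervalIntegral.integral_of_le (by linarith), intervalIntegral.integral_of_le (by linarith),
      integral_Ioc_eq_integral_Ioo, integral_Ioc_eq_integral_Ioo]
    refine setIntegral_congr_fun measurableSet_Ioo fun s hs => ?_
    have hs' : -s < -R := neg_lt_neg hs.1
    rw [(deriv_contourPlus_of_lt hp hR hs').deriv, contourPlus_of_le hp hR hs'.le, neg_mul, neg_neg]
  have h2 : ∫ s in (-R)..R, deriv (p.contourPlus R) s * F (p.contourPlus R s) =
      -∫ v in (-1 : ℝ)..1, p.polarMap R v * (Complex.I * (p.opening R : ℝ)) *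
        F (p.polarMap R v) := by
    have e := intervalIntegral.integral_comp_div (a := -R) (b := R)
      (fun v => -(p.polarMap R (-v) * (Complex.I * (p.opening R : ℝ)) * F (p.polarMap R (-v))))
      hR.ne'
    have e2 := intervalIntegral.integral_comp_neg (a := -1) (b := 1) (fun v =>
      -(p.polarMap R v * (Complex.I * (p.opening R : ℝ)) * F (p.polarMap R v)))
    rw [neg_neg] at e2
    rw [neg_div, div_self hR.ne', e2] at e
    have e3 : ∫ s in (-R)..R, deriv (p.contourPlus R) s * F (p.contourPlus R s) =
        ∫ s in (-R)..R, (1 / R : ℝ) • (-(p.polarMap R (-(s / R)) * (Complex.I * (p.opening R : ℝ)) *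
          F (p.polarMap R (-(s / R))))) := by
      rw [intervalIntegral.integral_of_le (by linarith),
        intervalIntegral.integral_of_le (by linarith),
        integral_Ioc_eq_integral_Ioo, integral_Ioc_eq_integral_Ioo]
      refine setIntegral_congr_fun measurableSet_Ioo fun s hs => ?_
      rw [(deriv_contourPlus_of_mem hp hR hs).deriv, contourPlus_of_mem hp hR ⟨hs.1.le, hs.2.le⟩]
      simp only [Complex.real_smul]
      push_cast
      ring
    rw [e3, intervalIntegral.integral_smul, e, smul_smul, one_div, inv_mul_cancel₀ hR.ne',
      one_smul, intervalIntegral.integral_neg]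
  have key := integral_polarMap_boundary hp hR hρ hF
  rw [h1, h2, h3]
  linear_combination -key

lemma continuous_comp_contourPlus (hp : p.IsPhysical) {R : ℝ} (hR : 0 < R) {F : ℂ → ℂ}
    (hF : ∀ k ∈ p.closedRegion R, ContinuousAt F k) :
    Continuous (fun s => F (p.contourPlus R s)) := by
  rw [continuous_iff_continuousAt]
  intro s
  exact ContinuousAt.comp (g := F) (hF _ (contourPlus_mem hp hR s).1)
    (continuous_contourPlus hp hR).continuousAt

/-- Cauchy's theorem for `D₀⁺`. -/
lemma integral_contourPlus_eq_zero (hp : p.IsPhysical) {R : ℝ} (hR : 0 < R) {F : ℂ → ℂ}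
    (hF : ∀ k ∈ p.closedRegion R, DifferentiableAt ℂ F k) {C S : ℝ}
    (hb : ∀ k ∈ p.closedRegion R, S ≤ ‖k‖ → ‖F k‖ ≤ C / ‖k‖ ^ 2) :
    Integrable (fun s => deriv (p.contourPlus R) s * F (p.contourPlus R s)) ∧
      ∫ s, deriv (p.contourPlus R) s * F (p.contourPlus R s) = 0 := by
  have hi : Integrable (fun s => deriv (p.contourPlus R) s * F (p.contourPlus R s)) := by
    refine integrable_contourPlus hp hR (continuous_comp_contourPlus hp hR
      fun k hk => (hF k hk).continuousAt) (C := C) (S := max S R) fun s hs => ?_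
    have h1 : ‖p.contourPlus R s‖ = |s| := by
      rw [norm_contourPlus hp hR, max_eq_right ((le_max_right _ _).trans hs)]
    have := hb _ (contourPlus_mem hp hR s).1 (h1 ▸ (le_max_left _ _).trans hs)
    rwa [h1, sq_abs] at this
  refine ⟨hi, ?_⟩
  -- The arc of radius `ρ` has length at most `π ρ` and the integrand is at most `C / ρ²` on it, so
  -- the arc integral tends to zero.
  have hlim := intervalIntegral_tendsto_integral hi tendsto_neg_atTop_atBot tendsto_id
  refine tendsto_nhds_unique hlim ?_
  have hz : Tendsto (fun ρ : ℝ => C * π / ρ) atTop (𝓝 0) :=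
    tendsto_const_nhds.div_atTop tendsto_id
  refine squeeze_zero_norm' ?_ hz
  filter_upwards [eventually_ge_atTop R, eventually_ge_atTop S] with ρ h1 h2
  have hρ : 0 < ρ := hR.trans_le h1
  simp only [id]
  rw [integral_contourPlus_symm hp hR h1 hF hi, norm_neg]
  have hbd : ∀ v ∈ uIoc (-1 : ℝ) 1, ‖p.polarMap ρ v * (Complex.I * (p.opening ρ : ℝ)) *
        F (p.polarMap ρ v)‖ ≤ π / 2 * (C / ρ) := by
    intro v hv
    rw [uIoc_of_le (by norm_num)] at hv
    have h3 := hb _ (polarMap_mem_closedRegion hp hR h1 (abs_le.2 ⟨hv.1.le, hv.2⟩))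
      (by rwa [norm_polarMap hρ])
    rw [norm_polarMap hρ] at h3
    rw [norm_mul, norm_mul, norm_mul, norm_polarMap hρ, Complex.norm_I, one_mul, Complex.norm_real,
      Real.norm_of_nonneg (opening_pos hp hρ).le]
    have h4 := opening_lt hp hρ
    have h5 := opening_pos hp hρ
    calc ρ * p.opening ρ * ‖F (p.polarMap ρ v)‖ ≤ ρ * (π / 2) * (C / ρ ^ 2) := by gcongr
      _ = π / 2 * (C / ρ) := by field_simp
  refine (intervalIntegral.norm_integral_le_of_norm_le_const hbd).trans (le_of_eq ?_)
  norm_num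
  ring

/-! ### A simple pole inside `D₀⁺` -/

lemma add_ne_zero_of_im_pos {k : ℂ} (hk : 0 < k.im) {κ : ℝ} (hκ : 0 < κ) :
    k + κ * Complex.I ≠ 0 := fun h => by
  have := congrArg Complex.im h
  simp at this
  linarith

lemma sq_add_sq_eq (k : ℂ) (κ : ℝ) :
    k ^ 2 + (κ : ℂ) ^ 2 = (k - κ * Complex.I) * (k + κ * Complex.I) := by
  linear_combination ((κ : ℂ) ^ 2) * Complex.I_sq

/-- The Möbius map with zero `iκ` and pole `-iκ`. -/
def moebius (κ : ℝ) (k : ℂ) : ℂ := (k - κ * Complex.I) / (k + κ * Complex.I)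

lemma moebius_im {κ : ℝ} {k : ℂ} :
    (moebius κ k).im = -(2 * κ * k.re) / Complex.normSq (k + κ * Complex.I) := by
  rw [moebius, Complex.div_im]
  simp
  ring

lemma hasDerivAt_log_moebius {κ : ℝ} {k c : ℂ} (hc : c ≠ 0) (h1 : k - κ * Complex.I ≠ 0)
    (h2 : k + κ * Complex.I ≠ 0) (h3 : c * moebius κ k ∈ Complex.slitPlane) :
    HasDerivAt (fun k => Complex.log (c * moebius κ k))
      (2 * κ * Complex.I * (1 / (k ^ 2 + (κ : ℂ) ^ 2))) k := by
  have h4 : HasDerivAt (moebius κ) (2 * κ * Complex.I / (k + κ * Complex.I) ^ 2) k := by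
    refine (((hasDerivAt_id k).sub_const (κ * Complex.I)).div
      ((hasDerivAt_id k).add_const (κ * Complex.I)) h2).congr_deriv ?_
    simp only [id]
    congr 1
    ring
  refine ((h4.const_mul c).clog h3).congr_deriv ?_
  rw [sq_add_sq_eq, moebius]
  field_simp

/-- The function `2iκ / (k² + κ²)` is the logarithmic derivative of `moebius κ`, so the integral
measures the change of its logarithm. At both ends of the contour `moebius` tends to `1`, and at `s
= 0` it equals the negative number `-x`. The half `s ≥ 0` is covered by the branch `log (i ·
moebius)`, the half `s ≤ 0` by `log (-i · moebius)`; the terms `log x` cancel and `2πi` remains. -/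
lemma integral_contourPlus_inv (hp : p.IsPhysical) {R κ : ℝ} (hR : 0 < R) (hκ : R < κ) :
    Integrable (fun s => deriv (p.contourPlus R) s *
      (1 / (p.contourPlus R s ^ 2 + (κ : ℂ) ^ 2))) ∧
    ∫ s, deriv (p.contourPlus R) s * (1 / (p.contourPlus R s ^ 2 + (κ : ℂ) ^ 2)) =
      (π / κ : ℂ) := by
  have hκ0 := hR.trans hκ
  have hκ' : (κ : ℂ) ≠ 0 := by exact_mod_cast hκ0.ne'
  set c := p.contourPlus R with hc
  have hcc : Continuous c := continuous_contourPlus hp hR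
  have hp1 : ∀ s, c s + κ * Complex.I ≠ 0 := fun s =>
    add_ne_zero_of_im_pos (contourPlus_mem hp hR s).1.1 hκ0
  have hm1 : ∀ s, c s - κ * Complex.I ≠ 0 := fun s => sub_ne_zero.2
    (contourPlus_ne_of_mem hp hR (ofReal_mul_I_mem_D0Plus hp hR hκ) s)
  have hne : ∀ s, c s ^ 2 + (κ : ℂ) ^ 2 ≠ 0 := fun s => by
    rw [sq_add_sq_eq]; exact mul_ne_zero (hm1 s) (hp1 s)
  have hi : Integrable (fun s => deriv c s * (1 / (c s ^ 2 + (κ : ℂ) ^ 2))) := by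
    refine integrable_contourPlus hp hR (by fun_prop (disch := exact hne _)) (C := 2)
      (S := 2 * κ) fun s hs => ?_
    have h1 : ‖c s‖ = |s| := by
      rw [hc, norm_contourPlus hp hR, max_eq_right (by linarith)]
    have h2 : ‖c s‖ ^ 2 - κ ^ 2 ≤ ‖c s ^ 2 + (κ : ℂ) ^ 2‖ := by
      have := norm_sub_norm_le (c s ^ 2) (-(κ : ℂ) ^ 2)
      rw [sub_neg_eq_add, norm_neg, norm_pow, norm_pow, Complex.norm_real,
        Real.norm_of_nonneg hκ0.le] at this
      exact this
    rw [h1, sq_abs] at h2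
    have h3 : (2 * κ) ^ 2 ≤ s ^ 2 := by
      rw [← sq_abs s]; exact pow_le_pow_left₀ (by positivity) hs 2
    have h4 : 0 < s ^ 2 := by nlinarith
    rw [norm_div, norm_one, div_le_div_iff₀ (by nlinarith) h4]
    nlinarith
  refine ⟨hi, ?_⟩
  have hmc : Continuous fun s => moebius κ (c s) := by
    unfold moebius
    fun_prop (disch := exact hp1 _)
  have hdiff : ∀ s ∉ ({-R, R} : Set ℝ), ∀ a : ℂ, a ≠ 0 →
      a * moebius κ (c s) ∈ Complex.slitPlane →
      HasDerivAt (fun s => Complex.log (a * moebius κ (c s)))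
        (2 * κ * Complex.I * (deriv c s * (1 / (c s ^ 2 + (κ : ℂ) ^ 2)))) s := by
    intro s hs a ha hsl
    have h1 := (hasDerivAt_log_moebius ha (hm1 s) (hp1 s) hsl).comp s
      (differentiableAt_contourPlus hp hR hs).hasDerivAt
    refine h1.congr_deriv ?_
    ring
  have hnorm : ∀ s, 0 < Complex.normSq (c s + κ * Complex.I) := fun s =>
    Complex.normSq_pos.2 (hp1 s)
  set x : ℝ := (κ - R) / (κ + R) with hx
  have hx0 : 0 < x := div_pos (by linarith) (by linarith)
  have hm0 : moebius κ (c 0) = -(x : ℂ) := by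
    have : (κ : ℂ) + R ≠ 0 := by exact_mod_cast (show κ + R ≠ 0 by linarith)
    have h2 : (R : ℂ) + κ ≠ 0 := by rwa [add_comm]
    rw [hc, contourPlus_zero hp hR, moebius, hx]
    push_cast
    rw [← sub_mul, ← add_mul, mul_div_mul_right _ _ Complex.I_ne_zero]
    field_simp
    ring
  have hright : ∀ s, 0 ≤ s → Complex.I * moebius κ (c s) ∈ Complex.slitPlane := by
    intro s hs
    rcases hs.lt_or_eq with h | h
    · left
      have h1 := contourPlus_re_pos hp hR h
      simp only [Complex.mul_re, Complex.I_re, zero_mul, Complex.I_im, one_mul, zero_sub]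
      rw [moebius_im, neg_div, neg_neg]
      exact div_pos (by positivity) (hnorm s)
    · right
      rw [← h, hm0]
      simpa using hx0.ne'
  have hleft : ∀ s, s ≤ 0 → -Complex.I * moebius κ (c s) ∈ Complex.slitPlane := by
    intro s hs
    rcases hs.lt_or_eq with h | h
    · left
      have h1 := contourPlus_re_neg hp hR h
      simp only [Complex.mul_re, Complex.neg_re, Complex.I_re, neg_zero, zero_mul, Complex.neg_im,
        Complex.I_im, zero_sub]
      rw [moebius_im, neg_one_mul, neg_neg]
      exact div_pos (by have := mul_pos hκ0 (neg_pos.2 h1); linarith) (hnorm s)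
    · right
      rw [h, hm0]
      simpa using hx0.ne'
  have hinf : ∀ u : ℝ → ℝ, Tendsto (fun ρ => |u ρ|) atTop atTop →
      Tendsto (fun ρ => moebius κ (c (u ρ))) atTop (𝓝 1) := by
    intro u hu
    have h0 : Tendsto (fun ρ => ‖c (u ρ) + κ * Complex.I‖) atTop atTop := by
      refine tendsto_atTop_mono (fun ρ => ?_) (tendsto_atTop_add_const_right _ (-κ) hu)
      have h1 := norm_sub_norm_le (c (u ρ)) (-(κ * Complex.I))
      rw [sub_neg_eq_add, norm_neg, norm_mul, Complex.norm_I, mul_one, Complex.norm_real,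
        Real.norm_of_nonneg hκ0.le, hc, norm_contourPlus hp hR] at h1
      linarith [le_max_right R |u ρ|]
    have h1 : Tendsto (fun ρ => 1 - 2 * κ * Complex.I * (c (u ρ) + κ * Complex.I)⁻¹) atTop
        (𝓝 (1 - 2 * κ * Complex.I * 0)) :=
      ((tendsto_inv₀_cobounded.comp (tendsto_norm_atTop_iff_cobounded.1 h0)).const_mul _).const_sub
        1
    rw [mul_zero, sub_zero] at h1
    refine h1.congr fun ρ => ?_
    have := hp1 (u ρ)
    rw [moebius]
    field_simp
    ring
  have hlimR : Tendsto (fun ρ : ℝ => Complex.log (Complex.I * moebius κ (c ρ))) atTop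
      (𝓝 (Complex.log Complex.I)) := by
    have h1 := (hinf id tendsto_abs_atTop_atTop).const_mul Complex.I
    rw [mul_one] at h1
    exact h1.clog (Or.inr (by simp))
  have hlimL : Tendsto (fun ρ : ℝ => Complex.log (-Complex.I * moebius κ (c (-ρ)))) atTop
      (𝓝 (Complex.log (-Complex.I))) := by
    have h1 := (hinf (fun ρ => -ρ) (by simpa using tendsto_abs_atTop_atTop)).const_mul (-Complex.I)
    rw [mul_one] at h1
    exact h1.clog (Or.inr (by simp))
  have hcount : ({-R, R} : Set ℝ).Countable := (Set.toFinite _).countable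
  have hint : ∀ a b : ℝ, IntervalIntegrable (fun s => 2 * κ * Complex.I *
      (deriv c s * (1 / (c s ^ 2 + (κ : ℂ) ^ 2)))) volume a b :=
    fun a b => (hi.const_mul _).intervalIntegrable
  have hfinite : ∀ ρ : ℝ, 0 ≤ ρ → ∫ s in (-ρ)..ρ, 2 * κ * Complex.I *
      (deriv c s * (1 / (c s ^ 2 + (κ : ℂ) ^ 2))) =
      (Complex.log (-Complex.I * moebius κ (c 0)) - Complex.log (-Complex.I * moebius κ (c (-ρ)))) +
      (Complex.log (Complex.I * moebius κ (c ρ)) - Complex.log (Complex.I * moebius κ (c 0))) := by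
    intro ρ hρ
    rw [← intervalIntegral.integral_add_adjacent_intervals (hint (-ρ) 0) (hint 0 ρ)]
    congr 1
    · refine integral_eq_of_hasDerivAt_off_countable_of_le
        (f := fun s => Complex.log (-Complex.I * moebius κ (c s))) _ (by linarith) hcount ?_ ?_
        (hint _ _)
      · exact (hmc.continuousOn.const_mul _).clog fun s hs => hleft s hs.2
      · exact fun s hs => hdiff s hs.2 _ (by simp) (hleft s hs.1.2.le)
    · refine integral_eq_of_hasDerivAt_off_countable_of_le
        (f := fun s => Complex.log (Complex.I * moebius κ (c s))) _ hρ hcount ?_ ?_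
        (hint _ _)
      · exact (hmc.continuousOn.const_mul _).clog fun s hs => hright s hs.1
      · exact fun s hs => hdiff s hs.2 _ (by simp) (hright s hs.1.1.le)
  have hlim := intervalIntegral_tendsto_integral (hi.const_mul (2 * κ * Complex.I))
    tendsto_neg_atTop_atBot tendsto_id
  have hlim2 := (hlimL.const_sub (Complex.log (-Complex.I * moebius κ (c 0)))).add
    (hlimR.sub_const (Complex.log (Complex.I * moebius κ (c 0))))
  have hfin := tendsto_nhds_unique (hlim.congr' (by
    filter_upwards [eventually_ge_atTop 0] with ρ hρ
    exact hfinite ρ hρ)) hlim2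
  rw [integral_const_mul, hm0, show -Complex.I * -(x : ℂ) = x * Complex.I by ring,
    show Complex.I * -(x : ℂ) = x * -Complex.I by ring, Complex.log_ofReal_mul hx0 Complex.I_ne_zero,
    Complex.log_ofReal_mul hx0 (neg_ne_zero.2 Complex.I_ne_zero), Complex.log_I, Complex.log_neg_I]
    at hfin
  have h2I : 2 * (κ : ℂ) * Complex.I ≠ 0 := by simp [hκ']
  apply mul_left_cancel₀ h2I
  rw [hfin]
  field_simp
  ring

/-- The residue theorem for `D₀⁺` and a simple pole on the imaginary axis. -/
lemma integral_contourPlus_pole (hp : p.IsPhysical) {R κ : ℝ} (hR : 0 < R) (hκ : R < κ)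
    {h : ℂ → ℂ} (hh : ∀ k ∈ p.closedRegion R, DifferentiableAt ℂ h k) {C S : ℝ}
    (hb : ∀ k ∈ p.closedRegion R, S ≤ ‖k‖ → ‖h k‖ ≤ C) :
    ∫ s, deriv (p.contourPlus R) s * (h (p.contourPlus R s) /
      (p.contourPlus R s ^ 2 + (κ : ℂ) ^ 2)) = (π / κ : ℂ) * h (κ * Complex.I) := by
  have hκ0 := hR.trans hκ
  have hmem := ofReal_mul_I_mem_D0Plus hp hR hκ
  set k₀ : ℂ := κ * Complex.I
  -- Subtracting the value `h k₀` removes the pole: away from `k₀`, `G` is `(h k - h k₀) / (k² +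
  -- κ²)`. It is holomorphic and decays quadratically, so only the multiple `h k₀` of
  -- `integral_contourPlus_inv` is left.
  set G : ℂ → ℂ := fun k => dslope h k₀ k / (k + k₀)
  have hnhd : p.D0Plus R ∈ 𝓝 k₀ := (isOpen_D0Plus hp R).mem_nhds hmem
  have hsub : p.D0Plus R ⊆ p.closedRegion R := by
    rw [← closure_D0Plus hp hR]; exact subset_closure
  have hG : ∀ k ∈ p.closedRegion R, DifferentiableAt ℂ G k := by
    intro k hk
    have h1 : DifferentiableAt ℂ (dslope h k₀) k := by
      by_cases hkk : k = k₀
      · have h2 : DifferentiableOn ℂ h (p.D0Plus R) := fun x hx =>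
          (hh x (hsub hx)).differentiableWithinAt
        have h3 := (Complex.differentiableOn_dslope hnhd).2 h2
        rw [hkk]
        exact h3.differentiableAt hnhd
      · exact (differentiableAt_dslope_of_ne hkk).2 (hh k hk)
    exact h1.div (by fun_prop) (add_ne_zero_of_im_pos hk.1 hκ0)
  have hGe : ∀ k, k ≠ k₀ → G k = (h k - h k₀) / (k ^ 2 + (κ : ℂ) ^ 2) := by
    intro k hk
    simp only [G]
    rw [dslope_of_ne _ hk, slope_def_field, sq_add_sq_eq, div_div]
  have hk0 : ‖k₀‖ = κ := by simp [k₀, abs_of_pos hκ0]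
  obtain ⟨hGi, hG0⟩ := integral_contourPlus_eq_zero hp hR hG (C := 2 * (C + ‖h k₀‖))
    (S := max S (2 * κ)) (by
      intro k hk hk2
      have h1 := hb k hk ((le_max_left _ _).trans hk2)
      have h2 : 2 * κ ≤ ‖k‖ := (le_max_right _ _).trans hk2
      have hne : k ≠ k₀ := by rintro rfl; linarith
      have h3 : ‖k‖ ^ 2 - κ ^ 2 ≤ ‖k ^ 2 + (κ : ℂ) ^ 2‖ := by
        have := norm_sub_norm_le (k ^ 2) (-(κ : ℂ) ^ 2)
        rw [sub_neg_eq_add, norm_neg, norm_pow, norm_pow, Complex.norm_real,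
          Real.norm_of_nonneg hκ0.le] at this
        exact this
      have h4 : (2 * κ) ^ 2 ≤ ‖k‖ ^ 2 := pow_le_pow_left₀ (by positivity) h2 2
      have h5 := norm_sub_le (h k) (h k₀)
      have h6 : 0 < ‖k‖ ^ 2 := by nlinarith
      rw [hGe k hne, norm_div, div_le_div_iff₀ (by nlinarith) h6]
      have h7 : ‖k‖ ^ 2 ≤ 2 * ‖k ^ 2 + (κ : ℂ) ^ 2‖ := by nlinarith
      calc ‖h k - h k₀‖ * ‖k‖ ^ 2 ≤ (C + ‖h k₀‖) * (2 * ‖k ^ 2 + (κ : ℂ) ^ 2‖) := by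
            have h8 : ‖h k - h k₀‖ ≤ C + ‖h k₀‖ := by linarith
            exact mul_le_mul h8 h7 (by positivity) ((norm_nonneg _).trans h8)
        _ = _ := by ring)
  obtain ⟨hi, hI⟩ := integral_contourPlus_inv hp hR hκ
  have e : ∀ s, deriv (p.contourPlus R) s * (h (p.contourPlus R s) /
      (p.contourPlus R s ^ 2 + (κ : ℂ) ^ 2)) =
      deriv (p.contourPlus R) s * G (p.contourPlus R s) + h k₀ *
      (deriv (p.contourPlus R) s * (1 / (p.contourPlus R s ^ 2 + (κ : ℂ) ^ 2))) := by
    intro s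
    rw [hGe _ (contourPlus_ne_of_mem hp hR hmem s)]
    ring
  simp_rw [e]
  rw [integral_add hGi (hi.const_mul _), hG0, integral_const_mul, hI]
  ring

/-! ### Uniqueness for truncated Laplace transforms -/

/-- The Laplace transform of `F` on `[0, T]`, shifted so that it is bounded in the left
half-plane. -/
def shiftedLaplace (F : ℝ → ℂ) (T : ℝ) (z : ℂ) : ℂ :=
  ∫ s in (0 : ℝ)..T, Complex.exp (z * ((T : ℂ) - s)) * F s

lemma norm_exp_mul_sub_le {z : ℂ} {T s c : ℝ} (hs : s ∈ Icc 0 T) (hc : z.re ≤ c) (hc0 : 0 ≤ c) :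
    ‖Complex.exp (z * ((T : ℂ) - s))‖ ≤ Real.exp (c * T) := by
  rw [← Complex.ofReal_sub, Complex.norm_exp, Complex.re_mul_ofReal]
  apply Real.exp_le_exp.2
  nlinarith [mul_le_mul_of_nonneg_right hc (sub_nonneg.2 hs.2), mul_nonneg hc0 hs.1]

lemma norm_shiftedLaplace_le {F : ℝ → ℂ} {T c : ℝ} (hT : 0 ≤ T)
    (hF : IntervalIntegrable F volume 0 T) {z : ℂ} (hz : z.re ≤ c) (hc : 0 ≤ c) :
    ‖shiftedLaplace F T z‖ ≤ Real.exp (c * T) * ∫ s in (0 : ℝ)..T, ‖F s‖ := by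
  rw [← intervalIntegral.integral_const_mul]
  refine intervalIntegral.norm_integral_le_of_norm_le hT ?_ (hF.norm.const_mul _)
  filter_upwards with s hs
  rw [norm_mul]
  exact mul_le_mul_of_nonneg_right (norm_exp_mul_sub_le ⟨hs.1.le, hs.2⟩ hz hc) (norm_nonneg _)

lemma differentiable_shiftedLaplace {F : ℝ → ℂ} {T : ℝ} (hT : 0 ≤ T)
    (hF : IntervalIntegrable F volume 0 T) : Differentiable ℂ (shiftedLaplace F T) := by
  intro z₀
  have hm := hF.aestronglyMeasurable
  have hcont : ∀ z : ℂ, AEStronglyMeasurable (fun s : ℝ => Complex.exp (z * ((T : ℂ) - s)) * F s)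
      (volume.restrict (uIoc 0 T)) := fun z => by
    rw [uIoc_of_le hT]
    exact (Continuous.aestronglyMeasurable (by fun_prop)).mul hm
  refine (intervalIntegral.hasDerivAt_integral_of_dominated_loc_of_deriv_le
    (F' := fun z s => Complex.exp (z * ((T : ℂ) - s)) * ((T : ℂ) - s) * F s)
    (bound := fun s => Real.exp ((‖z₀‖ + 1) * T) * T * ‖F s‖)
    (Metric.ball_mem_nhds z₀ one_pos) (Eventually.of_forall hcont) ?_ ?_ ?_ ?_ ?_).2.differentiableAt
  · exact hF.continuousOn_mul (by fun_prop)
  · rw [uIoc_of_le hT]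
    exact (Continuous.aestronglyMeasurable (by fun_prop)).mul hm
  · filter_upwards with s hs z hz
    rw [uIoc_of_le hT] at hs
    have h1 : z.re ≤ ‖z₀‖ + 1 := by
      have := norm_sub_norm_le z z₀
      rw [mem_ball_iff_norm] at hz
      linarith [Complex.re_le_norm z]
    rw [norm_mul, norm_mul]
    have h2 : ‖(T : ℂ) - s‖ ≤ T := by
      rw [← Complex.ofReal_sub, Complex.norm_real, Real.norm_of_nonneg (sub_nonneg.2 hs.2)]
      linarith [hs.1]
    have h3 := norm_exp_mul_sub_le ⟨hs.1.le, hs.2⟩ h1 (by positivity)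
    gcongr
  · exact hF.norm.const_mul _
  · filter_upwards with s hs z hz
    have h := (((hasDerivAt_id z).mul_const ((T : ℂ) - s)).cexp).mul_const (F s)
    simpa using h

/-- A function on `[0, T]` whose Laplace transform decays like `exp (-xT')` along the positive
reals vanishes on `(0, T')`. -/
lemma eq_zero_of_laplace_le {F : ℝ → ℂ} {T' T : ℝ} (hT' : 0 < T') (hTT : T' ≤ T)
    (hF : IntervalIntegrable F volume 0 T) {C x₀ : ℝ}
    (hb : ∀ x ≥ x₀, ‖∫ s in (0 : ℝ)..T, ((Real.exp (-x * s) : ℝ) : ℂ) * F s‖ ≤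
      C * Real.exp (-x * T')) {t : ℝ} (ht : t ∈ Ioo 0 T') (hc : ContinuousAt F t) : F t = 0 := by
  have hF1 : IntervalIntegrable F volume 0 T' := hF.mono_set (by
    rw [uIcc_of_le hT'.le, uIcc_of_le (hT'.le.trans hTT)]; exact Icc_subset_Icc_right hTT)
  have hF2 : IntervalIntegrable F volume T' T := hF.mono_set (by
    rw [uIcc_of_le hTT, uIcc_of_le (hT'.le.trans hTT)]; exact Icc_subset_Icc_left hT'.le)
  set G := shiftedLaplace F T' with hG
  set N := ∫ s in (0 : ℝ)..T', ‖F s‖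
  have hN : 0 ≤ N := intervalIntegral.integral_nonneg hT'.le fun _ _ => norm_nonneg _
  have hGd : Differentiable ℂ G := differentiable_shiftedLaplace hT'.le hF1
  have hleft : ∀ z : ℂ, z.re ≤ 0 → ‖G z‖ ≤ N := fun z hz => by
    simpa using norm_shiftedLaplace_le hT'.le hF1 hz le_rfl
  -- The shift multiplies by `e^{xT'}`. This turns both the assumed bound and the tail over `[T',
  -- T]`, each of size `e^{-xT'}`, into constants.
  have hreal : ∀ x : ℝ, x₀ ≤ x → 0 ≤ x → ‖G x‖ ≤ C + ∫ s in T'..T, ‖F s‖ := by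
    intro x hx hx0
    have hsplit : G x = ((Real.exp (x * T') : ℝ) : ℂ) *
        ((∫ s in (0 : ℝ)..T, ((Real.exp (-x * s) : ℝ) : ℂ) * F s) -
          ∫ s in T'..T, ((Real.exp (-x * s) : ℝ) : ℂ) * F s) := by
      have h1 : IntervalIntegrable (fun s => ((Real.exp (-x * s) : ℝ) : ℂ) * F s) volume 0 T :=
        hF.continuousOn_mul (by fun_prop)
      have h2 : IntervalIntegrable (fun s => ((Real.exp (-x * s) : ℝ) : ℂ) * F s) volume T' T :=
        hF2.continuousOn_mul (by fun_prop)
      have h3 : IntervalIntegrable (fun s => ((Real.exp (-x * s) : ℝ) : ℂ) * F s) volume 0 T' :=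
        hF1.continuousOn_mul (by fun_prop)
      rw [← intervalIntegral.integral_add_adjacent_intervals h3 h2, add_sub_cancel_right,
        ← intervalIntegral.integral_const_mul, hG, shiftedLaplace]
      refine intervalIntegral.integral_congr fun s _ => ?_
      rw [← mul_assoc, ← Complex.ofReal_mul, ← Real.exp_add]
      push_cast
      congr 2
      ring
    have h4 : ‖∫ s in T'..T, ((Real.exp (-x * s) : ℝ) : ℂ) * F s‖ ≤
        Real.exp (-x * T') * ∫ s in T'..T, ‖F s‖ := by
      rw [← intervalIntegral.integral_const_mul]
      refine intervalIntegral.norm_integral_le_of_norm_le hTT ?_ (hF2.norm.const_mul _)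
      filter_upwards with s hs
      rw [norm_mul, Complex.norm_real, Real.norm_of_nonneg (Real.exp_pos _).le]
      refine mul_le_mul_of_nonneg_right (Real.exp_le_exp.2 ?_) (norm_nonneg _)
      nlinarith [hs.1]
    have h5 := (norm_sub_le _ _).trans (add_le_add (hb x hx) h4)
    rw [hsplit, norm_mul, Complex.norm_real, Real.norm_of_nonneg (Real.exp_pos _).le]
    refine (mul_le_mul_of_nonneg_left h5 (Real.exp_pos _).le).trans (le_of_eq ?_)
    have h6 : Real.exp (x * T') * Real.exp (-x * T') = 1 := by
      rw [← Real.exp_add]; simp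
    linear_combination (C + ∫ s in T'..T, ‖F s‖) * h6
  -- Phragmén–Lindelöf in the half-plane: `G` is bounded by `N` on the imaginary axis, bounded on
  -- the positive reals, and of growth order one, below the critical order two.
  have hright : ∀ z : ℂ, 0 ≤ z.re → ‖G z‖ ≤ N := by
    intro z hz
    refine PhragmenLindelof.right_half_plane_of_bounded_on_real hGd.diffContOnCl
      ⟨1, by norm_num, T', ?_⟩ ?_ (fun x => hleft _ (by simp)) hz
    · refine Asymptotics.IsBigO.of_bound N ?_
      filter_upwards with z
      have := norm_shiftedLaplace_le hT'.le hF1 (Complex.re_le_norm z) (norm_nonneg z)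
      rwa [Real.norm_of_nonneg (Real.exp_pos _).le, Real.rpow_one, mul_comm T', mul_comm N]
    · refine isBoundedUnder_of_eventually_le (a := C + ∫ s in T'..T, ‖F s‖) ?_
      filter_upwards [eventually_ge_atTop x₀, eventually_ge_atTop 0] with x h1 h2
      exact hreal x h1 h2
  have hconst : ∀ z, G z = G 0 := fun z =>
    hGd.apply_eq_apply_of_bounded (isBounded_iff_forall_norm_le.2 ⟨N, by
      rintro _ ⟨w, rfl⟩
      exact (le_total w.re 0).elim (hleft w) (hright w)⟩) z 0
  set f : ℝ → ℂ := (Ioc 0 T').indicator F with hf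
  have hfi : Integrable f :=
    (intervalIntegrable_iff_integrableOn_Ioc_of_le hT'.le).1 hF1 |>.integrable_indicator
      measurableSet_Ioc
  have hfour : ∀ ξ : ℝ, FourierTransform.fourier f ξ =
      Complex.exp (-(2 * π * ξ * T') * Complex.I) * G (2 * π * ξ * Complex.I) := by
    intro ξ
    rw [Real.fourier_eq', hG, shiftedLaplace, ← intervalIntegral.integral_const_mul,
      intervalIntegral.integral_of_le hT'.le, ← integral_indicator measurableSet_Ioc]
    refine integral_congr_ae (Eventually.of_forall fun s => ?_)
    simp only [hf, indicator]
    split_ifs with h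
    · rw [← mul_assoc, ← Complex.exp_add, smul_eq_mul]
      congr 2
      simp
      ring
    · simp
  have hnorm : ∀ ξ : ℝ, ‖FourierTransform.fourier f ξ‖ = ‖G 0‖ := by
    intro ξ
    rw [hfour, hconst, norm_mul]
    have : ‖Complex.exp (-(2 * π * ξ * T') * Complex.I)‖ = 1 := by
      have := Complex.norm_exp_ofReal_mul_I (-(2 * π * ξ * T'))
      push_cast at this
      exact this
    rw [this, one_mul]
  -- By Liouville `G` is constant, so the Fourier transform of the truncation of `F` has constant
  -- modulus. Riemann–Lebesgue makes it zero, and Fourier inversion at the continuity point `t`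
  -- finishes.
  have hzero : ‖G 0‖ = 0 := by
    have h1 := (Real.zero_at_infty_fourier f).norm
    simp only [hnorm, norm_zero] at h1
    exact tendsto_nhds_unique tendsto_const_nhds h1
  have hfz : FourierTransform.fourier f = 0 := by
    ext ξ
    exact norm_eq_zero.1 ((hnorm ξ).trans hzero)
  have hft : ContinuousAt f t := by
    refine hc.congr ?_
    filter_upwards [Ioo_mem_nhds ht.1 ht.2] with s hs
    exact (indicator_of_mem (show s ∈ Ioc 0 T' from ⟨hs.1, hs.2.le⟩) F).symm
  have hinv := hfi.fourierInv_fourier_eq (by rw [hfz]; exact integrable_zero _ _ _) hft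
  rw [hfz, hf, indicator_of_mem (show t ∈ Ioc 0 T' from ⟨ht.1, ht.2.le⟩)] at hinv
  rw [← hinv, Real.fourierInv_eq']
  simp

/-! ### The truncated Laplace transform of a solution -/

/-- The Laplace transform of `u` on `[0, T]`. -/
def lap (u : ℝ → ℝ) (T y : ℝ) : ℝ := ∫ s in (0 : ℝ)..T, Real.exp (-y * s) * u s

section Solutions

variable {g : ℝ → ℝ} {e q : ℝ → ℝ → ℝ}

lemma isOpen_openStrip (p : GKParams) : IsOpen p.openStrip := isOpen_Ioo.prod isOpen_Ioi

lemma mem_closedStrip_of_pos {x t : ℝ} (hx : x ∈ Icc 0 p.l) (ht : 0 < t) :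
    (x, t) ∈ p.closedStrip := by
  refine ⟨⟨hx, ht.le⟩, ?_⟩
  simp [ht.ne']

lemma mem_closedStrip_of_mem_Ioo {x t : ℝ} (hx : x ∈ Ioo 0 p.l) (ht : 0 ≤ t) :
    (x, t) ∈ p.closedStrip := by
  refine ⟨⟨⟨hx.1.le, hx.2.le⟩, ht⟩, ?_⟩
  simp [hx.1.ne', hx.2.ne]

/-- Partial derivatives of a `C¹` function of two variables. -/
lemma partial_deriv_of_contDiffOn {u : ℝ → ℝ → ℝ}
    (hu : ContDiffOn ℝ 1 (Function.uncurry u) p.openStrip) :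
    (∀ x ∈ Ioo 0 p.l, ∀ t > 0, HasDerivAt (fun s => u x s) (deriv (fun s => u x s) t) t) ∧
    (∀ x ∈ Ioo 0 p.l, ∀ t > 0, HasDerivAt (fun y => u y t) (deriv (fun y => u y t) x) x) ∧
    ContinuousOn (fun z : ℝ × ℝ => deriv (fun s => u z.1 s) z.2) p.openStrip ∧
    ContinuousOn (fun z : ℝ × ℝ => deriv (fun y => u y z.2) z.1) p.openStrip := by
  have hd : ∀ z ∈ p.openStrip, HasFDerivAt (Function.uncurry u)
      (fderiv ℝ (Function.uncurry u) z) z := fun z hz =>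
    ((hu.differentiableOn (by norm_num)).differentiableAt
      ((isOpen_openStrip p).mem_nhds hz)).hasFDerivAt
  have h1 : ∀ z ∈ p.openStrip, HasDerivAt (fun s => u z.1 s)
      (fderiv ℝ (Function.uncurry u) z (0, 1)) z.2 := fun z hz =>
    HasFDerivAt.comp_hasDerivAt (f := fun s => (z.1, s)) z.2 (hd z hz) ((hasDerivAt_const z.2 z.1).prodMk (hasDerivAt_id z.2))
  have h2 : ∀ z ∈ p.openStrip, HasDerivAt (fun y => u y z.2)
      (fderiv ℝ (Function.uncurry u) z (1, 0)) z.1 := fun z hz =>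
    HasFDerivAt.comp_hasDerivAt (f := fun y => (y, z.2)) z.1 (hd z hz) ((hasDerivAt_id z.1).prodMk (hasDerivAt_const z.1 z.2))
  have hc := hu.continuousOn_fderiv_of_isOpen (isOpen_openStrip p) le_rfl
  refine ⟨fun x hx t ht => ?_, fun x hx t ht => ?_, ?_, ?_⟩
  · exact (h1 (x, t) ⟨hx, ht⟩).differentiableAt.hasDerivAt
  · exact (h2 (x, t) ⟨hx, ht⟩).differentiableAt.hasDerivAt
  · exact (hc.clm_apply continuousOn_const).congr fun z hz => (h1 z hz).deriv
  · exact (hc.clm_apply continuousOn_const).congr fun z hz => (h2 z hz).deriv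

lemma hasDerivAt_deriv_of_contDiffOn {f : ℝ → ℝ} {s : Set ℝ} (hs : IsOpen s)
    (hf : ContDiffOn ℝ 2 f s) {x : ℝ} (hx : x ∈ s) :
    HasDerivAt (deriv f) (iteratedDeriv 2 f x) x := by
  have h1 : ContDiffAt ℝ 2 f x := hf.contDiffAt (hs.mem_nhds hx)
  have h2 := (h1.fderiv_right (m := 1) (by norm_num)).differentiableAt (by norm_num)
  have h3 : DifferentiableAt ℝ (deriv f) x := h2.clm_apply (differentiableAt_const (1 : ℝ))
  rw [iteratedDeriv_succ, iteratedDeriv_one]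
  exact h3.hasDerivAt

/-- The conserved density of the global relation. -/
def density (p : GKParams) (e q : ℝ → ℝ → ℝ) (y ν x t : ℝ) : ℝ :=
  Real.exp (ν * x - y * t) * (p.rb * ν * e x t + y * q x t)

/-- The derivative in time of the conserved density. -/
def densityDeriv (p : GKParams) (e q : ℝ → ℝ → ℝ) (y ν x t : ℝ) : ℝ :=
  Real.exp (ν * x - y * t) * (p.rb * ν * deriv (fun s => e x s) t +
    y * deriv (fun s => q x s) t - y * (p.rb * ν * e x t + y * q x t))

/-- The flux belonging to the conserved density. -/
def flux (p : GKParams) (e q : ℝ → ℝ → ℝ) (y ν x t : ℝ) : ℝ :=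
  Real.exp (ν * x - y * t) * (p.rc * y * deriv (fun z => q z t) x - p.rb * y * e x t -
    ν * (p.rc * y + p.rb) * q x t)

namespace IsSolution

lemma hasDerivAt_density (hs : p.IsSolution g e q) (y ν : ℝ) {x t : ℝ} (hx : x ∈ Ioo 0 p.l)
    (ht : 0 < t) : HasDerivAt (p.density e q y ν x) (p.densityDeriv e q y ν x t) t := by
  have h1 := (partial_deriv_of_contDiffOn hs.e_smooth).1 x hx t ht
  have h2 := (partial_deriv_of_contDiffOn hs.q_smooth).1 x hx t ht
  have h3 : HasDerivAt (fun t => Real.exp (ν * x - y * t)) (Real.exp (ν * x - y * t) * (-y)) t := by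
    simpa using (((hasDerivAt_id t).const_mul y).const_sub (ν * x)).exp
  refine (h3.mul ((h1.const_mul (p.rb * ν)).add (h2.const_mul y))).congr_deriv ?_
  simp only [densityDeriv, Pi.add_apply]
  ring

/-- After `e_t = -q_x` and the constitutive law are inserted, everything cancels except a multiple
of `hν`, the dispersion relation for `ω = -y`, `k² = -ν²`. This is the local conservation law with
density `density`. -/
lemma hasDerivAt_flux (hp : p.IsPhysical) (hs : p.IsSolution g e q) {y ν : ℝ}
    (hν : ν ^ 2 * (p.rc * y + p.rb) = y * (y + p.ra)) {x t : ℝ} (hx : x ∈ Ioo 0 p.l)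
    (ht : 0 < t) :
    HasDerivAt (fun x => p.flux e q y ν x t) (p.densityDeriv e q y ν x t) x := by
  have h1 := (partial_deriv_of_contDiffOn hs.e_smooth).2.1 x hx t ht
  have h2 := (partial_deriv_of_contDiffOn hs.q_smooth).2.1 x hx t ht
  have h4 := hasDerivAt_deriv_of_contDiffOn isOpen_Ioo (hs.q_smooth_x t ht) hx
  have h3 : HasDerivAt (fun x => Real.exp (ν * x - y * t)) (Real.exp (ν * x - y * t) * ν) x := by
    simpa using (((hasDerivAt_id x).const_mul ν).sub_const (y * t)).exp
  refine (h3.mul (((h4.const_mul (p.rc * y)).sub (h1.const_mul (p.rb * y))).sub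
    (h2.const_mul (ν * (p.rc * y + p.rb))))).congr_deriv ?_
  have hb := hs.balance x hx t ht
  have hc := hs.constitutive x hx t ht
  have hτ := hp.τ_pos
  have hqt : deriv (fun s => q x s) t = p.rc * iteratedDeriv 2 (fun y => q y t) x -
      p.ra * q x t - p.rb * deriv (fun y => e y t) x := by
    simp only [ra, rb, rc]
    field_simp
    linear_combination hc
  have het : deriv (fun s => e x s) t = -deriv (fun y => q y t) x := by linarith
  simp only [densityDeriv, Pi.sub_apply]
  rw [hqt, het]
  linear_combination (-Real.exp (ν * x - y * t) * q x t) * hν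

lemma continuousOn_densityDeriv (hs : p.IsSolution g e q) (y ν : ℝ) :
    ContinuousOn (fun z : ℝ × ℝ => p.densityDeriv e q y ν z.1 z.2) p.openStrip := by
  have h1 := (partial_deriv_of_contDiffOn hs.e_smooth).2.2.1
  have h2 := (partial_deriv_of_contDiffOn hs.q_smooth).2.2.1
  have h3 : ContinuousOn (fun z : ℝ × ℝ => e z.1 z.2) p.openStrip := hs.e_smooth.continuousOn
  have h4 : ContinuousOn (fun z : ℝ × ℝ => q z.1 z.2) p.openStrip := hs.q_smooth.continuousOn
  unfold densityDeriv
  fun_prop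

lemma continuousOn_density (hs : p.IsSolution g e q) (y ν : ℝ) :
    ContinuousOn (fun z : ℝ × ℝ => p.density e q y ν z.1 z.2) p.closedStrip := by
  have h3 : ContinuousOn (fun z : ℝ × ℝ => e z.1 z.2) p.closedStrip := hs.e_cont
  have h4 : ContinuousOn (fun z : ℝ × ℝ => q z.1 z.2) p.closedStrip := hs.q_cont
  unfold density
  fun_prop

lemma hasDerivAt_integral_density (hp : p.IsPhysical) (hs : p.IsSolution g e q) {y ν : ℝ}
    (hν : ν ^ 2 * (p.rc * y + p.rb) = y * (y + p.ra)) {A B t : ℝ} (hA : 0 < A) (hAB : A ≤ B)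
    (hB : B < p.l) (ht : 0 < t) :
    HasDerivAt (fun t => ∫ x in A..B, p.density e q y ν x t)
      (p.flux e q y ν B t - p.flux e q y ν A t) t := by
  have hI : ∀ x ∈ Icc A B, x ∈ Ioo 0 p.l := fun x hx =>
    ⟨hA.trans_le hx.1, hx.2.trans_lt hB⟩
  have hcd : ∀ t > 0, ContinuousOn (fun x => p.density e q y ν x t) (uIcc A B) := fun t ht => by
    rw [uIcc_of_le hAB]
    exact (hs.continuousOn_density y ν).comp (f := fun x => (x, t)) (by fun_prop)
      fun x hx => mem_closedStrip_of_mem_Ioo (hI x hx) ht.le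
  have hcd' : ∀ t > 0, ContinuousOn (fun x => p.densityDeriv e q y ν x t) (uIcc A B) :=
    fun t ht => by
      rw [uIcc_of_le hAB]
      exact (hs.continuousOn_densityDeriv y ν).comp (f := fun x => (x, t)) (by fun_prop)
        fun x hx => ⟨hI x hx, ht⟩
  obtain ⟨M, hM⟩ := (isCompact_Icc.prod isCompact_Icc).exists_bound_of_continuousOn
    (s := Icc A B ×ˢ Icc (t / 2) (3 * t / 2))
    ((hs.continuousOn_densityDeriv y ν).mono fun z hz =>
      ⟨hI z.1 hz.1, show 0 < z.2 by linarith [hz.2.1]⟩)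
  have hball : ∀ s ∈ Metric.ball t (t / 2), s ∈ Icc (t / 2) (3 * t / 2) ∧ 0 < s := by
    intro s h
    rw [Metric.mem_ball, Real.dist_eq, abs_lt] at h
    exact ⟨⟨by linarith, by linarith⟩, by linarith⟩
  have key := (intervalIntegral.hasDerivAt_integral_of_dominated_loc_of_deriv_le
    (F := fun t x => p.density e q y ν x t) (F' := fun t x => p.densityDeriv e q y ν x t)
    (x₀ := t) (a := A) (b := B) (μ := volume) (bound := fun _ => M)
    (Metric.ball_mem_nhds t (half_pos ht)) ?_ ?_ ?_ ?_ ?_ ?_).2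
  · refine key.congr_deriv ?_
    rw [intervalIntegral.integral_eq_sub_of_hasDerivAt (f := fun x => p.flux e q y ν x t)]
    · intro x hx
      rw [uIcc_of_le hAB] at hx
      exact hs.hasDerivAt_flux hp hν (hI x hx) ht
    · exact (hcd' t ht).intervalIntegrable
  · filter_upwards [Metric.ball_mem_nhds t (half_pos ht)] with s h
    exact ((hcd s (hball s h).2).mono uIoc_subset_uIcc).aestronglyMeasurable measurableSet_uIoc
  · exact (hcd t ht).intervalIntegrable
  · exact ((hcd' t ht).mono uIoc_subset_uIcc).aestronglyMeasurable measurableSet_uIoc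
  · filter_upwards with x hx s h
    have hx' : x ∈ Icc A B := by rw [← uIcc_of_le hAB]; exact uIoc_subset_uIcc hx
    exact hM (x, s) ⟨hx', (hball s h).1⟩
  · exact intervalIntegrable_const
  · filter_upwards with x hx s h
    have hx' : x ∈ Icc A B := by rw [← uIcc_of_le hAB]; exact uIoc_subset_uIcc hx
    exact hs.hasDerivAt_density y ν (hI x hx') (hball s h).2

lemma continuousOn_integral_density (hs : p.IsSolution g e q) (y ν : ℝ) {A B : ℝ}
    (hA : 0 < A) (hAB : A ≤ B) (hB : B < p.l) :
    ContinuousOn (fun t => ∫ x in A..B, p.density e q y ν x t) (Ici 0) := by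
  -- Clamping both variables extends the density continuously to the plane without changing it on
  -- `[A, B] × [0, ∞)`.
  have hc : Continuous (fun z : ℝ × ℝ => p.density e q y ν (max A (min B z.2)) (max 0 z.1)) :=
    (hs.continuousOn_density y ν).comp_continuous
      (f := fun z : ℝ × ℝ => (max A (min B z.2), max 0 z.1)) (by fun_prop) fun z =>
      mem_closedStrip_of_mem_Ioo ⟨lt_max_of_lt_left hA, max_lt (hAB.trans_lt hB)
        (min_lt_of_left_lt hB)⟩ (le_max_left _ _)
  have h := intervalIntegral.continuous_parametric_intervalIntegral_of_continuous'
    (f := fun t x => p.density e q y ν (max A (min B x)) (max 0 t)) (μ := volume) hc A B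
  refine h.continuousOn.congr fun t ht => ?_
  refine intervalIntegral.integral_congr fun x hx => ?_
  rw [uIcc_of_le hAB] at hx
  simp only [max_eq_right (mem_Ici.1 ht), min_eq_right hx.2, max_eq_right hx.1]

lemma continuousOn_time (hs : p.IsSolution g e q) {x : ℝ} (hx : x ∈ Icc 0 p.l) :
    ContinuousOn (e x) (Ioi 0) ∧ ContinuousOn (q x) (Ioi 0) :=
  ⟨hs.e_cont.comp (f := fun t => (x, t)) (by fun_prop) fun _ ht => mem_closedStrip_of_pos hx ht,
    hs.q_cont.comp (f := fun t => (x, t)) (by fun_prop) fun _ ht => mem_closedStrip_of_pos hx ht⟩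

lemma intervalIntegrable_of_bounded {u : ℝ → ℝ} {T : ℝ} (hT : 0 ≤ T)
    (hc : ContinuousOn u (Ioi 0)) {M : ℝ} (hM : ∀ t ∈ Icc 0 T, |u t| ≤ M) :
    IntervalIntegrable u volume 0 T := by
  rw [intervalIntegrable_iff_integrableOn_Ioc_of_le hT]
  refine IntegrableOn.of_bound (by simp) ((hc.mono Ioc_subset_Ioi_self).aestronglyMeasurable
    measurableSet_Ioc) M ?_
  filter_upwards [ae_restrict_mem measurableSet_Ioc] with t ht
  exact hM t ⟨ht.1.le, ht.2⟩

lemma intervalIntegrable_time (hs : p.IsSolution g e q) {x : ℝ} (hx : x ∈ Icc 0 p.l) {T : ℝ}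
    (hT : 0 ≤ T) : IntervalIntegrable (e x) volume 0 T ∧ IntervalIntegrable (q x) volume 0 T := by
  obtain ⟨M, hM⟩ := hs.bounded T
  exact ⟨intervalIntegrable_of_bounded hT (hs.continuousOn_time hx).1 fun t ht => (hM x hx t ht).1,
    intervalIntegrable_of_bounded hT (hs.continuousOn_time hx).2 fun t ht => (hM x hx t ht).2⟩

/-- The global relation on `[A, B]`. -/
lemma global_relation_interior (hp : p.IsPhysical) (hs : p.IsSolution g e q) {y ν : ℝ}
    (hν : ν ^ 2 * (p.rc * y + p.rb) = y * (y + p.ra)) {A B T : ℝ} (hA : 0 < A) (hAB : A ≤ B)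
    (hB : B < p.l) (hT : 0 < T) :
    (∫ x in A..B, p.density e q y ν x T) +
      p.rc * y * (Real.exp (ν * B - y * T) * e B T - Real.exp (ν * A - y * T) * e A T) =
    -(p.rc * y + p.rb) * (Real.exp (ν * B) * (y * lap (e B) T y + ν * lap (q B) T y) -
      Real.exp (ν * A) * (y * lap (e A) T y + ν * lap (q A) T y)) := by
  have hAm : A ∈ Ioo 0 p.l := ⟨hA, hAB.trans_lt hB⟩
  have hBm : B ∈ Ioo 0 p.l := ⟨hA.trans_le hAB, hB⟩
  -- The flux contains `q_x`, about which nothing is known at the ends of the interval. Since `q_x =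
  -- -e_t`, the added term turns it into a time derivative, and `W` involves only `e` and `q`.
  set V : ℝ → ℝ := fun t => (∫ x in A..B, p.density e q y ν x t) +
      p.rc * y * (Real.exp (ν * B - y * t) * e B t - Real.exp (ν * A - y * t) * e A t)
  set W : ℝ → ℝ := fun t => -(p.rc * y + p.rb) *
    (Real.exp (ν * B) * (y * (Real.exp (-y * t) * e B t) + ν * (Real.exp (-y * t) * q B t)) -
      Real.exp (ν * A) * (y * (Real.exp (-y * t) * e A t) + ν * (Real.exp (-y * t) * q A t)))
  have hec : ∀ x ∈ Ioo 0 p.l, ContinuousOn (e x) (Ici 0) := fun x hx =>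
    hs.e_cont.comp (f := fun t => (x, t)) (by fun_prop) fun t ht =>
      mem_closedStrip_of_mem_Ioo hx ht
  have hVc : ContinuousOn V (Icc 0 T) := by
    have h1 := (hs.continuousOn_integral_density y ν hA hAB hB).mono
      (show Icc 0 T ⊆ Ici 0 from Icc_subset_Ici_self)
    have h2 := (hec A hAm).mono (show Icc 0 T ⊆ Ici 0 from Icc_subset_Ici_self)
    have h3 := (hec B hBm).mono (show Icc 0 T ⊆ Ici 0 from Icc_subset_Ici_self)
    simp only [V]
    fun_prop
  have hVd : ∀ t ∈ Ioo 0 T, HasDerivAt V (W t) t := by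
    intro t ht
    have h0 := hs.hasDerivAt_integral_density hp hν hA hAB hB ht.1
    have hexp : ∀ x, HasDerivAt (fun t => Real.exp (ν * x - y * t))
        (Real.exp (ν * x - y * t) * (-y)) t := fun x => by
      simpa using (((hasDerivAt_id t).const_mul y).const_sub (ν * x)).exp
    have he := fun x hx => (partial_deriv_of_contDiffOn hs.e_smooth).1 x hx t ht.1
    have hb := fun x hx => hs.balance x hx t ht.1
    refine (h0.add ((((hexp B).mul (he B hBm)).sub ((hexp A).mul (he A hAm))).const_mul
      (p.rc * y))).congr_deriv ?_
    have hsplit : ∀ x, Real.exp (ν * x - y * t) = Real.exp (ν * x) * Real.exp (-y * t) := fun x => by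
      rw [← Real.exp_add]; ring_nf
    simp only [flux, W, hsplit]
    linear_combination (p.rc * y * Real.exp (ν * B) * Real.exp (-y * t)) * hb B hBm -
      (p.rc * y * Real.exp (ν * A) * Real.exp (-y * t)) * hb A hAm
  have hint : ∀ x ∈ Ioo 0 p.l, IntervalIntegrable (fun t => Real.exp (-y * t) * e x t) volume 0 T ∧
      IntervalIntegrable (fun t => Real.exp (-y * t) * q x t) volume 0 T := fun x hx => by
    obtain ⟨h1, h2⟩ := hs.intervalIntegrable_time ⟨hx.1.le, hx.2.le⟩ hT.le
    exact ⟨h1.continuousOn_mul (by fun_prop), h2.continuousOn_mul (by fun_prop)⟩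
  obtain ⟨iA, jA⟩ := hint A hAm
  obtain ⟨iB, jB⟩ := hint B hBm
  have i1 := ((iB.const_mul y).add (jB.const_mul ν)).const_mul (Real.exp (ν * B))
  have i2 := ((iA.const_mul y).add (jA.const_mul ν)).const_mul (Real.exp (ν * A))
  have hWi : IntervalIntegrable W volume 0 T := (i1.sub i2).const_mul _
  have hFTC := intervalIntegral.integral_eq_sub_of_hasDerivAt_of_le hT.le hVc hVd hWi
  have hV0 : V 0 = 0 := by
    have h1 : ∫ x in A..B, p.density e q y ν x 0 = 0 := by
      rw [intervalIntegral.integral_congr (g := fun _ => (0 : ℝ)), intervalIntegral.integral_zero]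
      intro x hx
      rw [uIcc_of_le hAB] at hx
      obtain ⟨h1, h2⟩ := hs.initial x ⟨hA.trans_le hx.1, hx.2.trans_lt hB⟩
      simp [density, h1, h2]
    simp [V, h1, (hs.initial A hAm).1, (hs.initial B hBm).1]
  rw [hV0, sub_zero] at hFTC
  change V T = _
  rw [← hFTC]
  simp only [W, lap]
  rw [intervalIntegral.integral_const_mul, intervalIntegral.integral_sub i1 i2,
    intervalIntegral.integral_const_mul, intervalIntegral.integral_const_mul,
    intervalIntegral.integral_add (iB.const_mul y) (jB.const_mul ν),
    intervalIntegral.integral_add (iA.const_mul y) (jA.const_mul ν)]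
  simp only [intervalIntegral.integral_const_mul]

end IsSolution

/-! ### Asymptotics of the Laplace transform of a solution -/

/-- The positive `κ` with `-y` a value of the dispersion relation at `iκ`. -/
def kap (p : GKParams) (y : ℝ) : ℝ := √(y * (y + p.ra) / (p.rc * y + p.rb))

lemma kap_nonneg (p : GKParams) (y : ℝ) : 0 ≤ p.kap y := Real.sqrt_nonneg _

lemma kap_sq_mul (hp : p.IsPhysical) {y : ℝ} (hy : 0 ≤ y) :
    p.kap y ^ 2 * (p.rc * y + p.rb) = y * (y + p.ra) := by
  have ha := hp.ra_pos
  have hb := hp.rb_pos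
  have hc := hp.rc_pos
  rw [kap, Real.sq_sqrt (by positivity), div_mul_cancel₀ _ (by positivity)]

lemma kap_sq_le (hp : p.IsPhysical) {y : ℝ} (hy : 1 ≤ y) :
    p.kap y ^ 2 ≤ (1 + p.ra) / p.rc * y := by
  have ha := hp.ra_pos
  have hb := hp.rb_pos
  have hc := hp.rc_pos
  have h := kap_sq_mul hp (zero_le_one.trans hy)
  rw [div_mul_eq_mul_div, le_div_iff₀ hc]
  have h1 : y * (p.kap y ^ 2 * p.rc) ≤ y * (y + p.ra) := by
    nlinarith [mul_nonneg (sq_nonneg (p.kap y)) hb.le]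
  nlinarith [le_of_mul_le_mul_left h1 (by linarith)]

lemma le_kap_sq (hp : p.IsPhysical) {y : ℝ} (hy : 1 ≤ y) :
    y / (p.rc + p.rb) ≤ p.kap y ^ 2 := by
  have ha := hp.ra_pos
  have hb := hp.rb_pos
  have hc := hp.rc_pos
  have h := kap_sq_mul hp (zero_le_one.trans hy)
  rw [div_le_iff₀ (by positivity)]
  have h1 : p.kap y ^ 2 * (p.rc * y + p.rb) ≤ p.kap y ^ 2 * (p.rc + p.rb) * y := by
    nlinarith [mul_nonneg (sq_nonneg (p.kap y)) hb.le, mul_nonneg (mul_nonneg (sq_nonneg (p.kap y)) hb.le) (sub_nonneg.2 hy)]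
  have h2 : y * y ≤ p.kap y ^ 2 * (p.rc + p.rb) * y := by nlinarith
  exact le_of_mul_le_mul_right h2 (by linarith)

/-- For large `y` the pole `iκ` leaves the excised disc and lies inside the contour. -/
lemma eventually_lt_kap (hp : p.IsPhysical) (K : ℝ) : ∀ᶠ y in atTop, K < p.kap y := by
  have hb := hp.rb_pos
  have hc := hp.rc_pos
  filter_upwards [eventually_ge_atTop 1,
    eventually_gt_atTop ((p.rc + p.rb) * K ^ 2)] with y h1 h2
  refine lt_of_pow_lt_pow_left₀ 2 (kap_nonneg p y) (lt_of_lt_of_le ?_ (le_kap_sq hp h1))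
  rw [lt_div_iff₀ (by positivity)]
  linarith

/-- `kap y` grows like `√y`, so factors `e^{κl}` are negligible against any `e^{δy}` with `δ > 0`.
-/
lemma eventually_kap_le (hp : p.IsPhysical) {η : ℝ} (hη : 0 < η) :
    ∀ᶠ y in atTop, p.kap y ≤ η * y := by
  filter_upwards [eventually_ge_atTop 1,
    eventually_ge_atTop ((1 + p.ra) / p.rc / η ^ 2)] with y h1 h2
  refine le_of_sq_le_sq ((kap_sq_le hp h1).trans ?_) (by positivity)
  rw [div_le_iff₀ (by positivity)] at h2
  nlinarith

/-- The numerator of the transform of `e`. -/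
def numE (p : GKParams) (x κ y : ℝ) : ℝ :=
  Real.exp (κ * (p.l - x)) * (y + κ * p.γ) + Real.exp (-(κ * (p.l - x))) * (y - κ * p.γ)

/-- The numerator of the transform of `q`. -/
def numQ (p : GKParams) (x κ y : ℝ) : ℝ :=
  Real.exp (κ * (p.l - x)) * (y + κ * p.γ) - Real.exp (-(κ * (p.l - x))) * (y - κ * p.γ)

/-- The terms with `γ` enter with a positive sign and are dropped; `e^{κl} ≥ 1 + κl` and `e^{-κl} ≤
1` give the rest. This is the denominator of the transforms, which thus does not vanish for positive
`κ` and `y`. -/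
lemma numQ_zero_ge (hp : p.IsPhysical) {κ y : ℝ} (hκ : 0 ≤ κ) (hy : 0 ≤ y) :
    y * (κ * p.l) ≤ p.numQ 0 κ y := by
  have hγ := hp.γ_nonneg
  have hl := hp.l_pos
  have h0 : 0 ≤ κ * p.l := by positivity
  have h1 := Real.add_one_le_exp (κ * p.l)
  have h2 : Real.exp (-(κ * p.l)) ≤ 1 := Real.exp_le_one_iff.2 (by linarith)
  have h3 : 0 ≤ κ * p.γ := by positivity
  have h4 := Real.exp_pos (-(κ * p.l))
  unfold numQ
  rw [sub_zero]
  nlinarith [mul_le_mul_of_nonneg_left h1 hy, mul_le_mul_of_nonneg_left h2 hy,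
    mul_nonneg h3 (Real.exp_pos (κ * p.l)).le, mul_nonneg h3 h4.le]

lemma exp_mul_le_of_abs_le {ν κ x l : ℝ} (hν : |ν| ≤ κ) (hx : x ∈ Icc 0 l) :
    Real.exp (ν * x) ≤ Real.exp (κ * l) := by
  have hκ : 0 ≤ κ := (abs_nonneg _).trans hν
  apply Real.exp_le_exp.2
  have h1 := mul_le_mul_of_nonneg_right ((le_abs_self ν).trans hν) hx.1
  have h2 := mul_le_mul_of_nonneg_left hx.2 hκ
  linarith

lemma abs_num_le (hp : p.IsPhysical) {κ y x : ℝ} (hκ : 0 ≤ κ) (hκy : κ ≤ y)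
    (hx : x ∈ Icc 0 p.l) :
    |p.numE x κ y| ≤ 2 * Real.exp (κ * p.l) * (y * (1 + p.γ)) ∧
    |p.numQ x κ y| ≤ 2 * Real.exp (κ * p.l) * (y * (1 + p.γ)) := by
  have hγ := hp.γ_nonneg
  have hx' : p.l - x ∈ Icc 0 p.l := ⟨by linarith [hx.2], by linarith [hx.1]⟩
  have h1 := exp_mul_le_of_abs_le (abs_of_nonneg hκ).le hx'
  have h2 := exp_mul_le_of_abs_le (ν := -κ) (by rw [abs_neg, abs_of_nonneg hκ]) hx'
  rw [neg_mul] at h2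
  have h3 : κ * p.γ ≤ y * p.γ := mul_le_mul_of_nonneg_right hκy hγ
  have h4 : 0 ≤ κ * p.γ := by positivity
  have h5 : |y + κ * p.γ| ≤ y * (1 + p.γ) := by rw [abs_le]; constructor <;> nlinarith
  have h6 : |y - κ * p.γ| ≤ y * (1 + p.γ) := by rw [abs_le]; constructor <;> nlinarith
  have h7 : |Real.exp (κ * (p.l - x)) * (y + κ * p.γ)| ≤
      Real.exp (κ * p.l) * (y * (1 + p.γ)) := by
    rw [abs_mul, abs_of_pos (Real.exp_pos _)]
    exact mul_le_mul h1 h5 (abs_nonneg _) (Real.exp_pos _).le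
  have h8 : |Real.exp (-(κ * (p.l - x))) * (y - κ * p.γ)| ≤
      Real.exp (κ * p.l) * (y * (1 + p.γ)) := by
    rw [abs_mul, abs_of_pos (Real.exp_pos _)]
    exact mul_le_mul h2 h6 (abs_nonneg _) (Real.exp_pos _).le
  have h9 := abs_add_le (Real.exp (κ * (p.l - x)) * (y + κ * p.γ))
    (Real.exp (-(κ * (p.l - x))) * (y - κ * p.γ))
  have h10 := abs_sub (Real.exp (κ * (p.l - x)) * (y + κ * p.γ))
    (Real.exp (-(κ * (p.l - x))) * (y - κ * p.γ))
  unfold numE numQ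
  constructor <;> linarith

/-- The gap `δ = T - T'` is spent in two halves: one factor `e^{δy/2}` absorbs `e^{2κl}`, the other
absorbs `y`. -/
lemma mul_exp_le_of_le {δ l κ y T T' : ℝ} (hδ : 0 < δ) (hl : 0 < l) (hκδ : κ ≤ δ / (4 * l) * y)
    (hT : T - δ = T') :
    y * (Real.exp (κ * l) * Real.exp (κ * l)) * Real.exp (-y * T) ≤
      2 / δ * Real.exp (-y * T') := by
  have h1 : 2 * (κ * l) ≤ δ * y / 2 := by
    have := mul_le_mul_of_nonneg_right hκδ hl.le
    have e1 : δ / (4 * l) * y * l = δ * y / 4 := by field_simp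
    linarith
  have h2 : y ≤ 2 / δ * Real.exp (δ * y / 2) := by
    have := (lt_add_one _).le.trans (Real.add_one_le_exp (δ * y / 2))
    rw [div_mul_eq_mul_div, le_div_iff₀ hδ]
    linarith
  have e1 : Real.exp (-y * T') =
      Real.exp (δ * y / 2) * Real.exp (δ * y / 2) * Real.exp (-y * T) := by
    rw [← Real.exp_add, ← Real.exp_add, ← hT]
    congr 1
    ring
  have h4 : Real.exp (κ * l) * Real.exp (κ * l) ≤ Real.exp (δ * y / 2) := by
    rw [← Real.exp_add]; apply Real.exp_le_exp.2; linarith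
  rw [e1, ← mul_assoc (2 / δ)]
  refine mul_le_mul_of_nonneg_right ?_ (Real.exp_pos _).le
  rw [← mul_assoc (2 / δ)]
  exact mul_le_mul h2 h4 (by positivity) (by positivity)

lemma combine_of_mul_eq {d c κ n N G L U m s : ℝ} (hN : N ≠ 0) (hc : c * d = κ)
    (h1 : 2 * d * U = n * L + m) (h2 : N * L = 2 * κ * G + s) :
    2 * d * (U - c * (n / N) * G) = n / N * s + m := by
  have h3 : L = (2 * κ * G + s) / N := by rw [eq_div_iff hN, ← h2]; ring
  rw [mul_sub, h1, h3, ← hc]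
  ring

namespace IsSolution

lemma continuousOn_lap_of {u : ℝ → ℝ → ℝ} (hu : ContinuousOn (Function.uncurry u) p.closedStrip)
    {T M : ℝ} (hT : 0 ≤ T) (hM : ∀ x ∈ Icc 0 p.l, ∀ t ∈ Icc 0 T, |u x t| ≤ M) (y : ℝ) :
    ContinuousOn (fun x => lap (u x) T y) (Icc 0 p.l) := by
  intro x hx
  have hut : ∀ x ∈ Icc 0 p.l, ContinuousOn (u x) (Ioi 0) := fun x hx =>
    hu.comp (f := fun t => (x, t)) (by fun_prop) fun _ ht => mem_closedStrip_of_pos hx ht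
  refine intervalIntegral.continuousWithinAt_of_dominated_interval
    (bound := fun s => Real.exp (-y * s) * M) ?_ ?_ ?_ ?_
  · filter_upwards [self_mem_nhdsWithin] with z hz
    rw [uIoc_of_le hT]
    refine ContinuousOn.aestronglyMeasurable ?_ measurableSet_Ioc
    exact ContinuousOn.mul (by fun_prop) ((hut z hz).mono Ioc_subset_Ioi_self)
  · filter_upwards [self_mem_nhdsWithin] with z hz
    filter_upwards with s hs
    rw [uIoc_of_le hT] at hs
    rw [norm_mul, Real.norm_of_nonneg (Real.exp_pos _).le]
    exact mul_le_mul_of_nonneg_left (hM z hz s ⟨hs.1.le, hs.2⟩) (Real.exp_pos _).le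
  · exact (Continuous.intervalIntegrable (by fun_prop) _ _)
  · filter_upwards with s hs
    rw [uIoc_of_le hT] at hs
    have h1 : ContinuousOn (fun x => u x s) (Icc 0 p.l) :=
      hu.comp (f := fun x => (x, s)) (by fun_prop) fun _ hx => mem_closedStrip_of_pos hx hs.1
    exact (h1 x hx).const_mul _

/-- The global relation on `[x, l]`. -/
lemma global_relation (hp : p.IsPhysical) (hs : p.IsSolution g e q) {y ν : ℝ}
    (hν : ν ^ 2 * (p.rc * y + p.rb) = y * (y + p.ra)) {x T : ℝ} (hx : x ∈ Icc 0 p.l)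
    (hT : 0 < T) :
    (p.rc * y + p.rb) * (Real.exp (ν * x) * (y * lap (e x) T y + ν * lap (q x) T y) -
      Real.exp (ν * p.l) * (y * lap (e p.l) T y + ν * lap (q p.l) T y)) =
    p.rc * y * (Real.exp (ν * p.l - y * T) * e p.l T - Real.exp (ν * x - y * T) * e x T) +
      ∫ z in x..p.l, p.density e q y ν z T := by
  obtain ⟨M, hM⟩ := hs.bounded T
  have hl := hp.l_pos
  have hdc : ContinuousOn (fun z => p.density e q y ν z T) (Icc 0 p.l) :=
    (hs.continuousOn_density y ν).comp (f := fun z => (z, T)) (by fun_prop)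
      fun z hz => mem_closedStrip_of_pos hz hT
  have hdi : ∀ A ∈ Icc 0 p.l, ∀ B ∈ Icc 0 p.l,
      IntervalIntegrable (fun z => p.density e q y ν z T) volume A B := fun A hA B hB =>
    (hdc.mono (uIcc_subset_Icc hA hB)).intervalIntegrable
  have h0 : (0 : ℝ) ∈ Icc 0 p.l := ⟨le_rfl, hl.le⟩
  -- The interior relation says that `Φ` is constant on the open interval. As `Φ` contains no
  -- derivative of `e` or `q`, it is continuous up to the ends, which gives the relation there.
  set Φ : ℝ → ℝ := fun x => (p.rc * y + p.rb) *
    (Real.exp (ν * x) * (y * lap (e x) T y + ν * lap (q x) T y)) +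
    p.rc * y * (Real.exp (ν * x - y * T) * e x T) + ∫ z in (0 : ℝ)..x, p.density e q y ν z T
  have hΦc : ContinuousOn Φ (Icc 0 p.l) := by
    have h1 := continuousOn_lap_of hs.e_cont hT.le (fun x hx t ht => (hM x hx t ht).1) y
    have h2 := continuousOn_lap_of hs.q_cont hT.le (fun x hx t ht => (hM x hx t ht).2) y
    have h3 : ContinuousOn (fun x => e x T) (Icc 0 p.l) :=
      hs.e_cont.comp (f := fun x => (x, T)) (by fun_prop) fun _ hx => mem_closedStrip_of_pos hx hT
    have h4 : ContinuousOn (fun x => ∫ z in (0 : ℝ)..x, p.density e q y ν z T) (Icc 0 p.l) := by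
      have := intervalIntegral.continuousOn_primitive_interval (μ := volume)
        (f := fun z => p.density e q y ν z T) (a := 0) (b := p.l)
        (by rw [uIcc_of_le hl.le]; exact hdc.integrableOn_Icc)
      rwa [uIcc_of_le hl.le] at this
    simp only [Φ]
    fun_prop
  have hint : ∀ A ∈ Ioo 0 p.l, ∀ B ∈ Ioo 0 p.l, A ≤ B → Φ A = Φ B := by
    intro A hA B hB hAB
    have h1 := hs.global_relation_interior hp hν hA.1 hAB hB.2 hT
    have h2 := intervalIntegral.integral_add_adjacent_intervals
      (hdi 0 h0 A (Ioo_subset_Icc_self hA)) (hdi A (Ioo_subset_Icc_self hA) B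
        (Ioo_subset_Icc_self hB))
    simp only [Φ]
    linear_combination -h1 + h2
  have hm : p.l / 2 ∈ Ioo 0 p.l := ⟨by linarith, by linarith⟩
  have heq : EqOn Φ (fun _ => Φ (p.l / 2)) (Ioo 0 p.l) := fun z hz =>
    (le_total z (p.l / 2)).elim (fun h => hint z hz _ hm h) fun h => (hint _ hm z hz h).symm
  have heq' := heq.of_subset_closure hΦc continuousOn_const Ioo_subset_Icc_self
    (by rw [closure_Ioo hl.ne])
  have key : Φ x = Φ p.l := (heq' hx).trans (heq' ⟨hl.le, le_rfl⟩).symm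
  have h2 := intervalIntegral.integral_add_adjacent_intervals (hdi 0 h0 x hx)
    (hdi x hx p.l ⟨hl.le, le_rfl⟩)
  simp only [Φ] at key
  linear_combination key - h2

/-- The right side of the global relation is small. -/
lemma abs_global_relation_le (hp : p.IsPhysical) (hs : p.IsSolution g e q) {T M : ℝ} (hT : 0 < T)
    (hM : ∀ x ∈ Icc 0 p.l, ∀ t ∈ Icc 0 T, |e x t| ≤ M ∧ |q x t| ≤ M) {y κ ν : ℝ}
    (hy : 0 ≤ y) (hκy : κ ≤ y) (hνκ : |ν| = κ)
    (hν : ν ^ 2 * (p.rc * y + p.rb) = y * (y + p.ra)) {x : ℝ} (hx : x ∈ Icc 0 p.l) :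
    |Real.exp (ν * x) * (y * lap (e x) T y + ν * lap (q x) T y) -
      Real.exp (ν * p.l) * (y * lap (e p.l) T y + ν * lap (q p.l) T y)| ≤
    M * (2 * p.rc + (p.rb + 1) * p.l) / p.rb * (y * Real.exp (κ * p.l) * Real.exp (-y * T)) := by
  have hb := hp.rb_pos
  have hc := hp.rc_pos
  have hl := hp.l_pos
  have hκ0 : 0 ≤ κ := hνκ ▸ abs_nonneg ν
  have hTm : T ∈ Icc 0 T := ⟨hT.le, le_rfl⟩
  have hM0 : 0 ≤ M := (abs_nonneg _).trans (hM x hx T hTm).1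
  set Q := Real.exp (κ * p.l) * Real.exp (-y * T) with hQ
  have hQ0 : 0 < Q := by positivity
  have hexp : ∀ z ∈ Icc 0 p.l, Real.exp (ν * z - y * T) ≤ Q := fun z hz => by
    rw [sub_eq_add_neg, Real.exp_add, hQ, neg_mul]
    exact mul_le_mul_of_nonneg_right (exp_mul_le_of_abs_le hνκ.le hz) (Real.exp_pos _).le
  have h1 : ∀ z ∈ Icc 0 p.l, |Real.exp (ν * z - y * T) * e z T| ≤ Q * M := fun z hz => by
    rw [abs_mul, abs_of_pos (Real.exp_pos _)]
    exact mul_le_mul (hexp z hz) (hM z hz T hTm).1 (abs_nonneg _) hQ0.le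
  have h2 : ∀ z ∈ Icc 0 p.l, |p.density e q y ν z T| ≤ Q * ((p.rb + 1) * y * M) := fun z hz => by
    rw [density, abs_mul, abs_of_pos (Real.exp_pos _)]
    refine mul_le_mul (hexp z hz) ?_ (abs_nonneg _) hQ0.le
    refine (abs_add_le _ _).trans ?_
    rw [abs_mul, abs_mul, abs_mul, abs_of_pos hb, hνκ, abs_of_nonneg hy]
    have e1 : p.rb * κ * |e z T| ≤ p.rb * y * M := by
      have := (hM z hz T hTm).1
      gcongr
    have e2 : y * |q z T| ≤ y * M := mul_le_mul_of_nonneg_left (hM z hz T hTm).2 hy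
    linarith
  have h3 : |∫ z in x..p.l, p.density e q y ν z T| ≤ Q * ((p.rb + 1) * y * M) * p.l := by
    have := intervalIntegral.norm_integral_le_of_norm_le_const (a := x) (b := p.l)
      (f := fun z => p.density e q y ν z T) (C := Q * ((p.rb + 1) * y * M)) fun z hz => by
        rw [uIoc_of_le hx.2] at hz
        exact h2 z ⟨hx.1.trans hz.1.le, hz.2⟩
    refine this.trans (mul_le_mul_of_nonneg_left ?_ (by positivity))
    rw [abs_of_nonneg (by linarith [hx.2])]
    linarith [hx.1]
  have key := hs.global_relation hp hν hx hT
  set Z := Real.exp (ν * x) * (y * lap (e x) T y + ν * lap (q x) T y) -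
      Real.exp (ν * p.l) * (y * lap (e p.l) T y + ν * lap (q p.l) T y)
  have h4 : p.rb * |Z| ≤ (p.rc * y + p.rb) * |Z| := by
    have : 0 ≤ p.rc * y * |Z| := by positivity
    linarith
  have h5 : (p.rc * y + p.rb) * |Z| ≤ p.rc * y * (2 * (Q * M)) + Q * ((p.rb + 1) * y * M) * p.l := by
    rw [← abs_of_pos (show 0 < p.rc * y + p.rb by positivity), ← abs_mul, key]
    refine (abs_add_le _ _).trans (add_le_add ?_ h3)
    rw [abs_mul, abs_of_nonneg (show 0 ≤ p.rc * y by positivity)]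
    refine mul_le_mul_of_nonneg_left ((abs_sub _ _).trans ?_) (by positivity)
    linarith [h1 p.l ⟨hl.le, le_rfl⟩, h1 x hx]
  rw [div_mul_eq_mul_div, le_div_iff₀ hb]
  have e3 : y * Real.exp (κ * p.l) * Real.exp (-y * T) = y * Q := by rw [hQ]; ring
  rw [e3]
  linarith

lemma lap_congr {u v : ℝ → ℝ} {T : ℝ} (hT : 0 ≤ T) (h : ∀ t > 0, u t = v t) (y : ℝ) :
    lap u T y = lap v T y := by
  unfold lap
  rw [intervalIntegral.integral_of_le hT, intervalIntegral.integral_of_le hT]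
  refine setIntegral_congr_fun measurableSet_Ioc fun t ht => ?_
  simp only [h t ht.1]

/-- The truncated Laplace transforms of a solution agree with those of the explicit formula up to
an error that decays like `exp (-y T')` for every `T' < T`. -/
lemma lap_asymptotics (hp : p.IsPhysical) (hs : p.IsSolution g e q) {T' T : ℝ} (hT : 0 < T)
    (hTT : T' < T) {x : ℝ} (hx : x ∈ Icc 0 p.l) :
    ∃ C, ∀ᶠ y in atTop,
      |lap (e x) T y - p.kap y / y * (p.numE x (p.kap y) y / p.numQ 0 (p.kap y) y) * lap g T y| ≤
        C * Real.exp (-y * T') ∧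
      |lap (q x) T y - p.numQ x (p.kap y) y / p.numQ 0 (p.kap y) y * lap g T y| ≤
        C * Real.exp (-y * T') := by
  obtain ⟨M, hM⟩ := hs.bounded T
  have hb := hp.rb_pos
  have hc := hp.rc_pos
  have hl := hp.l_pos
  have hγ := hp.γ_nonneg
  set C₀ := M * (2 * p.rc + (p.rb + 1) * p.l) / p.rb
  have hM0 : 0 ≤ M := (abs_nonneg _).trans (hM x hx T ⟨hT.le, le_rfl⟩).1
  have hC₀ : 0 ≤ C₀ := by positivity
  set δ := T - T'
  have hδ : 0 < δ := sub_pos.2 hTT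
  refine ⟨C₀ * (2 * (1 + p.γ) / p.l + 1) * (2 / δ), ?_⟩
  filter_upwards [eventually_ge_atTop 1, eventually_lt_kap hp 1, eventually_kap_le hp one_pos,
    eventually_kap_le hp (η := δ / (4 * p.l)) (by positivity)] with y hy hκ1 hκy hκδ
  rw [one_mul] at hκy
  set κ := p.kap y
  have hκ0 : 0 < κ := one_pos.trans hκ1
  have hy0 : 0 < y := one_pos.trans_le hy
  have hκν := kap_sq_mul hp hy0.le
  set ε := C₀ * (y * Real.exp (κ * p.l) * Real.exp (-y * T)) with hε
  have hε0 : 0 ≤ ε := by positivity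
  have hP : ∀ z ∈ Icc 0 p.l, |Real.exp (κ * z) * (y * lap (e z) T y + κ * lap (q z) T y) -
      Real.exp (κ * p.l) * (y * lap (e p.l) T y + κ * lap (q p.l) T y)| ≤ ε := fun z hz =>
    hs.abs_global_relation_le hp hT hM hy0.le hκy (abs_of_pos hκ0) hκν hz
  have hN : ∀ z ∈ Icc 0 p.l, |Real.exp (-κ * z) * (y * lap (e z) T y + -κ * lap (q z) T y) -
      Real.exp (-κ * p.l) * (y * lap (e p.l) T y + -κ * lap (q p.l) T y)| ≤ ε := fun z hz =>
    hs.abs_global_relation_le hp hT hM hy0.le hκy (by rw [abs_neg, abs_of_pos hκ0])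
      (by rw [neg_sq]; exact hκν) hz
  have h0 : (0 : ℝ) ∈ Icc 0 p.l := ⟨le_rfl, hl.le⟩
  have hg : lap (q 0) T y = lap g T y := lap_congr hT.le hs.left_flux y
  have hql : lap (q p.l) T y = p.γ * lap (e p.l) T y := by
    rw [lap_congr hT.le hs.right_newton y, lap, lap, ← intervalIntegral.integral_const_mul]
    exact intervalIntegral.integral_congr fun t _ => mul_left_comm _ _ _
  have p0 := hP 0 h0
  have n0 := hN 0 h0
  have px := hP x hx
  have nx := hN x hx
  rw [hql] at p0 n0 px nx
  rw [hg] at p0 n0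
  simp only [mul_zero, Real.exp_zero, one_mul] at p0 n0
  -- `s1`, `s2` are the defects of the relations with `ν = ±κ` between `0` and `l`, and `r1`, `r2`
  -- those between `x` and `l`. The first pair determines the transform of `e` at `l`; the second
  -- pair then gives those of `e` and `q` at `x`.
  set s1 := y * lap (e 0) T y + κ * lap g T y -
    Real.exp (κ * p.l) * (y * lap (e p.l) T y + κ * (p.γ * lap (e p.l) T y)) with hs1
  set s2 := y * lap (e 0) T y + -κ * lap g T y -
    Real.exp (-κ * p.l) * (y * lap (e p.l) T y + -κ * (p.γ * lap (e p.l) T y)) with hs2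
  set r1 := Real.exp (κ * x) * (y * lap (e x) T y + κ * lap (q x) T y) -
    Real.exp (κ * p.l) * (y * lap (e p.l) T y + κ * (p.γ * lap (e p.l) T y)) with hr1
  set r2 := Real.exp (-κ * x) * (y * lap (e x) T y + -κ * lap (q x) T y) -
    Real.exp (-κ * p.l) * (y * lap (e p.l) T y + -κ * (p.γ * lap (e p.l) T y)) with hr2
  set N := p.numQ 0 κ y with hNd
  have hNge := numQ_zero_ge hp hκ0.le hy0.le
  have hNpos : 0 < N := lt_of_lt_of_le (by positivity) hNge
  have hNl : N * lap (e p.l) T y = 2 * κ * lap g T y + (-s1 + s2) := by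
    rw [hNd, numQ, hs1, hs2, sub_zero, neg_mul]; ring_nf
  have ex1 : Real.exp (-κ * x) * Real.exp (κ * x) = 1 := by rw [← Real.exp_add]; simp
  have ex2 : Real.exp (κ * (p.l - x)) = Real.exp (-κ * x) * Real.exp (κ * p.l) := by
    rw [← Real.exp_add]; ring_nf
  have ex3 : Real.exp (-(κ * (p.l - x))) = Real.exp (κ * x) * Real.exp (-κ * p.l) := by
    rw [← Real.exp_add]; ring_nf
  have hE : 2 * y * lap (e x) T y = p.numE x κ y * lap (e p.l) T y +
      (Real.exp (-κ * x) * r1 + Real.exp (κ * x) * r2) := by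
    rw [numE, ex2, ex3, hr1, hr2]
    linear_combination (-2 * y * lap (e x) T y) * ex1
  have hQ : 2 * κ * lap (q x) T y = p.numQ x κ y * lap (e p.l) T y +
      (Real.exp (-κ * x) * r1 - Real.exp (κ * x) * r2) := by
    rw [numQ, ex2, ex3, hr1, hr2]
    linear_combination (-2 * κ * lap (q x) T y) * ex1
  have hE' : 2 * y * (lap (e x) T y - κ / y * (p.numE x κ y / N) * lap g T y) =
      p.numE x κ y / N * (-s1 + s2) + (Real.exp (-κ * x) * r1 + Real.exp (κ * x) * r2) := by
    exact combine_of_mul_eq hNpos.ne' (div_mul_cancel₀ _ hy0.ne') hE hNl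
  have hQ' : 2 * κ * (lap (q x) T y - p.numQ x κ y / N * lap g T y) =
      p.numQ x κ y / N * (-s1 + s2) + (Real.exp (-κ * x) * r1 - Real.exp (κ * x) * r2) := by
    have := combine_of_mul_eq hNpos.ne' (one_mul κ) hQ hNl
    rwa [one_mul] at this
  have hs12 : |-s1 + s2| ≤ 2 * ε := by
    refine (abs_add_le _ _).trans ?_
    rw [abs_neg]; linarith
  have hr : |Real.exp (-κ * x) * r1| ≤ Real.exp (κ * p.l) * ε ∧
      |Real.exp (κ * x) * r2| ≤ Real.exp (κ * p.l) * ε := by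
    rw [abs_mul, abs_mul, abs_of_pos (Real.exp_pos _), abs_of_pos (Real.exp_pos _)]
    exact ⟨mul_le_mul (exp_mul_le_of_abs_le (by rw [abs_neg, abs_of_pos hκ0]) hx) px
      (abs_nonneg _) (Real.exp_pos _).le, mul_le_mul (exp_mul_le_of_abs_le (abs_of_pos hκ0).le hx)
      nx (abs_nonneg _) (Real.exp_pos _).le⟩
  have hratio : ∀ n : ℝ, |n| ≤ 2 * Real.exp (κ * p.l) * (y * (1 + p.γ)) →
      |n / N * (-s1 + s2)| ≤ 2 * Real.exp (κ * p.l) * (1 + p.γ) / p.l * (2 * ε) := by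
    intro n hn
    rw [abs_mul]
    refine mul_le_mul ?_ hs12 (abs_nonneg _) (by positivity)
    rw [abs_div, abs_of_pos hNpos, div_le_div_iff₀ hNpos hl]
    have h1 : y * p.l ≤ N :=
      (mul_le_mul_of_nonneg_left (le_mul_of_one_le_left hl.le hκ1.le) hy0.le).trans hNge
    calc |n| * p.l ≤ 2 * Real.exp (κ * p.l) * (y * (1 + p.γ)) * p.l :=
          mul_le_mul_of_nonneg_right hn hl.le
      _ = 2 * Real.exp (κ * p.l) * (1 + p.γ) * (y * p.l) := by ring
      _ ≤ _ := by gcongr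
  set B := ε * Real.exp (κ * p.l) * (2 * (1 + p.γ) / p.l + 1)
  have hB0 : 0 ≤ B := by positivity
  have hfin : ∀ d Z n m : ℝ, 1 ≤ d → 2 * d * Z = n / N * (-s1 + s2) + m →
      |n| ≤ 2 * Real.exp (κ * p.l) * (y * (1 + p.γ)) → |m| ≤ 2 * (Real.exp (κ * p.l) * ε) →
      |Z| ≤ B := by
    intro d Z n m hd hZ hn hm
    have h1 : |2 * d * Z| ≤ 2 * B := by
      rw [hZ]
      refine (abs_add_le _ _).trans ((add_le_add (hratio n hn) hm).trans (le_of_eq ?_))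
      simp only [B]
      field_simp
    rw [abs_mul, abs_of_pos (by linarith)] at h1
    linarith [le_mul_of_one_le_left (abs_nonneg Z) hd]
  have hBle : B ≤ C₀ * (2 * (1 + p.γ) / p.l + 1) * (2 / δ) * Real.exp (-y * T') := by
    have h3 := mul_exp_le_of_le hδ hl hκδ (sub_sub_cancel T T')
    calc B = C₀ * (2 * (1 + p.γ) / p.l + 1) *
          (y * (Real.exp (κ * p.l) * Real.exp (κ * p.l)) * Real.exp (-y * T)) := by
          simp only [B, hε]; ring
      _ ≤ C₀ * (2 * (1 + p.γ) / p.l + 1) * (2 / δ * Real.exp (-y * T')) := by gcongr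
      _ = _ := by ring
  obtain ⟨hn1, hn2⟩ := abs_num_le hp hκ0.le hκy hx
  exact ⟨(hfin _ _ _ _ hy hE' hn1 ((abs_add_le _ _).trans (by linarith [hr.1, hr.2]))).trans hBle,
    (hfin _ _ _ _ hκ1.le hQ' hn2 ((abs_sub _ _).trans (by linarith [hr.1, hr.2]))).trans hBle⟩

end IsSolution

end Solutions

/-! ### Poles of the integrands -/

/-- `k e^{ikl} Δ_m'(k)` without the factor `ω_{m'} - θ k²`, for `ω = ω_m`. -/
def dhat (p : GKParams) (k ω : ℂ) : ℂ :=
  p.expL k ^ 2 * (p.γ * k + Complex.I * ω) + (p.γ * k - Complex.I * ω)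

lemma expL_mul_expL_neg (p : GKParams) (k : ℂ) : p.expL k * p.expL (-k) = 1 := by
  rw [expL, expL, ← Complex.exp_add, ← Complex.exp_zero]
  ring_nf

lemma expL_ne_zero (p : GKParams) (k : ℂ) : p.expL k ≠ 0 := Complex.exp_ne_zero _

/-- From `β k² = ω₁ ω₂` one gets `ik(β - θ ω₁) = i ω₁ (ω₂ - θ k²) / k`. The factor `ω₂ - θ k²` is
thereby common to `σ` and `Δ'`. -/
lemma sigma1_eq (hp : p.IsPhysical) {k : ℂ} (hk : k ≠ 0) :
    p.sigma1 k = (p.omega2 k - p.theta * k ^ 2) * (p.γ + Complex.I * p.omega1 k / k) := by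
  have h := omega_mul hp k
  rw [sigma1, beta_eq, theta_eq]
  field_simp
  linear_combination -Complex.I * h

lemma sigma2_eq (hp : p.IsPhysical) {k : ℂ} (hk : k ≠ 0) :
    p.sigma2 k = (p.omega1 k - p.theta * k ^ 2) * (p.γ + Complex.I * p.omega2 k / k) := by
  have h := omega_mul hp k
  rw [sigma2, beta_eq, theta_eq]
  field_simp
  linear_combination -Complex.I * h

lemma Delta1_eq (hp : p.IsPhysical) {k : ℂ} (hk : k ≠ 0) :
    p.Delta1 k =
      (p.omega2 k - p.theta * k ^ 2) * (p.dhat k (p.omega1 k) / (k * p.expL k)) := by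
  have h := p.expL_mul_expL_neg k
  have h0 := p.expL_ne_zero k
  rw [Delta1, sigma1_eq hp hk, sigma1_eq hp (neg_ne_zero.2 hk), omega1_neg, omega2_neg, dhat,
    eq_inv_of_mul_eq_one_right h]
  field_simp
  ring

lemma Delta2_eq (hp : p.IsPhysical) {k : ℂ} (hk : k ≠ 0) :
    p.Delta2 k =
      (p.omega1 k - p.theta * k ^ 2) * (p.dhat k (p.omega2 k) / (k * p.expL k)) := by
  have h := p.expL_mul_expL_neg k
  have h0 := p.expL_ne_zero k
  rw [Delta2, sigma2_eq hp hk, sigma2_eq hp (neg_ne_zero.2 hk), omega1_neg, omega2_neg, dhat,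
    eq_inv_of_mul_eq_one_right h]
  field_simp
  ring

lemma regularAt_iff (hp : p.IsPhysical) {k : ℂ} (hk : k ≠ 0) :
    p.RegularAt k ↔
      (p.omega2 k - p.theta * k ^ 2 ≠ 0 → p.dhat k (p.omega1 k) ≠ 0) ∧
      (p.omega1 k - p.theta * k ^ 2 ≠ 0 → p.dhat k (p.omega2 k) ≠ 0) := by
  have h0 := p.expL_ne_zero k
  rw [RegularAt, Delta1_eq hp hk, Delta2_eq hp hk]
  refine and_congr (forall_congr' fun h => ?_) (forall_congr' fun h => ?_) <;>
    simp [h, hk, h0]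

lemma regularAt_neg (p : GKParams) (k : ℂ) : p.RegularAt (-k) ↔ p.RegularAt k := by
  simp [RegularAt, Delta1_neg, Delta2_neg, omega1_neg, omega2_neg]

/-- The scalar kernel that multiplies `g̃⁽ᵐ⁾`, for `(ω, ω') = (ω_m, ω_{m'})`. -/
def kernel (p : GKParams) (y : ℝ) (s : ℂ) (k ω ω' : ℂ) : ℂ :=
  2 * Complex.exp (Complex.I * k * y) * (p.γ * k - s * (Complex.I * ω)) *
    (ω' - p.theta * k ^ 2) / ((p.omega1 k - p.omega2 k) * p.dhat k ω)

/-- A component of the coefficient of `g̃⁽ᵐ⁾` in the integrand at `s k`, where `s = ±1`. -/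
def term (p : GKParams) (y : ℝ) (s : ℂ) (i : Fin 2) (k ω ω' : ℂ) : ℂ :=
  p.kernel y s k ω ω' * ![1, s * (ω / (Complex.I * k))] i

/-- When `f`, `d` or `w` is zero both sides are zero, by the convention for division by zero, so the
cancellation of `f` needs no regularity assumption. -/
lemma quotient_eq {k u u' γ ω f d w G E s : ℂ} (hk : k ≠ 0) (hu : u * u' = 1) :
    E * (2 * u' / w * (f * (γ - s * (Complex.I * ω) / k) / (f * (d / (k * u))) * f * G)) =
      2 * E * (γ * k - s * (Complex.I * ω)) * f / (w * d) * G := by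
  have hu0 : u ≠ 0 := left_ne_zero_of_mul_eq_one hu
  rw [eq_inv_of_mul_eq_one_right hu]
  rcases eq_or_ne f 0 with rfl | hf
  · simp
  rcases eq_or_ne d 0 with rfl | hd
  · simp
  rcases eq_or_ne w 0 with rfl | hw
  · simp
  field_simp

lemma exp_mul_explicitIntegrand (hp : p.IsPhysical) {k : ℂ} (hk : k ≠ 0) (g : ℝ → ℝ) (t x : ℝ)
    (i : Fin 2) :
    Complex.exp (Complex.I * k * x) * p.explicitIntegrand g k t i =
      p.term x 1 i k (p.omega1 k) (p.omega2 k) * p.gT1 g k t -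
        p.term x 1 i k (p.omega2 k) (p.omega1 k) * p.gT2 g k t := by
  have h := p.expL_mul_expL_neg k
  have e1 : (p.γ : ℂ) + Complex.I * p.omega1 k / -k = p.γ - 1 * (Complex.I * p.omega1 k) / k := by
    rw [div_neg, one_mul, sub_eq_add_neg]
  have e2 : (p.γ : ℂ) + Complex.I * p.omega2 k / -k = p.γ - 1 * (Complex.I * p.omega2 k) / k := by
    rw [div_neg, one_mul, sub_eq_add_neg]
  have h1 := quotient_eq (γ := p.γ) (ω := p.omega1 k) (f := p.omega2 k - p.theta * k ^ 2)
    (d := p.dhat k (p.omega1 k)) (w := p.omega1 k - p.omega2 k)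
    (G := p.gT1 g k t * ![1, p.omega1 k / (Complex.I * k)] i)
    (E := Complex.exp (Complex.I * k * x)) (s := 1) hk h
  have h2 := quotient_eq (γ := p.γ) (ω := p.omega2 k) (f := p.omega1 k - p.theta * k ^ 2)
    (d := p.dhat k (p.omega2 k)) (w := p.omega1 k - p.omega2 k)
    (G := p.gT2 g k t * ![1, p.omega2 k / (Complex.I * k)] i)
    (E := Complex.exp (Complex.I * k * x)) (s := 1) hk h
  rw [term, term, kernel, kernel, one_mul (p.omega1 k / _), one_mul (p.omega2 k / _),
    explicitIntegrand, Delta1_eq hp hk, Delta2_eq hp hk,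
    sigma1_eq hp (neg_ne_zero.2 hk), sigma2_eq hp (neg_ne_zero.2 hk), omega1_neg, omega2_neg,
    e1, e2, neg_sq]
  simp only [Pi.smul_apply, Pi.sub_apply, smul_eq_mul]
  linear_combination h1 - h2

/-- Since `dhat (-k) = -e^{-2ikl} dhat k`, the substitution `k ↦ -k` replaces `e^{-ikx}` by
`e^{ik(2l-x)}`: the wave reflected at `l`. Its exponent `2l - x` is positive, so this term too
decays in the upper half-plane. -/
lemma exp_mul_explicitIntegrand_neg (hp : p.IsPhysical) {k : ℂ} (hk : k ≠ 0) (g : ℝ → ℝ) (t x : ℝ)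
    (i : Fin 2) :
    Complex.exp (Complex.I * (-k) * x) * p.explicitIntegrand g (-k) t i =
      p.term (2 * p.l - x) (-1) i k (p.omega1 k) (p.omega2 k) * p.gT1 g k t -
        p.term (2 * p.l - x) (-1) i k (p.omega2 k) (p.omega1 k) * p.gT2 g k t := by
  have hE : Complex.exp (Complex.I * k * ((2 * p.l - x : ℝ) : ℂ)) =
      Complex.exp (Complex.I * (-k) * x) * p.expL k ^ 2 := by
    rw [expL, ← Complex.exp_nat_mul, ← Complex.exp_add]
    push_cast
    ring_nf
  have hd : ∀ ω, p.dhat (-k) ω = -(p.expL (-k) ^ 2 * p.dhat k ω) := fun ω => by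
    have h := p.expL_mul_expL_neg k
    rw [dhat, dhat]
    linear_combination (p.expL k * p.expL (-k) + 1) * (p.γ * k + Complex.I * ω) * h
  have hker : ∀ ω ω', p.kernel x 1 (-k) ω ω' = p.kernel (2 * p.l - x) (-1) k ω ω' := by
    intro ω ω'
    have h := p.expL_mul_expL_neg k
    rw [kernel, kernel, hE, hd, omega1_neg, omega2_neg, eq_inv_of_mul_eq_one_right h, neg_sq]
    have hu := p.expL_ne_zero k
    rcases eq_or_ne (p.dhat k ω) 0 with h0 | h0
    · simp [h0]
    rcases eq_or_ne (p.omega1 k - p.omega2 k) 0 with h1 | h1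
    · simp [h1]
    field_simp
    ring
  have h := exp_mul_explicitIntegrand hp (neg_ne_zero.2 hk) g t x i
  rw [term, term, gT1, gT2, omega1_neg, omega2_neg, hker, hker] at h
  rw [h, gT1, gT2, term, term]
  simp only [mul_neg, div_neg, one_mul, neg_mul]

/-! ### Bounds on the closure of `D` -/

/-- A lower bound for `Im k / |k|` in the part of the closure of `D` in the upper half-plane. -/
def slope (p : GKParams) : ℝ := √((1 - p.cosMax) / 2)

lemma slope_pos (hp : p.IsPhysical) : 0 < p.slope :=
  Real.sqrt_pos.2 (by linarith [cosMax_lt_one hp])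

/-- Here `Re k² = |k|² - 2 (Im k)²` is at most `cosMax |k|²`. -/
lemma slope_mul_norm_le (hp : p.IsPhysical) {R : ℝ} (hR : 0 < R) {k : ℂ}
    (hk : k ∈ p.closedRegion R) : p.slope * ‖k‖ ≤ k.im := by
  have hr : 0 < ‖k‖ := hR.trans_le hk.2.1
  have h1 := hk.2.2
  rw [reBound_eq hp hr] at h1
  have h2 := (abs_le.1 (abs_cosBound_le hp hr)).2
  have h3 : (k ^ 2).re = ‖k‖ ^ 2 - 2 * k.im ^ 2 := by
    rw [Complex.sq_norm, Complex.normSq_apply, sq, Complex.mul_re]; ring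
  refine le_of_sq_le_sq ?_ hk.1.le
  rw [mul_pow, slope, Real.sq_sqrt (by linarith [cosMax_lt_one hp])]
  nlinarith [mul_le_mul_of_nonneg_left h2 (sq_nonneg ‖k‖)]

lemma omega1_mul_eq (hp : p.IsPhysical) (k : ℂ) :
    p.omega1 k * (p.rb - p.rc * p.omega2 k) = p.rb * (p.ra - p.omega2 k) := by
  linear_combination p.rb * omega_add hp k - p.rc * omega_mul hp k

/-- The Möbius relation `ω₁ = rb (ra - ω₂) / (rb - rc ω₂)` has its zero and its pole in the open
right half-plane, so on `Re ω₂ ≤ 0` numerator and denominator are comparable. -/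
lemma norm_omega1_bounds (hp : p.IsPhysical) {k : ℂ} (hk : (p.omega2 k).re ≤ 0) :
    p.rb * p.ra / (p.rb + p.rc * p.ra) ≤ ‖p.omega1 k‖ ∧ ‖p.omega1 k‖ ≤ p.ra + p.rb / p.rc := by
  have ha := hp.ra_pos
  have hb := hp.rb_pos
  have hc := hp.rc_pos
  have h := congrArg norm (omega1_mul_eq hp k)
  rw [norm_mul, norm_mul, Complex.norm_of_nonneg hb.le] at h
  have lower : ∀ a b : ℝ, 0 < a → 0 < b → a ≤ ‖(a : ℂ) - b * p.omega2 k‖ ∧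
      b * ‖p.omega2 k‖ ≤ ‖(a : ℂ) - b * p.omega2 k‖ := by
    intro a b ha hb
    constructor
    · refine le_trans ?_ (Complex.re_le_norm _)
      simp only [Complex.sub_re, Complex.ofReal_re, Complex.re_ofReal_mul]
      nlinarith
    · refine le_of_sq_le_sq ?_ (norm_nonneg _)
      rw [mul_pow, Complex.sq_norm, Complex.sq_norm, Complex.normSq_apply, Complex.normSq_apply]
      simp only [Complex.sub_re, Complex.ofReal_re, Complex.re_ofReal_mul, Complex.sub_im,
        Complex.ofReal_im, Complex.im_ofReal_mul]
      nlinarith [mul_nonneg (mul_pos ha hb).le (neg_nonneg.2 hk)]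
  have upper : ∀ a b : ℝ, 0 < a → 0 < b → ‖(a : ℂ) - b * p.omega2 k‖ ≤ a + b * ‖p.omega2 k‖ := by
    intro a b ha hb
    refine (norm_sub_le _ _).trans (le_of_eq ?_)
    rw [norm_mul, Complex.norm_of_nonneg ha.le, Complex.norm_of_nonneg hb.le]
  obtain ⟨h1, h2⟩ := lower p.rb p.rc hb hc
  obtain ⟨h3, h4⟩ := lower p.ra 1 ha one_pos
  have h5 := upper p.rb p.rc hb hc
  have h6 := upper p.ra 1 ha one_pos
  simp only [Complex.ofReal_one, one_mul] at h3 h4 h6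
  set P := ‖(p.rb : ℂ) - p.rc * p.omega2 k‖
  set Q := ‖(p.ra : ℂ) - p.omega2 k‖
  have hP : 0 < P := hb.trans_le h1
  constructor
  · rw [div_le_iff₀ (by positivity)]
    refine le_of_mul_le_mul_right ?_ hP
    have : p.ra * P ≤ (p.rb + p.rc * p.ra) * Q := by
      nlinarith [mul_le_mul_of_nonneg_left h5 ha.le, mul_le_mul_of_nonneg_left h3 hb.le,
        mul_le_mul_of_nonneg_left h4 (mul_pos ha hc).le]
    calc p.rb * p.ra * P = p.rb * (p.ra * P) := by ring
      _ ≤ p.rb * ((p.rb + p.rc * p.ra) * Q) := mul_le_mul_of_nonneg_left this hb.le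
      _ = ‖p.omega1 k‖ * (p.rb + p.rc * p.ra) * P := by linear_combination -(p.rb + p.rc * p.ra) * h
  · refine le_of_mul_le_mul_right ?_ hP
    rw [h]
    have e1 : p.rb * ‖p.omega2 k‖ ≤ p.rb / p.rc * P := by
      rw [div_mul_eq_mul_div, le_div_iff₀ hc]
      nlinarith
    nlinarith

/-- An upper bound for `ω₁` on the closure of `D`. -/
def omegaBound (p : GKParams) : ℝ := p.ra + p.rb / p.rc

lemma omegaBound_pos (hp : p.IsPhysical) : 0 < p.omegaBound :=
  add_pos hp.ra_pos (div_pos hp.rb_pos hp.rc_pos)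

/-- By the sum relation `ω₂ - θ k² = ra - ω₁`, and `ω₁` is bounded. -/
lemma norm_omega2_bounds (hp : p.IsPhysical) {k : ℂ} (hk : (p.omega2 k).re ≤ 0) :
    p.rc * ‖k‖ ^ 2 - (p.ra + p.omegaBound) ≤ ‖p.omega2 k‖ ∧
      ‖p.omega2 k - p.theta * k ^ 2‖ ≤ p.ra + p.omegaBound := by
  have ha := hp.ra_pos
  have hc := hp.rc_pos
  have h1 := (norm_omega1_bounds hp hk).2
  rw [← omegaBound] at h1
  have e1 : p.omega2 k - p.theta * k ^ 2 = p.ra - p.omega1 k := by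
    rw [theta_eq]; linear_combination omega_add hp k
  have h2 : ‖p.omega2 k - p.theta * k ^ 2‖ ≤ p.ra + p.omegaBound := by
    rw [e1]
    refine (norm_sub_le _ _).trans ?_
    rw [Complex.norm_of_nonneg ha.le]
    linarith
  refine ⟨?_, h2⟩
  have h3 := norm_sub_norm_le (p.theta * k ^ 2) (p.theta * k ^ 2 - p.omega2 k)
  rw [sub_sub_cancel, norm_sub_rev, theta_eq, norm_mul, norm_pow, Complex.norm_of_nonneg hc.le] at h3
  rw [theta_eq] at h2
  linarith

lemma eventually_pow_mul_exp_le (n : ℕ) (C : ℝ) {δ ε : ℝ} (hδ : 0 < δ) (hε : 0 < ε) :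
    ∀ᶠ r in atTop, C * r ^ n * Real.exp (-(δ * r)) ≤ ε := by
  have h := (isLittleO_pow_exp_pos_mul_atTop (k := n) hδ).def
    (show 0 < ε / (|C| + 1) by positivity)
  filter_upwards [h, eventually_ge_atTop 0] with r h1 h2
  rw [Real.norm_of_nonneg (by positivity), Real.norm_of_nonneg (Real.exp_pos _).le,
    div_mul_eq_mul_div, le_div_iff₀ (by positivity)] at h1
  rw [Real.exp_neg, ← div_eq_mul_inv, div_le_iff₀ (Real.exp_pos _)]
  have h3 : C * r ^ n ≤ (|C| + 1) * r ^ n :=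
    mul_le_mul_of_nonneg_right (by linarith [le_abs_self C]) (by positivity)
  linarith

lemma norm_expL (p : GKParams) (k : ℂ) : ‖p.expL k‖ = Real.exp (-(p.l * k.im)) := by
  rw [expL, Complex.norm_exp]
  simp [mul_comm]

lemma norm_omega_le (hp : p.IsPhysical) {k : ℂ} (hr : 1 ≤ ‖k‖) (hk : (p.omega2 k).re ≤ 0) :
    ∀ ω ∈ ({p.omega1 k, p.omega2 k} : Set ℂ),
      ‖ω‖ ≤ (p.ra + p.rc + p.omegaBound) * ‖k‖ ^ 2 ∧
      ‖ω - p.theta * k ^ 2‖ ≤ (p.ra + p.rc + p.omegaBound) * ‖k‖ ^ 2 := by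
  have ha := hp.ra_pos
  have hc := hp.rc_pos
  have hW := omegaBound_pos hp
  have h1 := (norm_omega1_bounds hp hk).2
  rw [← omegaBound] at h1
  have h2 := (norm_omega2_bounds hp hk).2
  have hr2 : 1 ≤ ‖k‖ ^ 2 := one_le_pow₀ hr
  have hθ : ‖p.theta * k ^ 2‖ = p.rc * ‖k‖ ^ 2 := by
    rw [theta_eq, norm_mul, norm_pow, Complex.norm_of_nonneg hc.le]
  have h3 := norm_sub_le (p.omega1 k) (p.theta * k ^ 2)
  have h4 := norm_add_le (p.omega2 k - p.theta * k ^ 2) (p.theta * k ^ 2)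
  rw [sub_add_cancel] at h4
  have h5 : p.ra ≤ p.ra * ‖k‖ ^ 2 := le_mul_of_one_le_right ha.le hr2
  have h6 : p.omegaBound ≤ p.omegaBound * ‖k‖ ^ 2 := le_mul_of_one_le_right hW.le hr2
  have h7 : 0 ≤ p.rc * ‖k‖ ^ 2 := by positivity
  rintro ω (rfl | rfl) <;> constructor <;> linarith

/-- The part of `dhat` with `e^{2ikl}` is exponentially small in the sector. In `γk - iω` the term
`ω₂` wins by its quadratic growth; for `ω₁` either `γ = 0` and `|ω₁| ≥ w`, or the bounded `ω₁` loses
against `γ|k|`. The exponential part costs half of `w`. -/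
lemma exists_le_norm_dhat (hp : p.IsPhysical) : ∃ S ≥ 1, ∃ c > 0, ∀ k ∈ p.closedRegion S,
    1 ≤ ‖p.omega1 k - p.omega2 k‖ ∧
      ∀ ω ∈ ({p.omega1 k, p.omega2 k} : Set ℂ), c ≤ ‖p.dhat k ω‖ := by
  have ha := hp.ra_pos
  have hb := hp.rb_pos
  have hc := hp.rc_pos
  have hl := hp.l_pos
  have hγ := hp.γ_nonneg
  have hW := omegaBound_pos hp
  have hs := slope_pos hp
  have hw : 0 < p.rb * p.ra / (p.rb + p.rc * p.ra) := by positivity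
  set w := p.rb * p.ra / (p.rb + p.rc * p.ra)
  set A := p.γ + (p.ra + p.rc + p.omegaBound)
  have hquad : ∀ᶠ r : ℝ in atTop, 1 + w + (p.ra + p.omegaBound) + p.omegaBound + p.γ * r ≤
      p.rc * r ^ 2 := by
    filter_upwards [eventually_ge_atTop 1,
      eventually_ge_atTop ((1 + w + (p.ra + p.omegaBound) + p.omegaBound + p.γ) / p.rc)]
      with r h1 h2
    rw [div_le_iff₀ hc] at h2
    nlinarith
  have hlin : 0 < p.γ → ∀ᶠ r : ℝ in atTop, w + p.omegaBound ≤ p.γ * r := fun h0 => by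
    filter_upwards [eventually_ge_atTop ((w + p.omegaBound) / p.γ)] with r h1
    rw [div_le_iff₀ h0] at h1
    linarith
  have hlin' : ∀ᶠ r : ℝ in atTop, p.γ = 0 ∨ w + p.omegaBound ≤ p.γ * r := by
    rcases hγ.eq_or_lt with h | h
    · exact Eventually.of_forall fun _ => Or.inl h.symm
    · filter_upwards [hlin h] with r hr using Or.inr hr
  obtain ⟨S, hS⟩ := eventually_atTop.1 (((eventually_ge_atTop (1 : ℝ)).and hquad).and
    (hlin'.and (eventually_pow_mul_exp_le 2 A (show 0 < 2 * p.l * p.slope by positivity)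
      (half_pos hw))))
  refine ⟨S, (hS S le_rfl).1.1, w / 2, half_pos hw, fun k hk => ?_⟩
  obtain ⟨⟨hr, hq⟩, hli, he⟩ := hS ‖k‖ hk.2.1
  have hω := re_omega2_nonpos hp hk.2.2
  have h1 := norm_omega1_bounds hp hω
  rw [← omegaBound] at h1
  have h2 := norm_omega2_bounds hp hω
  have hγr : 0 ≤ p.γ * ‖k‖ := by positivity
  have hγk : ‖(p.γ : ℂ) * k‖ = p.γ * ‖k‖ := by rw [norm_mul, Complex.norm_of_nonneg hγ]
  constructor
  · rw [norm_sub_rev]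
    linarith [norm_sub_norm_le (p.omega2 k) (p.omega1 k)]
  have hmain : ∀ ω ∈ ({p.omega1 k, p.omega2 k} : Set ℂ), w ≤ ‖p.γ * k - Complex.I * ω‖ := by
    have hI : ∀ ω : ℂ, ‖Complex.I * ω‖ = ‖ω‖ := fun ω => by simp
    rintro ω (rfl | rfl)
    · rcases hli with h0 | h0
      · rw [h0, Complex.ofReal_zero, zero_mul, zero_sub, norm_neg, hI]
        exact h1.1
      · have := norm_sub_norm_le ((p.γ : ℂ) * k) (Complex.I * p.omega1 k)
        rw [hγk, hI] at this
        linarith [h1.2]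
    · have := norm_sub_norm_le (Complex.I * p.omega2 k) ((p.γ : ℂ) * k)
      rw [hγk, hI, norm_sub_rev] at this
      linarith [h2.1]
  intro ω hωm
  have h3 := hmain ω hωm
  have h4 := (norm_omega_le hp hr hω ω hωm).1
  have him := slope_mul_norm_le hp (one_pos.trans_le (hS S le_rfl).1.1) hk
  have h5 : ‖p.expL k ^ 2 * (p.γ * k + Complex.I * ω)‖ ≤ w / 2 := by
    rw [norm_mul, norm_pow, norm_expL]
    have e1 : Real.exp (-(p.l * k.im)) ^ 2 ≤ Real.exp (-(2 * p.l * p.slope * ‖k‖)) := by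
      rw [← Real.exp_nat_mul]
      apply Real.exp_le_exp.2
      push_cast
      nlinarith
    have e2 : ‖p.γ * k + Complex.I * ω‖ ≤ A * ‖k‖ ^ 2 := by
      refine (norm_add_le _ _).trans ?_
      rw [hγk, norm_mul, Complex.norm_I, one_mul]
      have : p.γ * ‖k‖ ≤ p.γ * ‖k‖ ^ 2 := by
        refine mul_le_mul_of_nonneg_left ?_ hγ
        nlinarith
      simp only [A]
      linarith
    calc _ ≤ Real.exp (-(2 * p.l * p.slope * ‖k‖)) * (A * ‖k‖ ^ 2) := by gcongr
      _ = A * ‖k‖ ^ 2 * Real.exp (-(2 * p.l * p.slope * ‖k‖)) := by ring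
      _ ≤ _ := he
  have h6 := norm_sub_norm_le (p.γ * k - Complex.I * ω)
    (-(p.expL k ^ 2 * (p.γ * k + Complex.I * ω)))
  rw [norm_neg, sub_neg_eq_add, add_comm (_ - _)] at h6
  rw [dhat]
  linarith

lemma exists_norm_kernel_le (hp : p.IsPhysical) {y : ℝ} (hy : 0 < y) {s : ℂ} (hs : ‖s‖ = 1) :
    ∃ S ≥ 1, ∃ C ≥ 0, ∀ k ∈ p.closedRegion S, ∀ ω ∈ ({p.omega1 k, p.omega2 k} : Set ℂ),
      ∀ ω' ∈ ({p.omega1 k, p.omega2 k} : Set ℂ), ∀ u ∈ ({1, ω / (Complex.I * k),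
        -(ω / (Complex.I * k))} : Set ℂ), ‖p.kernel y s k ω ω' * u‖ ≤ C / ‖k‖ ^ 2 := by
  have ha := hp.ra_pos
  have hb := hp.rb_pos
  have hc := hp.rc_pos
  have hγ := hp.γ_nonneg
  have hW := omegaBound_pos hp
  have hsl := slope_pos hp
  obtain ⟨S₁, hS₁, c, hc0, hd⟩ := exists_le_norm_dhat hp
  set B := p.ra + p.rc + p.omegaBound
  have hB : 0 < B := by positivity
  set A := p.γ + B
  have hA : 0 < A := by positivity
  -- The power eight collects two from each of `γk - siω`, `ω' - θk²` and `u`, and two from the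
  -- decay that is claimed.
  obtain ⟨S, hS⟩ := eventually_atTop.1 ((eventually_ge_atTop S₁).and
    (eventually_pow_mul_exp_le 8 (2 * A * B / c * (1 + B))
      (show 0 < y * p.slope by positivity) one_pos))
  refine ⟨S, hS₁.trans (hS S le_rfl).1, 1, zero_le_one, fun k hk ω hω ω' hω' u hu => ?_⟩
  obtain ⟨hr, he⟩ := hS ‖k‖ hk.2.1
  have hr1 : 1 ≤ ‖k‖ := hS₁.trans hr
  have hr0 : 0 < ‖k‖ := one_pos.trans_le hr1
  have hk' : k ∈ p.closedRegion S₁ := ⟨hk.1, hr, hk.2.2⟩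
  obtain ⟨h1, h2⟩ := hd k hk'
  have hre := re_omega2_nonpos hp hk.2.2
  have h3 := norm_omega_le hp hr1 hre ω hω
  have h4 := norm_omega_le hp hr1 hre ω' hω'
  have him := slope_mul_norm_le hp (one_pos.trans_le hS₁) hk'
  have e1 : ‖Complex.exp (Complex.I * k * y)‖ ≤ Real.exp (-(y * p.slope * ‖k‖)) := by
    rw [Complex.norm_exp]
    apply Real.exp_le_exp.2
    have : (Complex.I * k * y).re = -(k.im * y) := by simp
    rw [this]
    nlinarith
  have hpow : ∀ m n : ℕ, m ≤ n → ‖k‖ ^ m ≤ ‖k‖ ^ n := fun m n h => pow_le_pow_right₀ hr1 h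
  have e2 : ‖p.γ * k - s * (Complex.I * ω)‖ ≤ A * ‖k‖ ^ 2 := by
    refine (norm_sub_le _ _).trans ?_
    rw [norm_mul, norm_mul, norm_mul, hs, Complex.norm_I, one_mul, one_mul,
      Complex.norm_of_nonneg hγ]
    have := mul_le_mul_of_nonneg_left (hpow 1 2 one_le_two) hγ
    simp only [A]
    rw [pow_one] at this
    linarith [h3.1]
  have e3 : c ≤ ‖(p.omega1 k - p.omega2 k) * p.dhat k ω‖ := by
    rw [norm_mul]
    nlinarith [h2 ω hω]
  have e4 : ‖u‖ ≤ (1 + B) * ‖k‖ ^ 2 := by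
    have e5 : ‖ω / (Complex.I * k)‖ ≤ B * ‖k‖ ^ 2 := by
      rw [norm_div, norm_mul, Complex.norm_I, one_mul]
      exact (div_le_self (norm_nonneg _) hr1).trans h3.1
    have e6 : 1 ≤ ‖k‖ ^ 2 := one_le_pow₀ hr1
    have e7 : 0 ≤ B * ‖k‖ ^ 2 := by positivity
    rcases hu with rfl | rfl | rfl
    · rw [norm_one]; linarith
    · linarith
    · rw [norm_neg]; linarith
  have e8 : ‖p.kernel y s k ω ω'‖ ≤
      2 * Real.exp (-(y * p.slope * ‖k‖)) * (A * ‖k‖ ^ 2) * (B * ‖k‖ ^ 2) / c := by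
    rw [kernel, norm_div, norm_mul, norm_mul, norm_mul, Complex.norm_ofNat]
    have := h4.2
    gcongr
  rw [norm_mul, le_div_iff₀ (by positivity)]
  calc _ ≤ 2 * Real.exp (-(y * p.slope * ‖k‖)) * (A * ‖k‖ ^ 2) * (B * ‖k‖ ^ 2) / c *
        ((1 + B) * ‖k‖ ^ 2) * ‖k‖ ^ 2 := by gcongr
    _ = 2 * A * B / c * (1 + B) * ‖k‖ ^ 8 * Real.exp (-(y * p.slope * ‖k‖)) := by ring
    _ ≤ 1 := he

/-! ### Admissible radii -/

lemma re_sq_le_of_mem_closure (hp : p.IsPhysical) {k : ℂ} (hk : k ∈ closure p.D) :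
    (k ^ 2).re ≤ p.reBound ‖k‖ := by
  have hcl : IsClosed {k : ℂ | (k ^ 2).re ≤ p.reBound ‖k‖} :=
    isClosed_le (by fun_prop) ((continuous_reBound p).comp continuous_norm)
  exact closure_minimal (fun k hk => ((mem_D_iff hp k).1 hk).le) hcl hk

/-- Far out, a point of the closure of `D` is never real, and up to sign it lies in `closedRegion`,
where `dhat` does not vanish. -/
lemma exists_admissible (hp : p.IsPhysical) : ∃ R₀ > 0, ∀ R ≥ R₀, p.Admissible R := by
  obtain ⟨S, hS, c, hc, h⟩ := exists_le_norm_dhat hp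
  have hS0 : 0 < S := one_pos.trans_le hS
  refine ⟨S, hS0, fun R hR => ⟨hS0.trans_le hR, fun k hk hkR => ?_⟩⟩
  have hre := re_sq_le_of_mem_closure hp hk
  have hreg : ∀ k ∈ p.closedRegion S, p.RegularAt k := fun k hk => by
    have hk0 : k ≠ 0 := norm_pos_iff.1 (hS0.trans_le hk.2.1)
    rw [regularAt_iff hp hk0]
    exact ⟨fun _ => norm_pos_iff.1 (hc.trans_le ((h k hk).2 _ (by simp))),
      fun _ => norm_pos_iff.1 (hc.trans_le ((h k hk).2 _ (by simp)))⟩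
  rcases lt_trichotomy k.im 0 with h0 | h0 | h0
  · rw [← regularAt_neg]
    exact hreg _ ⟨by simpa using h0, by rw [norm_neg]; exact hR.trans hkR, by simpa using hre⟩
  · exfalso
    have h1 := reBound_lt hp (hS0.trans_le (hR.trans hkR))
    have h2 : (k ^ 2).re = ‖k‖ ^ 2 := by
      rw [Complex.sq_norm, Complex.normSq_apply, sq, Complex.mul_re, h0]; ring
    linarith
  · exact hreg k ⟨h0, hR.trans hkR, hre⟩

/-! ### The time transform -/

section TimeTransform

variable {g : ℝ → ℝ} {M : ℝ}

lemma timeTransform_eq (g : ℝ → ℝ) (ω : ℂ) (t : ℝ) : timeTransform g ω t =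
    Complex.exp (-ω * t) * ∫ s in (0 : ℝ)..t, Complex.exp (ω * s) * (g s : ℂ) := by
  rw [timeTransform, ← intervalIntegral.integral_const_mul]
  refine intervalIntegral.integral_congr fun s _ => ?_
  rw [← mul_assoc, ← Complex.exp_add]
  ring_nf

lemma timeTransform_congr {g' : ℝ → ℝ} {t : ℝ} (ht : 0 ≤ t) (h : ∀ s ∈ Ioc 0 t, g s = g' s)
    (ω : ℂ) : timeTransform g ω t = timeTransform g' ω t := by
  rw [timeTransform, timeTransform, intervalIntegral.integral_of_le ht,
    intervalIntegral.integral_of_le ht]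
  exact setIntegral_congr_fun measurableSet_Ioc fun s hs => by simp only [h s hs]

lemma norm_timeTransform_le (hM : ∀ s, |g s| ≤ M) {Λ t : ℝ} (hΛ : 0 ≤ Λ) {ω : ℂ}
    (hω : -Λ ≤ ω.re) (ht : 0 ≤ t) : ‖timeTransform g ω t‖ ≤ M * Real.exp (Λ * t) * t := by
  have hM0 : 0 ≤ M := (abs_nonneg _).trans (hM 0)
  refine (intervalIntegral.norm_integral_le_of_norm_le_const
    (C := M * Real.exp (Λ * t)) fun s hs => ?_).trans_eq (by rw [sub_zero, abs_of_nonneg ht])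
  rw [uIoc_of_le ht] at hs
  rw [norm_mul, Complex.norm_real, Real.norm_eq_abs, mul_comm, Complex.norm_exp]
  refine mul_le_mul (hM s) (Real.exp_le_exp.2 ?_) (Real.exp_pos _).le hM0
  have : (-ω * ((t : ℂ) - s)).re = -ω.re * (t - s) := by
    rw [← Complex.ofReal_sub, Complex.re_mul_ofReal, Complex.neg_re]
  rw [this]
  have h1 : -ω.re * (t - s) ≤ Λ * (t - s) :=
    mul_le_mul_of_nonneg_right (by linarith) (by linarith [hs.2])
  have h2 : Λ * (t - s) ≤ Λ * t := mul_le_mul_of_nonneg_left (by linarith [hs.1]) hΛ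
  exact h1.trans h2

lemma intervalIntegrable_exp_mul (hg : Integrable g) (ω : ℂ) (a b : ℝ) :
    IntervalIntegrable (fun s : ℝ => Complex.exp (ω * s) * (g s : ℂ)) volume a b :=
  (hg.ofReal (𝕜 := ℂ)).intervalIntegrable.continuousOn_mul (by fun_prop)

lemma continuous_timeTransform_time (hg : Integrable g) (ω : ℂ) :
    Continuous (timeTransform g ω) := by
  rw [funext (timeTransform_eq g ω)]
  exact Continuous.mul (by fun_prop)
    (intervalIntegral.continuous_primitive (intervalIntegrable_exp_mul hg ω) 0)

lemma differentiable_timeTransform (hg : Integrable g) (t : ℝ) :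
    Differentiable ℂ fun ω => timeTransform g ω t := by
  rw [funext fun ω => timeTransform_eq g ω t]
  refine Differentiable.mul (by fun_prop) fun ω₀ => ?_
  refine (intervalIntegral.hasDerivAt_integral_of_dominated_loc_of_deriv_le
    (F := fun ω (s : ℝ) => Complex.exp (ω * s) * (g s : ℂ))
    (F' := fun ω (s : ℝ) => Complex.exp (ω * s) * s * (g s : ℂ))
    (bound := fun s => Real.exp ((‖ω₀‖ + 1) * |s|) * |s| * |g s|)
    (Metric.ball_mem_nhds ω₀ one_pos) ?_ (intervalIntegrable_exp_mul hg ω₀ 0 t) ?_ ?_ ?_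
    ?_).2.differentiableAt
  · exact Eventually.of_forall fun ω =>
      (intervalIntegrable_exp_mul hg ω 0 t).def'.aestronglyMeasurable
  · exact ((hg.ofReal (𝕜 := ℂ)).intervalIntegrable.continuousOn_mul
      (g := fun s : ℝ => Complex.exp (ω₀ * s) * s) (by fun_prop)).def'.aestronglyMeasurable
  · refine Eventually.of_forall fun s _ ω hω => ?_
    have h1 : ‖ω‖ ≤ ‖ω₀‖ + 1 := by
      have := norm_sub_norm_le ω ω₀
      rw [Metric.mem_ball, dist_eq_norm] at hω
      linarith
    rw [norm_mul, norm_mul, Complex.norm_real, Complex.norm_real, Real.norm_eq_abs, Real.norm_eq_abs]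
    gcongr
    refine (Complex.norm_exp_le_exp_norm _).trans (Real.exp_le_exp.2 ?_)
    rw [norm_mul, Complex.norm_real, Real.norm_eq_abs]
    gcongr
  · exact hg.abs.intervalIntegrable.continuousOn_mul (by fun_prop)
  · refine Eventually.of_forall fun s _ ω _ => ?_
    have := ((hasDerivAt_id ω).mul_const (s : ℂ)).cexp.mul_const (g s : ℂ)
    simpa using this

/-- The Laplace transform of the time transform. -/
lemma laplace_timeTransform (hg : Integrable g) {T : ℝ} (hT : 0 ≤ T)
    (hgc : ContinuousOn g (Ioo 0 T)) {y : ℝ} {ω : ℂ} (h : (y : ℂ) + ω ≠ 0) :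
    ∫ t in (0 : ℝ)..T, ((Real.exp (-y * t) : ℝ) : ℂ) * timeTransform g ω t =
      ((∫ t in (0 : ℝ)..T, ((Real.exp (-y * t) : ℝ) : ℂ) * (g t : ℂ)) -
        (Real.exp (-y * T) : ℝ) * timeTransform g ω T) / (y + ω) := by
  have hcont := continuous_timeTransform_time hg ω
  have hE : Continuous fun t : ℝ => ((Real.exp (-y * t) : ℝ) : ℂ) := by fun_prop
  have hi1 : IntervalIntegrable (fun t : ℝ => ((Real.exp (-y * t) : ℝ) : ℂ) * timeTransform g ω t)
      volume 0 T := (hE.mul hcont).intervalIntegrable _ _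
  have hi2 : IntervalIntegrable (fun t : ℝ => ((Real.exp (-y * t) : ℝ) : ℂ) * (g t : ℂ))
      volume 0 T := (hg.ofReal (𝕜 := ℂ)).intervalIntegrable.continuousOn_mul hE.continuousOn
  -- `e^{-yt}` times the time transform vanishes at `0` and has derivative `e^{-yt} g` minus `y + ω`
  -- times itself; integrating over `[0, T]` gives the identity.
  have key := intervalIntegral.integral_eq_sub_of_hasDerivAt_of_le hT
    (f := fun t : ℝ => ((Real.exp (-y * t) : ℝ) : ℂ) * timeTransform g ω t)
    (f' := fun t : ℝ => ((Real.exp (-y * t) : ℝ) : ℂ) * (g t : ℂ) -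
      (y + ω) * (((Real.exp (-y * t) : ℝ) : ℂ) * timeTransform g ω t))
    (hE.mul hcont).continuousOn ?_ (hi2.sub (hi1.const_mul _))
  · rw [intervalIntegral.integral_sub hi2 (hi1.const_mul _),
      intervalIntegral.integral_const_mul] at key
    have h0 : timeTransform g ω 0 = 0 := by simp [timeTransform]
    rw [h0, mul_zero, sub_zero] at key
    rw [eq_div_iff h]
    linear_combination -key
  · intro t ht
    have hgt : ContinuousAt g t := hgc.continuousAt (isOpen_Ioo.mem_nhds ht)
    have hmeas : StronglyMeasurableAtFilter (fun s : ℝ => Complex.exp (ω * s) * (g s : ℂ)) (𝓝 t) :=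
      ((by fun_prop : Continuous fun s : ℝ => Complex.exp (ω * s)).aestronglyMeasurable.mul
        (hg.ofReal (𝕜 := ℂ)).aestronglyMeasurable).stronglyMeasurableAtFilter
    have hcat : ContinuousAt (fun s : ℝ => Complex.exp (ω * s) * (g s : ℂ)) t :=
      ContinuousAt.mul (by fun_prop) (Complex.continuous_ofReal.continuousAt.comp hgt)
    have h1 := intervalIntegral.integral_hasDerivAt_right (intervalIntegrable_exp_mul hg ω 0 t)
      hmeas hcat
    have h2 : HasDerivAt (fun t : ℝ => Complex.exp (-(y + ω) * t))
        (Complex.exp (-(y + ω) * t) * (-(y + ω))) t := by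
      have := ((hasDerivAt_id t).ofReal_comp.const_mul (-(y + ω))).cexp
      simpa using this
    have e1 : ∀ t : ℝ, ((Real.exp (-y * t) : ℝ) : ℂ) * timeTransform g ω t =
        Complex.exp (-(y + ω) * t) * ∫ s in (0 : ℝ)..t, Complex.exp (ω * s) * (g s : ℂ) := fun t => by
      rw [timeTransform_eq, ← mul_assoc, Complex.ofReal_exp, ← Complex.exp_add]
      congr 2
      push_cast
      ring
    have e2 : Complex.exp (-(y + ω) * t) * Complex.exp (ω * t) = (Real.exp (-y * t) : ℝ) := by
      rw [← Complex.exp_add, Complex.ofReal_exp]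
      congr 1
      push_cast
      ring
    rw [funext e1, e1, ← e2]
    refine (h2.mul h1).congr_deriv ?_
    ring

end TimeTransform

/-! ### Superpositions of time transforms -/

section Superposition

variable {g : ℝ → ℝ} {M Λ : ℝ} {w W : ℝ → ℂ}

lemma measurable_timeTransform_comp (hg : Integrable g) (hW : Continuous W) :
    StronglyMeasurable fun z : ℝ × ℝ => timeTransform g (W z.2) z.1 := by
  refine stronglyMeasurable_uncurry_of_continuous_of_stronglyMeasurable
    (u := fun (t s : ℝ) => timeTransform g (W s) t)
    (fun s => continuous_timeTransform_time hg (W s)) fun t => ?_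
  exact ((differentiable_timeTransform hg t).continuous.comp hW).stronglyMeasurable

lemma integrable_mul_timeTransform (hg : Integrable g) (hM : ∀ s, |g s| ≤ M) (hw : Integrable w)
    (hW : Continuous W) (hΛ : 0 ≤ Λ) (hre : ∀ s, -Λ ≤ (W s).re) {t : ℝ} (ht : 0 ≤ t) :
    Integrable fun s => w s * timeTransform g (W s) t :=
  hw.mul_bdd (c := M * Real.exp (Λ * t) * t)
    ((differentiable_timeTransform hg t).continuous.comp hW).aestronglyMeasurable
    (Eventually.of_forall fun s => norm_timeTransform_le hM hΛ (hre s) ht)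

lemma norm_timeTransform_le' (hM : ∀ s, |g s| ≤ M) (hΛ : 0 ≤ Λ) {ω : ℂ} (hω : -Λ ≤ ω.re)
    {t T : ℝ} (ht : 0 ≤ t) (htT : t ≤ T) :
    ‖timeTransform g ω t‖ ≤ M * Real.exp (Λ * T) * T := by
  have hM0 : 0 ≤ M := (abs_nonneg _).trans (hM 0)
  refine (norm_timeTransform_le hM hΛ hω ht).trans ?_
  gcongr

lemma continuousOn_superposition (hg : Integrable g) (hM : ∀ s, |g s| ≤ M) (hw : Integrable w)
    (hW : Continuous W) (hΛ : 0 ≤ Λ) (hre : ∀ s, -Λ ≤ (W s).re) (T : ℝ) :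
    ContinuousOn (fun t => ∫ s, w s * timeTransform g (W s) t) (Icc 0 T) := by
  refine continuousOn_of_dominated (bound := fun s => ‖w s‖ * (M * Real.exp (Λ * T) * T)) ?_ ?_
    (hw.norm.mul_const _) ?_
  · exact fun t ht => (integrable_mul_timeTransform hg hM hw hW hΛ hre ht.1).aestronglyMeasurable
  · refine fun t ht => Eventually.of_forall fun s => ?_
    rw [norm_mul]
    exact mul_le_mul_of_nonneg_left (norm_timeTransform_le' hM hΛ (hre s) ht.1 ht.2) (norm_nonneg _)
  · exact Eventually.of_forall fun s =>
      ((continuous_timeTransform_time hg (W s)).const_mul _).continuousOn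

/-- The Laplace transform of a superposition of time transforms. -/
lemma laplace_superposition (hg : Integrable g) (hM : ∀ s, |g s| ≤ M) (hw : Integrable w)
    (hW : Continuous W) (hΛ : 0 ≤ Λ) (hre : ∀ s, -Λ ≤ (W s).re) {T : ℝ} (hT : 0 ≤ T)
    (hgc : ContinuousOn g (Ioo 0 T)) {y : ℝ} (hy : Λ + 1 ≤ y) :
    ‖(∫ t in (0 : ℝ)..T, ((Real.exp (-y * t) : ℝ) : ℂ) * ∫ s, w s * timeTransform g (W s) t) -
      (∫ s, w s / (y + W s)) * ∫ t in (0 : ℝ)..T, ((Real.exp (-y * t) : ℝ) : ℂ) * (g t : ℂ)‖ ≤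
    (∫ s, ‖w s‖) * (M * Real.exp (Λ * T) * T) * Real.exp (-y * T) := by
  have hM0 : 0 ≤ M := (abs_nonneg _).trans (hM 0)
  have hne : ∀ s, 1 ≤ ‖(y : ℂ) + W s‖ := fun s => by
    refine le_trans ?_ (Complex.re_le_norm _)
    rw [Complex.add_re, Complex.ofReal_re]
    linarith [hre s]
  have hne0 : ∀ s, (y : ℂ) + W s ≠ 0 := fun s => norm_pos_iff.1 (one_pos.trans_le (hne s))
  set B := M * Real.exp (Λ * T) * T
  have hB : 0 ≤ B := by positivity
  set G := ∫ t in (0 : ℝ)..T, ((Real.exp (-y * t) : ℝ) : ℂ) * (g t : ℂ)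
  have hinv : Continuous fun s => ((y : ℂ) + W s)⁻¹ := (continuous_const.add hW).inv₀ hne0
  have hinvb : ∀ s, ‖((y : ℂ) + W s)⁻¹‖ ≤ 1 := fun s => by
    rw [norm_inv]; exact inv_le_one_of_one_le₀ (hne s)
  have hw1 : Integrable fun s => w s / (y + W s) := by
    simp only [div_eq_mul_inv]
    exact hw.mul_bdd (c := 1) hinv.aestronglyMeasurable (Eventually.of_forall hinvb)
  have hw2 : Integrable fun s => w s / (y + W s) * timeTransform g (W s) T :=
    integrable_mul_timeTransform hg hM hw1 hW hΛ hre hT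
  have hswap : (∫ t in (0 : ℝ)..T, ((Real.exp (-y * t) : ℝ) : ℂ) *
      ∫ s, w s * timeTransform g (W s) t) =
      ∫ s, ∫ t in (0 : ℝ)..T, w s * (((Real.exp (-y * t) : ℝ) : ℂ) * timeTransform g (W s) t) := by
    simp only [intervalIntegral.integral_of_le hT]
    rw [← integral_integral_swap]
    · refine integral_congr_ae (Eventually.of_forall fun t => ?_)
      simp only
      rw [← integral_const_mul]
      exact integral_congr_ae (Eventually.of_forall fun s => by simp only; ring)
    · have hmaj : Integrable (fun z : ℝ × ℝ => Real.exp (-y * z.1) * (‖w z.2‖ * B))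
          ((volume.restrict (Ioc 0 T)).prod volume) :=
        Integrable.mul_prod (f := fun t => Real.exp (-y * t)) (g := fun s => ‖w s‖ * B)
          ((Continuous.integrableOn_Icc (by fun_prop)).mono_set Ioc_subset_Icc_self)
          (hw.norm.mul_const B)
      refine hmaj.mono' ?_ ?_
      · refine AEStronglyMeasurable.mul hw.aestronglyMeasurable.comp_snd ?_
        refine AEStronglyMeasurable.mul ?_
          (measurable_timeTransform_comp hg hW).aestronglyMeasurable
        exact (by fun_prop : Continuous fun z : ℝ × ℝ =>
          ((Real.exp (-y * z.1) : ℝ) : ℂ)).aestronglyMeasurable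
      · have hmem : ∀ᵐ z ∂((volume.restrict (Ioc (0 : ℝ) T)).prod (volume : Measure ℝ)),
            z.1 ∈ Ioc 0 T :=
          Measure.quasiMeasurePreserving_fst.ae (ae_restrict_mem measurableSet_Ioc)
        filter_upwards [hmem] with z hz
        simp only [Function.uncurry]
        rw [norm_mul, norm_mul, Complex.norm_real, Real.norm_of_nonneg (Real.exp_pos _).le]
        have := norm_timeTransform_le' hM hΛ (hre z.2) hz.1.le hz.2
        calc _ = Real.exp (-y * z.1) * (‖w z.2‖ * ‖timeTransform g (W z.2) z.1‖) := by ring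
          _ ≤ _ := by gcongr
  -- Only the contribution of the final time `T` deviates from the product form; it carries the
  -- factor `e^{-yT}` and becomes the error.
  have hinner : ∀ s, (∫ t in (0 : ℝ)..T, w s * (((Real.exp (-y * t) : ℝ) : ℂ) *
      timeTransform g (W s) t)) = w s / (y + W s) * G -
        (Real.exp (-y * T) : ℝ) * (w s / (y + W s) * timeTransform g (W s) T) := fun s => by
    rw [intervalIntegral.integral_const_mul, laplace_timeTransform hg hT hgc (hne0 s)]
    ring
  rw [hswap, integral_congr_ae (Eventually.of_forall hinner),
    integral_sub (hw1.mul_const _) (hw2.const_mul _), integral_mul_const, integral_const_mul,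
    sub_sub_cancel_left, norm_neg, norm_mul, Complex.norm_real,
    Real.norm_of_nonneg (Real.exp_pos _).le, mul_comm]
  refine mul_le_mul_of_nonneg_right ?_ (Real.exp_pos _).le
  rw [← integral_mul_const]
  refine norm_integral_le_of_norm_le (hw.norm.mul_const _) (Eventually.of_forall fun s => ?_)
  rw [norm_mul, div_eq_mul_inv, norm_mul]
  have h1 := norm_timeTransform_le' hM hΛ (hre s) hT le_rfl
  have h2 := mul_le_mul_of_nonneg_left (hinvb s) (norm_nonneg (w s))
  rw [mul_one] at h2
  exact mul_le_mul h2 h1 (norm_nonneg _) (norm_nonneg _)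

end Superposition

/-! ### The integrands along the contour -/

lemma mem_closure_D (hp : p.IsPhysical) {R : ℝ} (hR : 0 < R) {k : ℂ} (hk : k ∈ p.closedRegion R) :
    k ∈ closure p.D := closedRegion_subset hp hR hk

lemma ne_zero_of_mem {R : ℝ} (hR : 0 < R) {k : ℂ} (hk : k ∈ p.closedRegion R) : k ≠ 0 :=
  norm_pos_iff.1 (hR.trans_le hk.2.1)

lemma ra_sub_omega2_ne_zero (hp : p.IsPhysical) {k : ℂ} (hk : (p.omega2 k).re ≤ 0) :
    (p.ra : ℂ) - p.omega2 k ≠ 0 := fun h => by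
  have := congrArg Complex.re h
  simp only [Complex.sub_re, Complex.ofReal_re, Complex.zero_re] at this
  linarith [hp.ra_pos]

lemma omega1_sub_ne_zero (hp : p.IsPhysical) {k : ℂ} (hk : (p.omega2 k).re ≤ 0) :
    p.omega1 k - p.theta * k ^ 2 ≠ 0 := by
  have e : p.omega1 k - p.theta * k ^ 2 = p.ra - p.omega2 k := by
    rw [theta_eq]; linear_combination omega_add hp k
  rw [e]
  exact ra_sub_omega2_ne_zero hp hk

lemma dhat_omega2_ne_zero (hp : p.IsPhysical) {R : ℝ} (hR : p.Admissible R) {k : ℂ}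
    (hk : k ∈ p.closedRegion R) : p.dhat k (p.omega2 k) ≠ 0 :=
  ((regularAt_iff hp (ne_zero_of_mem hR.1 hk)).1
    (hR.2 k (mem_closure_D hp hR.1 hk) hk.2.1)).2
      (omega1_sub_ne_zero hp (re_omega2_nonpos hp hk.2.2))

/-- The factor equals `ra - ω₁`, and inserting `ω₁ = ra` into the Möbius relation leaves `(rb - ra
rc) ω₂ = 0` with `ω₂ ≠ 0`. So it vanishes everywhere on the region, in the case `ατ = μ²`, or
nowhere. -/
lemma omega2_sub_eq_zero_iff (hp : p.IsPhysical) {R : ℝ} (hR : 0 < R) {k : ℂ}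
    (hk : k ∈ p.closedRegion R) :
    p.omega2 k - p.theta * k ^ 2 = 0 ↔ p.rb = p.ra * p.rc := by
  have h1 := omega1_mul_eq hp k
  have h2 := ra_sub_omega2_ne_zero hp (re_omega2_nonpos hp hk.2.2)
  have e : p.omega2 k - p.theta * k ^ 2 = p.ra - p.omega1 k := by
    rw [theta_eq]; linear_combination omega_add hp k
  have hω : p.omega2 k ≠ 0 := fun h => by
    have h3 := omega_mul hp k
    rw [h, mul_zero, eq_comm, mul_eq_zero] at h3
    rcases h3 with h3 | h3
    · exact hp.rb_pos.ne' (by exact_mod_cast h3)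
    · exact ne_zero_of_mem hR hk (pow_eq_zero_iff two_ne_zero |>.1 h3)
  rw [e]
  constructor
  · intro h
    have h3 : ((p.rb : ℂ) - p.ra * p.rc) * p.omega2 k = 0 := by
      linear_combination h1 + (p.rb - p.rc * p.omega2 k) * h
    have h4 := sub_eq_zero.1 ((mul_eq_zero.1 h3).resolve_right hω)
    exact_mod_cast h4
  · intro h
    have hb : (p.rb : ℂ) = p.ra * p.rc := by exact_mod_cast h
    have hc : (p.rc : ℂ) ≠ 0 := by exact_mod_cast hp.rc_pos.ne'
    have h3 : p.rc * (p.ra - p.omega2 k) * (p.ra - p.omega1 k) = 0 := by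
      rw [hb] at h1
      linear_combination -h1
    exact (mul_eq_zero.1 h3).resolve_left (mul_ne_zero hc h2)

lemma differentiableAt_term (hp : p.IsPhysical) {R : ℝ} (hR : 0 < R) {k : ℂ}
    (hk : k ∈ p.closedRegion R) (y : ℝ) (s : ℂ) (i : Fin 2) {ω ω' : ℂ → ℂ}
    (hω : DifferentiableAt ℂ ω k) (hω' : DifferentiableAt ℂ ω' k) (hd : p.dhat k (ω k) ≠ 0) :
    DifferentiableAt ℂ (fun k => p.term y s i k (ω k) (ω' k)) k := by
  have h1 := differentiableAt_omega1 hp hk.2.2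
  have h2 := differentiableAt_omega2 hp hk.2.2
  have hk0 := ne_zero_of_mem hR hk
  have hdd : DifferentiableAt ℂ (fun k => p.dhat k (ω k)) k := by
    unfold dhat expL; fun_prop
  have hw := omega_sub_ne_zero hp hk.2.2
  unfold term kernel
  refine DifferentiableAt.mul ?_ ?_
  · exact DifferentiableAt.div (by fun_prop) ((h1.sub h2).mul hdd) (mul_ne_zero hw hd)
  · fin_cases i
    · simp
    · simp only [Fin.mk_one, Matrix.cons_val_one, Matrix.cons_val_fin_one]
      exact (hω.div (by fun_prop) (mul_ne_zero Complex.I_ne_zero hk0)).const_mul s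

lemma exists_norm_term_le (hp : p.IsPhysical) {y : ℝ} (hy : 0 < y) {s : ℂ}
    (hs : s ∈ ({1, -1} : Set ℂ)) (i : Fin 2) :
    ∃ S ≥ 1, ∃ C ≥ 0, ∀ k ∈ p.closedRegion S,
      ‖p.term y s i k (p.omega1 k) (p.omega2 k)‖ ≤ C / ‖k‖ ^ 2 ∧
      ‖p.term y s i k (p.omega2 k) (p.omega1 k)‖ ≤ C / ‖k‖ ^ 2 := by
  have hs1 : ‖s‖ = 1 := by rcases hs with rfl | rfl <;> simp
  obtain ⟨S, hS, C, hC, h⟩ := exists_norm_kernel_le hp hy hs1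
  have hu : ∀ k ω : ℂ, ![1, s * (ω / (Complex.I * k))] i ∈ ({1, ω / (Complex.I * k),
      -(ω / (Complex.I * k))} : Set ℂ) := fun k ω => by
    rcases hs with rfl | rfl <;> fin_cases i <;> simp
  exact ⟨S, hS, C, hC, fun k hk => ⟨h k hk _ (by simp) _ (by simp) _ (hu k _),
    h k hk _ (by simp) _ (by simp) _ (hu k _)⟩⟩

/-- The terms with `ω₁` do not contribute to the integrals. -/
lemma integral_term_omega1 (hp : p.IsPhysical) {R : ℝ} (hR : p.Admissible R) {g : ℝ → ℝ} {M : ℝ}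
    (hg : Integrable g) (hM : ∀ s, |g s| ≤ M) {t : ℝ} (ht : 0 ≤ t) {y : ℝ} (hy : 0 < y) {s : ℂ}
    (hs : s ∈ ({1, -1} : Set ℂ)) (i : Fin 2) :
    Integrable (fun v => deriv (p.contourPlus R) v * (p.term y s i (p.contourPlus R v)
        (p.omega1 (p.contourPlus R v)) (p.omega2 (p.contourPlus R v)) *
          p.gT1 g (p.contourPlus R v) t)) ∧
      ∫ v, deriv (p.contourPlus R) v * (p.term y s i (p.contourPlus R v)
        (p.omega1 (p.contourPlus R v)) (p.omega2 (p.contourPlus R v)) *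
          p.gT1 g (p.contourPlus R v) t) = 0 := by
  -- In the degenerate case regularity says nothing about `dhat` at `ω₁`, so Cauchy's theorem is
  -- unavailable; but then the term is identically zero.
  by_cases hdeg : p.rb = p.ra * p.rc
  · have h0 : ∀ v, p.term y s i (p.contourPlus R v)
        (p.omega1 (p.contourPlus R v)) (p.omega2 (p.contourPlus R v)) = 0 := fun v => by
      rw [term, kernel, (omega2_sub_eq_zero_iff hp hR.1 (contourPlus_mem hp hR.1 v).1).2 hdeg]
      simp
    simp [h0]
  · obtain ⟨S, -, C, hC, hb⟩ := exists_norm_term_le hp hy hs i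
    refine integral_contourPlus_eq_zero hp hR.1 (F := fun k =>
      p.term y s i k (p.omega1 k) (p.omega2 k) * p.gT1 g k t) (S := S)
      (C := C * (M * Real.exp (0 * t) * t)) (fun k hk => ?_) fun k hk hSk => ?_
    · have hd : p.dhat k (p.omega1 k) ≠ 0 := ((regularAt_iff hp (ne_zero_of_mem hR.1 hk)).1
        (hR.2 k (mem_closure_D hp hR.1 hk) hk.2.1)).1
          (mt (omega2_sub_eq_zero_iff hp hR.1 hk).1 hdeg)
      have h1 := differentiableAt_omega1 hp hk.2.2
      exact (differentiableAt_term hp hR.1 hk y s i h1 (differentiableAt_omega2 hp hk.2.2) hd).mul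
        (((differentiable_timeTransform hg t) _).comp k h1)
    · rw [norm_mul, mul_div_right_comm]
      refine mul_le_mul (hb k ⟨hk.1, hSk, hk.2.2⟩).1 ?_ (norm_nonneg _) (by positivity)
      exact norm_timeTransform_le hM le_rfl (by linarith [re_omega1_pos hp k]) ht

/-- The weight of `g̃⁽²⁾` along the contour. -/
def weight (p : GKParams) (R y : ℝ) (s : ℂ) (i : Fin 2) (v : ℝ) : ℂ :=
  deriv (p.contourPlus R) v * p.term y s i (p.contourPlus R v)
    (p.omega2 (p.contourPlus R v)) (p.omega1 (p.contourPlus R v))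

lemma differentiableAt_term_omega2 (hp : p.IsPhysical) {R : ℝ} (hR : p.Admissible R) {k : ℂ}
    (hk : k ∈ p.closedRegion R) (y : ℝ) (s : ℂ) (i : Fin 2) :
    DifferentiableAt ℂ (fun k => p.term y s i k (p.omega2 k) (p.omega1 k)) k :=
  differentiableAt_term hp hR.1 hk y s i (differentiableAt_omega2 hp hk.2.2)
    (differentiableAt_omega1 hp hk.2.2) (dhat_omega2_ne_zero hp hR hk)

lemma integrable_weight (hp : p.IsPhysical) {R : ℝ} (hR : p.Admissible R) {y : ℝ} (hy : 0 < y)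
    {s : ℂ} (hs : s ∈ ({1, -1} : Set ℂ)) (i : Fin 2) : Integrable (p.weight R y s i) := by
  obtain ⟨S, -, C, hC, hb⟩ := exists_norm_term_le hp hy hs i
  refine integrable_contourPlus hp hR.1 (S := max R S) (C := C) (f := fun v =>
    p.term y s i (p.contourPlus R v) (p.omega2 (p.contourPlus R v)) (p.omega1 (p.contourPlus R v)))
    (continuous_comp_contourPlus hp hR.1 (F := fun k => p.term y s i k (p.omega2 k) (p.omega1 k))
      fun k hk => (differentiableAt_term_omega2 hp hR hk y s i).continuousAt) fun v hv => ?_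
  have h1 := norm_contourPlus hp hR.1 v
  rw [max_eq_right ((le_max_left _ _).trans hv)] at h1
  have h2 := (contourPlus_mem hp hR.1 v).1
  have := (hb _ ⟨h2.1, by rw [h1]; exact (le_max_right _ _).trans hv, h2.2.2⟩).2
  rwa [h1, sq_abs] at this

lemma continuous_omega2_contourPlus (hp : p.IsPhysical) {R : ℝ} (hR : 0 < R) :
    Continuous fun v => p.omega2 (p.contourPlus R v) :=
  continuous_comp_contourPlus hp hR fun _ hk => (differentiableAt_omega2 hp hk.2.2).continuousAt

/-- Off the circular arc the contour lies on the frontier of `D`, where `Re ω₂ ≥ 0`; the arc is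
compact. -/
lemma exists_le_re_omega2 (hp : p.IsPhysical) {R : ℝ} (hR : 0 < R) :
    ∃ Λ ≥ 0, ∀ v, -Λ ≤ (p.omega2 (p.contourPlus R v)).re := by
  obtain ⟨M, hM⟩ := (isCompact_Icc (a := -R) (b := R)).exists_bound_of_continuousOn
    (continuous_omega2_contourPlus hp hR).continuousOn
  refine ⟨max M 0, le_max_right _ _, fun v => ?_⟩
  by_cases hv : |v| ≤ R
  · have h1 := hM v (abs_le.1 hv)
    have h2 := Complex.abs_re_le_norm (p.omega2 (p.contourPlus R v))
    linarith [(abs_le.1 h2).1, le_max_left M 0]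
  · have h1 : p.contourPlus R v ∈ frontier (p.D0Plus R) :=
      range_contourPlus hp hR ▸ mem_range_self v
    rw [(isOpen_D0Plus hp R).frontier_eq] at h1
    have h2 : 0 ≤ (p.omega2 (p.contourPlus R v)).re := by
      by_contra! h
      refine h1.2 ⟨(mem_D_iff_re hp _).2 h, (contourPlus_mem hp hR v).1.1, ?_⟩
      rw [norm_contourPlus hp hR]
      exact (not_le.1 hv).trans_le (le_max_right _ _)
    linarith [le_max_right M 0]

section Representation

variable {g : ℝ → ℝ} {M R x t : ℝ}

lemma integrable_weight_mul (hp : p.IsPhysical) (hR : p.Admissible R) (hg : Integrable g)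
    (hM : ∀ s, |g s| ≤ M) (ht : 0 ≤ t) {y : ℝ} (hy : 0 < y) {s : ℂ}
    (hs : s ∈ ({1, -1} : Set ℂ)) (i : Fin 2) :
    Integrable fun v => p.weight R y s i v * timeTransform g (p.omega2 (p.contourPlus R v)) t := by
  obtain ⟨Λ, hΛ, hre⟩ := exists_le_re_omega2 hp hR.1
  exact integrable_mul_timeTransform hg hM (integrable_weight hp hR hy hs i)
    (continuous_omega2_contourPlus hp hR.1) hΛ hre ht

lemma deriv_contourMinus (p : GKParams) (R v : ℝ) :
    deriv (p.contourMinus R) v = -deriv (p.contourPlus R) v :=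
  deriv.fun_neg

lemma integral_contour_components (hp : p.IsPhysical) (hR : p.Admissible R) (hg : Integrable g)
    (hM : ∀ s, |g s| ≤ M) (hx : x ∈ Ioc 0 p.l) (ht : 0 ≤ t) (i : Fin 2) :
    (Integrable (fun v => deriv (p.contourPlus R) v *
        (Complex.exp (Complex.I * p.contourPlus R v * x) *
          p.explicitIntegrand g (p.contourPlus R v) t i)) ∧
      Integrable (fun v => deriv (p.contourMinus R) v *
        (Complex.exp (Complex.I * p.contourMinus R v * x) *
          p.explicitIntegrand g (p.contourMinus R v) t i))) ∧
    ((∫ v, deriv (p.contourPlus R) v * (Complex.exp (Complex.I * p.contourPlus R v * x) *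
          p.explicitIntegrand g (p.contourPlus R v) t i)) +
      ∫ v, deriv (p.contourMinus R) v * (Complex.exp (Complex.I * p.contourMinus R v * x) *
          p.explicitIntegrand g (p.contourMinus R v) t i)) =
      -∫ v, (p.weight R x 1 i v - p.weight R (2 * p.l - x) (-1) i v) *
        timeTransform g (p.omega2 (p.contourPlus R v)) t := by
  have hx2 : 0 < 2 * p.l - x := by linarith [hx.2, hp.l_pos]
  have hm1 : (1 : ℂ) ∈ ({1, -1} : Set ℂ) := by simp
  have hm2 : (-1 : ℂ) ∈ ({1, -1} : Set ℂ) := by simp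
  obtain ⟨i1, z1⟩ := integral_term_omega1 hp hR hg hM ht hx.1 hm1 i
  obtain ⟨i2, z2⟩ := integral_term_omega1 hp hR hg hM ht hx2 hm2 i
  have j1 := integrable_weight_mul hp hR hg hM ht hx.1 hm1 i
  have j2 := integrable_weight_mul hp hR hg hM ht hx2 hm2 i
  have hne : ∀ v, p.contourPlus R v ≠ 0 := fun v =>
    ne_zero_of_mem hR.1 (contourPlus_mem hp hR.1 v).1
  have e1 := fun v => exp_mul_explicitIntegrand hp (hne v) g t x i
  have e2 := fun v => exp_mul_explicitIntegrand_neg hp (hne v) g t x i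
  have f1 : (fun v => deriv (p.contourPlus R) v * (Complex.exp (Complex.I * p.contourPlus R v * x) *
      p.explicitIntegrand g (p.contourPlus R v) t i)) = fun v =>
      deriv (p.contourPlus R) v * (p.term x 1 i (p.contourPlus R v)
        (p.omega1 (p.contourPlus R v)) (p.omega2 (p.contourPlus R v)) *
          p.gT1 g (p.contourPlus R v) t) -
      p.weight R x 1 i v * timeTransform g (p.omega2 (p.contourPlus R v)) t := by
    funext v
    rw [e1, weight, gT2]
    ring
  have f2 : (fun v => deriv (p.contourMinus R) v *
      (Complex.exp (Complex.I * p.contourMinus R v * x) *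
        p.explicitIntegrand g (p.contourMinus R v) t i)) = fun v =>
      p.weight R (2 * p.l - x) (-1) i v * timeTransform g (p.omega2 (p.contourPlus R v)) t -
      deriv (p.contourPlus R) v * (p.term (2 * p.l - x) (-1) i (p.contourPlus R v)
        (p.omega1 (p.contourPlus R v)) (p.omega2 (p.contourPlus R v)) *
          p.gT1 g (p.contourPlus R v) t) := by
    funext v
    rw [deriv_contourMinus, contourMinus, e2, weight, gT2]
    ring
  rw [f1, f2]
  refine ⟨⟨i1.sub j1, j2.sub i2⟩, ?_⟩
  simp only [sub_mul]
  rw [integral_sub i1 j1, integral_sub j2 i2, integral_sub j1 j2, z1, z2]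
  ring

end Representation

/-! ### The residue at `iκ` -/

/-- `-y` solves the dispersion equation at `k = iκ`, and it cannot be `ω₁`, whose real part is
positive. -/
lemma omega_at_pole (hp : p.IsPhysical) {y κ : ℝ} (hy : 0 < y)
    (hκ : κ ^ 2 * (p.rc * y + p.rb) = y * (y + p.ra)) :
    p.omega2 (κ * Complex.I) = -y ∧ p.omega1 (κ * Complex.I) + p.rc * κ ^ 2 = p.ra + y := by
  have hκ' : (κ : ℂ) ^ 2 * (p.rc * y + p.rb) = y * (y + p.ra) := by exact_mod_cast hκ
  have hI : ((κ : ℂ) * Complex.I) ^ 2 = -κ ^ 2 := by rw [mul_pow, Complex.I_sq]; ring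
  have h1 := omega_add hp (κ * Complex.I)
  have h2 := omega_mul hp (κ * Complex.I)
  rw [hI] at h1 h2
  have h3 : (p.omega1 (κ * Complex.I) + y) * (p.omega2 (κ * Complex.I) + y) = 0 := by
    linear_combination h2 + y * h1 - hκ'
  have h4 : p.omega1 (κ * Complex.I) + y ≠ 0 := fun h => by
    have := congrArg Complex.re h
    simp only [Complex.add_re, Complex.ofReal_re, Complex.zero_re] at this
    linarith [re_omega1_pos hp (κ * Complex.I)]
  have h5 := (mul_eq_zero.1 h3).resolve_left h4
  exact ⟨eq_neg_of_add_eq_zero_left h5, by linear_combination h1 - h5⟩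

/-- At `iκ` the function `dhat` becomes `i e^{-κl} numQ 0`. The choices `s = 1` with `x` and `s =
-1` with `2l - x` supply the two exponentials of `numE` and `numQ`. -/
lemma term_residue (hp : p.IsPhysical) {y κ : ℝ} (hy : 0 < y) (hκ0 : 0 < κ)
    (hκ : κ ^ 2 * (p.rc * y + p.rb) = y * (y + p.ra)) (x : ℝ) (s : ℂ) (i : Fin 2) :
    (π / κ : ℂ) * (p.term x s i (κ * Complex.I) (p.omega2 (κ * Complex.I))
      (p.omega1 (κ * Complex.I)) * (y + p.omega1 (κ * Complex.I)) / (p.rc * y + p.rb)) =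
    2 * π * ((Real.exp (κ * (p.l - x)) : ℝ) * (κ * p.γ + s * y) / (p.numQ 0 κ y : ℝ)) *
      ![(κ / y : ℂ), s] i := by
  obtain ⟨h1, h2⟩ := omega_at_pole hp hy hκ
  set w := p.omega1 (κ * Complex.I) with hw
  have hN : 0 < p.numQ 0 κ y := lt_of_lt_of_le
    (by have := hp.l_pos; positivity) (numQ_zero_ge hp hκ0.le hy.le)
  have hN' : ((p.numQ 0 κ y : ℝ) : ℂ) ≠ 0 := by exact_mod_cast hN.ne'
  have hwy : w + y ≠ 0 := fun h => by
    have := congrArg Complex.re h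
    simp only [Complex.add_re, Complex.ofReal_re, Complex.zero_re] at this
    linarith [re_omega1_pos hp (κ * Complex.I)]
  have hcb : (p.rc * y + p.rb : ℂ) ≠ 0 := by
    have : 0 < p.rc * y + p.rb := by
      have := hp.rc_pos
      have := hp.rb_pos
      positivity
    exact_mod_cast this.ne'
  have hy' : (y : ℂ) ≠ 0 := by exact_mod_cast hy.ne'
  have hκ0' : (κ : ℂ) ≠ 0 := by exact_mod_cast hκ0.ne'
  have hκ' : (κ : ℂ) ^ 2 * (p.rc * y + p.rb) = y * (y + p.ra) := by exact_mod_cast hκ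
  have hL : p.expL (κ * Complex.I) = (Real.exp (-(κ * p.l)) : ℝ) := by
    rw [expL, Complex.ofReal_exp]
    congr 1
    push_cast
    linear_combination κ * p.l * Complex.I_sq
  have hX : Complex.exp (Complex.I * (κ * Complex.I) * x) = (Real.exp (-(κ * x)) : ℝ) := by
    rw [Complex.ofReal_exp]
    congr 1
    push_cast
    linear_combination κ * x * Complex.I_sq
  have hll : Real.exp (-(κ * p.l)) * Real.exp (κ * p.l) = 1 := by rw [← Real.exp_add]; simp
  have hd : p.dhat (κ * Complex.I) (-y) =
      Complex.I * (Real.exp (-(κ * p.l)) : ℝ) * (p.numQ 0 κ y : ℝ) := by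
    have e1 : ((Real.exp (-(κ * p.l)) : ℝ) : ℂ) * (Real.exp (κ * p.l) : ℝ) = 1 := by
      exact_mod_cast hll
    rw [dhat, hL, numQ, sub_zero]
    generalize Real.exp (-(κ * p.l)) = a at e1 ⊢
    generalize Real.exp (κ * p.l) = b at e1 ⊢
    push_cast
    linear_combination -Complex.I * (y + κ * p.γ) * e1
  have hE : ((Real.exp (κ * (p.l - x)) : ℝ) : ℂ) * (Real.exp (-(κ * p.l)) : ℝ) =
      (Real.exp (-(κ * x)) : ℝ) := by
    rw [← Complex.ofReal_mul, ← Real.exp_add]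
    ring_nf
  have hl0 : ((Real.exp (-(κ * p.l)) : ℝ) : ℂ) ≠ 0 := by exact_mod_cast (Real.exp_pos _).ne'
  have hvec : ![1, s * (-(y : ℂ) / (Complex.I * (κ * Complex.I)))] i =
      y / κ * ![(κ / y : ℂ), s] i := by
    fin_cases i
    · simp only [Fin.zero_eta, Matrix.cons_val_zero]; field_simp
    · simp only [Fin.mk_one, Matrix.cons_val_one, Matrix.cons_val_fin_one]
      field_simp
      linear_combination (-s) * Complex.I_sq
  have hθ : w - p.theta * (κ * Complex.I) ^ 2 = p.ra + y := by
    rw [theta_eq, mul_pow, Complex.I_sq]; linear_combination h2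
  rw [term, kernel, ← hw, h1, hd, hX, hθ, hvec, ← hE]
  generalize ((Real.exp (-(κ * p.l)) : ℝ) : ℂ) = a at hl0 ⊢
  generalize ((Real.exp (κ * (p.l - x)) : ℝ) : ℂ) = b
  generalize ![(κ / y : ℂ), s] i = c
  have e3 : (p.ra : ℂ) + y = κ ^ 2 * (p.rc * y + p.rb) / y := by
    field_simp; linear_combination -hκ'
  have e4 : p.γ * ((κ : ℂ) * Complex.I) - s * (Complex.I * -y) =
      Complex.I * (κ * p.γ + s * y) := by ring
  have hI := Complex.I_ne_zero
  rw [e3, e4, sub_neg_eq_add, add_comm (y : ℂ) w, mul_comm (p.rc : ℂ) y]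
  rw [mul_comm (p.rc : ℂ) y] at hcb
  field_simp

/-! ### The representation of solutions -/

/-- The ratio of the Laplace transforms of the `i`-th component of a solution and of `g`. -/
def transfer (p : GKParams) (x : ℝ) (i : Fin 2) (y : ℝ) : ℝ :=
  ![p.kap y / y * (p.numE x (p.kap y) y / p.numQ 0 (p.kap y) y),
    p.numQ x (p.kap y) y / p.numQ 0 (p.kap y) y] i

section Final

variable {g : ℝ → ℝ} {M R x : ℝ}

/-- Expanding by `y + ω₁` replaces the denominator by `(rc y + rb)(k² + κ²)`, so the only
singularity enclosed is a simple pole at `iκ`. The residue theorem applies to the remaining factor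
`h`, which is holomorphic and bounded far out. -/
lemma integral_weight_div (hp : p.IsPhysical) (hR : p.Admissible R) (hx : x ∈ Ioc 0 p.l)
    (i : Fin 2) {Λ : ℝ} (hre : ∀ v, -Λ ≤ (p.omega2 (p.contourPlus R v)).re) {y : ℝ}
    (hy0 : 0 < y) (hy : Λ + 1 ≤ y) (hκ : R < p.kap y) :
    ∫ v, (p.weight R x 1 i v - p.weight R (2 * p.l - x) (-1) i v) /
      (y + p.omega2 (p.contourPlus R v)) = 2 * π * (p.transfer x i y : ℝ) := by
  have hκ0 : 0 < p.kap y := hR.1.trans hκ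
  have hκy := kap_sq_mul hp hy0.le
  have hx2 : 0 < 2 * p.l - x := by linarith [hx.2, hp.l_pos]
  obtain ⟨S₁, hS₁, C₁, hC₁, hb₁⟩ := exists_norm_term_le hp hx.1 (s := 1) (by simp) i
  obtain ⟨S₂, hS₂, C₂, hC₂, hb₂⟩ := exists_norm_term_le hp hx2 (s := -1) (by simp) i
  have hcb0 : 0 < p.rc * y + p.rb := by
    have := hp.rc_pos
    have := hp.rb_pos
    positivity
  have hcb : (p.rc * y + p.rb : ℂ) ≠ 0 := by exact_mod_cast hcb0.ne'
  have hW := omegaBound_pos hp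
  set h : ℂ → ℂ := fun k => (p.term x 1 i k (p.omega2 k) (p.omega1 k) -
    p.term (2 * p.l - x) (-1) i k (p.omega2 k) (p.omega1 k)) * (y + p.omega1 k) /
      (p.rc * y + p.rb)
  have key := integral_contourPlus_pole hp hR.1 hκ (h := h) (S := max S₁ S₂)
    (C := (C₁ + C₂) * (y + p.omegaBound) / (p.rc * y + p.rb)) (fun k hk => ?_) fun k hk hSk => ?_
  · have e1 : ∀ v, (p.weight R x 1 i v - p.weight R (2 * p.l - x) (-1) i v) /
        (y + p.omega2 (p.contourPlus R v)) = deriv (p.contourPlus R) v *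
          (h (p.contourPlus R v) / (p.contourPlus R v ^ 2 + (p.kap y : ℂ) ^ 2)) := by
      intro v
      have hκ' : (p.kap y : ℂ) ^ 2 * (p.rc * y + p.rb) = y * (y + p.ra) := by exact_mod_cast hκy
      have n2 : (y : ℂ) + p.omega2 (p.contourPlus R v) ≠ 0 := fun h => by
        have := congrArg Complex.re h
        simp only [Complex.add_re, Complex.ofReal_re, Complex.zero_re] at this
        linarith [hre v]
      simp only [weight, h]
      generalize p.contourPlus R v = k at n2 ⊢
      have n1 : (y : ℂ) + p.omega1 k ≠ 0 := fun h => by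
        have := congrArg Complex.re h
        simp only [Complex.add_re, Complex.ofReal_re, Complex.zero_re] at this
        linarith [re_omega1_pos hp k]
      have hprod : ((y : ℂ) + p.omega1 k) * (y + p.omega2 k) =
          (p.rc * y + p.rb) * (k ^ 2 + (p.kap y : ℂ) ^ 2) := by
        linear_combination y * omega_add hp k + omega_mul hp k - hκ'
      rw [div_div, ← hprod, mul_comm (_ - _) (y + p.omega1 k : ℂ), mul_div_mul_left _ _ n1]
      ring
    rw [integral_congr_ae (Eventually.of_forall e1), key]
    have r1 := term_residue hp hy0 hκ0 hκy x 1 i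
    have r2 := term_residue hp hy0 hκ0 hκy (2 * p.l - x) (-1) i
    rw [show p.kap y * (p.l - (2 * p.l - x)) = -(p.kap y * (p.l - x)) by ring] at r2
    have e2 : (2 * π * ((p.numE x (p.kap y) y : ℝ) / (p.numQ 0 (p.kap y) y : ℝ) *
        ![(p.kap y / y : ℂ), 0] i + (p.numQ x (p.kap y) y : ℝ) / (p.numQ 0 (p.kap y) y : ℝ) *
        ![(0 : ℂ), 1] i) : ℂ) = 2 * π * (p.transfer x i y : ℝ) := by
      rw [transfer]
      fin_cases i <;> simp [mul_comm]
    rw [← e2]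
    simp only [h]
    have e3 : (![(p.kap y / y : ℂ), 1] i = ![(p.kap y / y : ℂ), 0] i + ![(0 : ℂ), 1] i) ∧
        (![(p.kap y / y : ℂ), -1] i = ![(p.kap y / y : ℂ), 0] i - ![(0 : ℂ), 1] i) := by
      fin_cases i <;> simp
    rw [e3.1] at r1
    rw [e3.2] at r2
    generalize p.numQ 0 (p.kap y) y = N at r1 r2 ⊢
    rw [numE, numQ]
    push_cast at r1 r2 ⊢
    linear_combination r1 - r2
  · have h1 := differentiableAt_omega1 hp hk.2.2
    have h2 := differentiableAt_term_omega2 hp hR hk x 1 i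
    have h3 := differentiableAt_term_omega2 hp hR hk (2 * p.l - x) (-1) i
    exact ((h2.sub h3).mul ((differentiableAt_const _).add h1)).div_const _
  · have h1 := (hb₁ k ⟨hk.1, (le_max_left _ _).trans hSk, hk.2.2⟩).2
    have h2 := (hb₂ k ⟨hk.1, (le_max_right _ _).trans hSk, hk.2.2⟩).2
    have h3 := (norm_omega1_bounds hp (re_omega2_nonpos hp hk.2.2)).2
    rw [← omegaBound] at h3
    have hk1 : 1 ≤ ‖k‖ ^ 2 := one_le_pow₀ (hS₁.trans ((le_max_left _ _).trans hSk))
    have h4 : ‖p.term x 1 i k (p.omega2 k) (p.omega1 k) -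
        p.term (2 * p.l - x) (-1) i k (p.omega2 k) (p.omega1 k)‖ ≤ C₁ + C₂ :=
      (norm_sub_le _ _).trans (add_le_add (h1.trans (div_le_self hC₁ hk1))
        (h2.trans (div_le_self hC₂ hk1)))
    have h5 : ‖(y : ℂ) + p.omega1 k‖ ≤ y + p.omegaBound := by
      refine (norm_add_le _ _).trans ?_
      rw [Complex.norm_of_nonneg hy0.le]
      linarith
    have h6 : ‖(p.rc * y + p.rb : ℂ)‖ = p.rc * y + p.rb := by
      rw [← Complex.norm_of_nonneg hcb0.le]
      push_cast
      rfl
    simp only [h]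
    rw [norm_div, norm_mul, h6]
    gcongr

/-- The difference of the two sides has a truncated Laplace transform of size `e^{-yT'}`: by `hlap`
for `u`, by `laplace_superposition` and `integral_weight_div` for the contour integral. Hence
`eq_zero_of_laplace_le` annihilates it. -/
lemma eq_superposition (hp : p.IsPhysical) (hR : p.Admissible R) (hg : Integrable g)
    (hM : ∀ s, |g s| ≤ M) {T' T : ℝ} (hT' : 0 < T') (hTT : T' ≤ T) (hgc : ContinuousOn g (Ioo 0 T))
    (hx : x ∈ Ioc 0 p.l) (i : Fin 2) {u : ℝ → ℝ} (hu : IntervalIntegrable u volume 0 T) {C : ℝ}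
    (hlap : ∀ᶠ y in atTop,
      |lap u T y - p.transfer x i y * lap g T y| ≤ C * Real.exp (-y * T'))
    {t : ℝ} (ht : t ∈ Ioo 0 T') (hc : ContinuousAt u t) :
    (u t : ℂ) = 1 / (2 * π) * ∫ v, (p.weight R x 1 i v - p.weight R (2 * p.l - x) (-1) i v) *
      timeTransform g (p.omega2 (p.contourPlus R v)) t := by
  have hx2 : 0 < 2 * p.l - x := by linarith [hx.2, hp.l_pos]
  have hT : 0 ≤ T := hT'.le.trans hTT
  obtain ⟨Λ, hΛ, hre⟩ := exists_le_re_omega2 hp hR.1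
  have hw : Integrable fun v => p.weight R x 1 i v - p.weight R (2 * p.l - x) (-1) i v :=
    (integrable_weight hp hR hx.1 (by simp) i).sub (integrable_weight hp hR hx2 (by simp) i)
  have hW := continuous_omega2_contourPlus hp hR.1
  set φ : ℝ → ℂ := fun t => ∫ v, (p.weight R x 1 i v - p.weight R (2 * p.l - x) (-1) i v) *
      timeTransform g (p.omega2 (p.contourPlus R v)) t
  have hφ : ContinuousOn φ (Icc 0 T) := continuousOn_superposition hg hM hw hW hΛ hre T
  set B := (∫ v, ‖p.weight R x 1 i v - p.weight R (2 * p.l - x) (-1) i v‖) *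
    (M * Real.exp (Λ * T) * T)
  have hM0 : 0 ≤ M := (abs_nonneg _).trans (hM 0)
  have hB : 0 ≤ B := mul_nonneg (integral_nonneg fun _ => norm_nonneg _) (by positivity)
  have hφi : IntervalIntegrable (fun t => 1 / (2 * π) * φ t) volume 0 T :=
    (continuousOn_const.mul (by rwa [uIcc_of_le hT])).intervalIntegrable
  have hui : IntervalIntegrable (fun t => (u t : ℂ)) volume 0 T := ⟨hu.1.ofReal, hu.2.ofReal⟩
  have hcast : ∀ (f : ℝ → ℝ) (y : ℝ),
      ∫ t in (0 : ℝ)..T, ((Real.exp (-y * t) : ℝ) : ℂ) * (f t : ℂ) = (lap f T y : ℝ) := by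
    intro f y
    rw [lap, ← intervalIntegral.integral_ofReal]
    exact intervalIntegral.integral_congr fun s _ => (Complex.ofReal_mul _ _).symm
  obtain ⟨y₀, hy₀⟩ := eventually_atTop.1 (hlap.and ((eventually_lt_kap hp R).and
    ((eventually_ge_atTop (Λ + 1)).and (eventually_gt_atTop 0))))
  refine sub_eq_zero.1 (eq_zero_of_laplace_le hT' hTT (F := fun t => (u t : ℂ) - 1 / (2 * π) * φ t)
    (hui.sub hφi) (C := C + B / (2 * π)) (x₀ := y₀) (fun y hy => ?_) ht ?_)
  · obtain ⟨h1, h2, h3, h4⟩ := hy₀ y hy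
    have hE : ContinuousOn (fun t : ℝ => ((Real.exp (-y * t) : ℝ) : ℂ)) (uIcc 0 T) := by fun_prop
    have k1 := laplace_superposition hg hM hw hW hΛ hre hT hgc h3
    rw [integral_weight_div hp hR hx i hre h4 h3 h2, hcast] at k1
    have k2 : (∫ t in (0 : ℝ)..T, ((Real.exp (-y * t) : ℝ) : ℂ) * ((u t : ℂ) - 1 / (2 * π) * φ t)) =
        ((lap u T y - p.transfer x i y * lap g T y : ℝ) : ℂ) - 1 / (2 * π) *
        ((∫ t in (0 : ℝ)..T, ((Real.exp (-y * t) : ℝ) : ℂ) * φ t) -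
          2 * π * (p.transfer x i y : ℝ) * (lap g T y : ℝ)) := by
      simp only [mul_sub]
      rw [intervalIntegral.integral_sub (hui.continuousOn_mul hE) (hφi.continuousOn_mul hE), hcast,
        ← intervalIntegral.integral_const_mul]
      have hπ : (π : ℂ) ≠ 0 := by exact_mod_cast Real.pi_ne_zero
      have e1 : ∀ a : ℂ, 1 / (2 * (π : ℂ)) * (2 * π * a) = a := fun a => by field_simp
      rw [mul_assoc (2 * (π : ℂ)), e1]
      push_cast
      simp only [mul_left_comm (1 / (2 * (π : ℂ)))]
      ring
    have hexp : Real.exp (-y * T) ≤ Real.exp (-y * T') := Real.exp_le_exp.2 (by nlinarith)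
    rw [k2]
    refine (norm_sub_le _ _).trans ?_
    rw [Complex.norm_real, Real.norm_eq_abs, norm_mul, add_mul]
    have e2 : ‖1 / (2 * (π : ℂ))‖ = 1 / (2 * π) := by
      rw [norm_div, norm_mul, Complex.norm_of_nonneg Real.pi_pos.le]; simp
    rw [e2]
    refine add_le_add h1 ?_
    calc _ ≤ 1 / (2 * π) * (B * Real.exp (-y * T)) := by gcongr
      _ ≤ 1 / (2 * π) * (B * Real.exp (-y * T')) := by gcongr
      _ = _ := by ring
  · exact (Complex.continuous_ofReal.continuousAt.comp hc).sub (continuousAt_const.mul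
      (hφ.continuousAt (Icc_mem_nhds ht.1 (ht.2.trans_le hTT))))

lemma explicitIntegrand_congr {g' : ℝ → ℝ} {t : ℝ} (ht : 0 ≤ t) (h : ∀ s ∈ Ioc 0 t, g s = g' s)
    (k : ℂ) : p.explicitIntegrand g k t = p.explicitIntegrand g' k t := by
  simp only [explicitIntegrand, gT1, gT2, timeTransform_congr ht h]

lemma representation (hp : p.IsPhysical) (hR : p.Admissible R) {e q : ℝ → ℝ → ℝ}
    (hs : p.IsSolution g e q) (hx : x ∈ Ioc 0 p.l) {t : ℝ} (ht : 0 < t) (i : Fin 2) :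
    (Integrable (fun v => deriv (p.contourPlus R) v *
        (Complex.exp (Complex.I * p.contourPlus R v * x) *
          p.explicitIntegrand g (p.contourPlus R v) t i)) ∧
      Integrable (fun v => deriv (p.contourMinus R) v *
        (Complex.exp (Complex.I * p.contourMinus R v * x) *
          p.explicitIntegrand g (p.contourMinus R v) t i))) ∧
    ![(e x t : ℂ), (q x t : ℂ)] i = -(1 / (2 * (π : ℂ)) *
      ∫ v, deriv (p.contourPlus R) v * (Complex.exp (Complex.I * p.contourPlus R v * x) *
          p.explicitIntegrand g (p.contourPlus R v) t i)) - 1 / (2 * (π : ℂ)) *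
      ∫ v, deriv (p.contourMinus R) v * (Complex.exp (Complex.I * p.contourMinus R v * x) *
          p.explicitIntegrand g (p.contourMinus R v) t i) := by
  -- Any `t < T' < T` would serve; below `T' = t + 1`. Cutting `g` off outside `(0, T]` makes it
  -- bounded and integrable on the line and does not affect its time transforms at `t`.
  set T := t + 2
  have hT : 0 < T := by positivity
  obtain ⟨M, hM⟩ := hs.bounded T
  have hl := hp.l_pos
  have h0 : (0 : ℝ) ∈ Icc 0 p.l := ⟨le_rfl, hl.le⟩
  have hx' : x ∈ Icc 0 p.l := ⟨hx.1.le, hx.2⟩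
  set g₀ := (Ioc 0 T).indicator g
  have hgc : ContinuousOn g (Ioi 0) :=
    (hs.continuousOn_time h0).2.congr fun s hs' => (hs.left_flux s hs').symm
  have hgM : ∀ s ∈ Ioc 0 T, |g s| ≤ M := fun s hs' => by
    rw [← hs.left_flux s hs'.1]; exact (hM 0 h0 s ⟨hs'.1.le, hs'.2⟩).2
  have hM0 : 0 ≤ M := (abs_nonneg _).trans (hgM T ⟨hT, le_rfl⟩)
  have hg₀M : ∀ s, |g₀ s| ≤ M := fun s => by
    by_cases h : s ∈ Ioc 0 T
    · simpa only [g₀, indicator_of_mem h] using hgM s h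
    · simpa only [g₀, indicator_of_notMem h, abs_zero] using hM0
  have hgg : ∀ s ∈ Ioc 0 T, g s = g₀ s := fun s h => (indicator_of_mem h g).symm
  have hg₀ : Integrable g₀ := by
    rw [integrable_indicator_iff measurableSet_Ioc]
    refine IntegrableOn.of_bound (by simp)
      ((hgc.mono Ioc_subset_Ioi_self).aestronglyMeasurable measurableSet_Ioc) M ?_
    exact (ae_restrict_iff' measurableSet_Ioc).2 (Eventually.of_forall hgM)
  have hg₀c : ContinuousOn g₀ (Ioo 0 T) :=
    (hgc.mono Ioo_subset_Ioi_self).congr fun s h => (hgg s ⟨h.1, h.2.le⟩).symm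
  have hlapg : ∀ y, lap g T y = lap g₀ T y := fun y => by
    rw [lap, lap, intervalIntegral.integral_of_le hT.le, intervalIntegral.integral_of_le hT.le]
    exact setIntegral_congr_fun measurableSet_Ioc fun s h => by simp only [hgg s h]
  have hcongr : ∀ k, p.explicitIntegrand g k t = p.explicitIntegrand g₀ k t := fun k =>
    explicitIntegrand_congr ht.le (fun s h => hgg s ⟨h.1, h.2.trans (by simp [T])⟩) k
  simp only [hcongr]
  obtain ⟨hi, hsum⟩ := integral_contour_components hp hR hg₀ hg₀M hx ht.le i
  refine ⟨hi, ?_⟩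
  rw [← neg_add', ← mul_add, hsum, mul_neg, neg_neg]
  have hTT : t + 1 < T := by simp only [T]; linarith
  obtain ⟨C, hC⟩ := hs.lap_asymptotics hp hT hTT hx'
  have ht1 : t ∈ Ioo 0 (t + 1) := ⟨ht, by linarith⟩
  have ht0 : (0 : ℝ) < t + 1 := by linarith
  simp only [hlapg] at hC
  obtain ⟨hec, hqc⟩ := hs.continuousOn_time hx'
  obtain ⟨hei, hqi⟩ := hs.intervalIntegrable_time hx' hT.le
  fin_cases i
  · exact eq_superposition hp hR hg₀ hg₀M ht0 hTT.le hg₀c hx 0 hei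
      (hC.mono fun y h => h.1) ht1 (hec.continuousAt (Ioi_mem_nhds ht))
  · exact eq_superposition hp hR hg₀ hg₀M ht0 hTT.le hg₀c hx 1 hqi
      (hC.mono fun y h => h.2) ht1 (hqc.continuousAt (Ioi_mem_nhds ht))

end Final

end

end GKParams

theorem mainTheorem2 (p : GKParams) (hτ : 0 < p.τ) (hα : 0 < p.α) (hμ : 0 < p.μ)
    (hγ : 0 ≤ p.γ) (hl : 0 < p.l) :
    -- the two integrands coincide and have the explicit form
    (∀ (g : ℝ → ℝ) (k : ℂ) (t : ℝ), p.RegularAt k →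
      p.S k *ᵥ p.aVec g k t = p.expL (-k) • (p.S k *ᵥ p.bVec g k t) ∧
      p.expL (-k) • (p.S k *ᵥ p.bVec g k t) = p.explicitIntegrand g k t) ∧
    -- all sufficiently large radii are admissible
    (∃ R₀ > 0, ∀ R ≥ R₀, p.Admissible R) ∧
    -- the contours trace the boundaries of the domains
    (∀ R > 0, range (p.contourPlus R) = frontier (p.D0Plus R) ∧
      range (p.contourMinus R) = frontier (p.D0Minus R)) ∧
    -- every solution is given by the two contour integrals
    (∀ R : ℝ, p.Admissible R → ∀ (g : ℝ → ℝ) (e q : ℝ → ℝ → ℝ), p.IsSolution g e q →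
      ∀ x ∈ Ioc 0 p.l, ∀ t > 0,
        GKParams.PathIntegrable (p.contourPlus R)
          (fun k => Complex.exp (Complex.I * k * (x : ℂ)) • (p.S k *ᵥ p.aVec g k t)) ∧
        GKParams.PathIntegrable (p.contourMinus R)
          (fun k => Complex.exp (Complex.I * k * (x : ℂ)) •
            (p.expL (-k) • (p.S k *ᵥ p.bVec g k t))) ∧
        ![(e x t : ℂ), (q x t : ℂ)] =
          -((1 / (2 * (π : ℂ))) • GKParams.pathIntegral (p.contourPlus R)
              (fun k => Complex.exp (Complex.I * k * (x : ℂ)) • (p.S k *ᵥ p.aVec g k t)))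
          - (1 / (2 * (π : ℂ))) • GKParams.pathIntegral (p.contourMinus R)
              (fun k => Complex.exp (Complex.I * k * (x : ℂ)) •
                (p.expL (-k) • (p.S k *ᵥ p.bVec g k t)))) := by
  have hp : p.IsPhysical := ⟨hτ, hα, hμ, hγ, hl⟩
  have hab : ∀ (g : ℝ → ℝ) (k : ℂ) (t : ℝ), p.RegularAt k →
      p.S k *ᵥ p.aVec g k t = p.explicitIntegrand g k t := fun g k t hk => by
    rw [GKParams.aVec_eq p g k t hk, Matrix.mulVec_smul, GKParams.S_mulVec_bVec]
  refine ⟨fun g k t hk => ⟨?_, GKParams.S_mulVec_bVec p g k t⟩, GKParams.exists_admissible hp,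
    fun R hR => ⟨GKParams.range_contourPlus hp hR, GKParams.range_contourMinus hp hR⟩,
    fun R hR g e q hs x hx t ht => ?_⟩
  · rw [hab g k t hk, GKParams.S_mulVec_bVec]
  have hreg : ∀ v, p.RegularAt (p.contourPlus R v) := fun v =>
    have hm := (GKParams.contourPlus_mem hp hR.1 v).1
    hR.2 _ (GKParams.mem_closure_D hp hR.1 hm) hm.2.1
  have hrep := GKParams.representation hp hR hs hx ht
  have e1 : (fun v => deriv (p.contourPlus R) v •
      (Complex.exp (Complex.I * p.contourPlus R v * (x : ℂ)) •
        (p.S (p.contourPlus R v) *ᵥ p.aVec g (p.contourPlus R v) t))) = fun v =>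
      deriv (p.contourPlus R) v • (Complex.exp (Complex.I * p.contourPlus R v * (x : ℂ)) •
        p.explicitIntegrand g (p.contourPlus R v) t) := by
    funext v
    rw [hab _ _ _ (hreg v)]
  have i1 : Integrable (fun v => deriv (p.contourPlus R) v •
      (Complex.exp (Complex.I * p.contourPlus R v * (x : ℂ)) •
        p.explicitIntegrand g (p.contourPlus R v) t)) :=
    Integrable.of_eval fun i => (hrep i).1.1
  have i2 : Integrable (fun v => deriv (p.contourMinus R) v •
      (Complex.exp (Complex.I * p.contourMinus R v * (x : ℂ)) •
        p.explicitIntegrand g (p.contourMinus R v) t)) :=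
    Integrable.of_eval fun i => (hrep i).1.2
  simp only [GKParams.S_mulVec_bVec, GKParams.PathIntegrable, GKParams.pathIntegral, e1]
  refine ⟨i1, i2, funext fun i => ?_⟩
  simp only [Pi.sub_apply, Pi.neg_apply, Pi.smul_apply, smul_eq_mul]
  rw [eval_integral fun i => i1.eval i, eval_integral fun i => i2.eval i]
  exact (hrep i).2
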